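/- Let $k$ be an algebraically closed field and let $\mathcal A$ be a $k$-linear abelian category which is - connected: any two indecomposable objects are linked by an unoriented path of non-zero maps between indecomposable objects; - 1-Calabi–Yau: all $\operatorname{Ext}^n_{\mathcal A}(X,Y)$ are finite dimensional over $k$, and the shift $[1]$ is a Serre functor of $\mathcal C = D^b(\mathcal A)$, i.e. there are isomorphisms $\operatorname{Hom}_{\mathcal C}(X,Y)\cong \operatorname{Hom}_{\mathcal C}(Y,X[1])^*$ natural in $X,Y$. Let $E,B\in\mathcal A$ be non-isomorphic endo-simple objects (that is, $\operatorname{End}(E)\cong k\cong\operatorname{End}(B)$) with $\operatorname{Hom}(E,B)\neq 0$. Let $T_B$ be the twist functor along $B$ on $\mathcal C$, given on objects by $T_BX=\operatorname{cone}(B\otimes \operatorname{RHom}(B,X)\to X)$ with the canonical map; its inverse is given on objects by the triangle $T_B^*X\to X\to B\otimes\operatorname{RHom}(X,B)^*\to T_B^*X[1]$. Put $E_i=T_B^iE$ for $i\in\mathbb Z$, where $T_B^{-1}=T_B^*$. Let $D^{\le 0}\subseteq\mathcal C$ be the full subcategory of finite direct sums of indecomposable objects $X$ of $\mathcal C$ such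 that for some $i\in\mathbb Z$ there is a path $E_i\to X_1\to\cdots\to X$ of non-zero maps between indecomposable objects of $\mathcal C$, and let $D^{\ge 1}$ be the full subcategory of finite direct sums of the other indecomposable objects. Then $(D^{\le 0},D^{\ge 1})$ defines a $t$-structure on $\mathcal C$ which is bounded ($\bigcap_n D^{\le n}=\bigcap_n D^{\ge n}=\{0\}$) and split (all triangles $X\to Y\to Z\to X[1]$ with $X\in D^{\le 0}$, $Z\in D^{\ge 1}$ split), all $E_i$ lie in its heart $\mathcal H=D^{\le 0}\cap D^{\ge 0}$, and the sequence $(E_i)_{i\in\mathbb Z}$ is ample in $\mathcal H$, that is: 1. (projective) for every epimorphism $X\to Y$ in $\mathcal H$ there is $n\in\mathbb Z$ such that $\operatorname{Hom}(E_i,X)\to\operatorname{Hom}(E_i,Y)$ is surjective for all $i<n$; 2. (coherent) for every $X\in\mathcal H$ and $n\in\mathbb Z$ there are integers $i_1,\dots,i_s\le n$ such that the canonical map $\bigoplus_{j=1}^s\operatorname{Hom}(E_i,E_{i_j})\otimes_k\operatorname{Hom}(E_{i_j},X)\to\operatorname{Hom}(E_i,X)$ is surjective for all $i\ll 0$; 3.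 (ample) for every non-zero $X\in\mathcal H$ one has $\operatorname{Hom}(E_i,X)\neq0$ for all $i\ll0$. -/

import Mathlib

open CategoryTheory CategoryTheory.Limits CategoryTheory.Pretriangulated
open CategoryTheory.Triangulated
open scoped TensorProduct DirectSum ZeroObject

universe w w' v u t

noncomputable section

namespace OneCY

/-! ### Abelian categories: finiteness, connectedness, endo-simple objects -/

/-- A `k`-linear abelian category is Ext-finite if all its Ext-groups are finite dimensional. -/
def ExtFinite (k : Type t) [Field k] (A : Type u) [Category.{v} A] [Abelian A] [Linear k A]
    [HasExt.{w'} A] : Prop :=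
  ∀ (X Y : A) (n : ℕ), Module.Finite k (Abelian.Ext X Y n)

/-- `IndecArrow X Y`: the objects `X`, `Y` are indecomposable and there is a non-zero map from
`X` to `Y`. -/
def IndecArrow {C : Type u} [Category.{v} C] [Preadditive C] [HasBinaryBiproducts C]
    (X Y : C) : Prop :=
  Indecomposable X ∧ Indecomposable Y ∧ ∃ f : X ⟶ Y, f ≠ 0

/-- There is an oriented path `X = X₀ ⟶ X₁ ⟶ ⋯ ⟶ Xₙ = Y` of non-zero maps between
indecomposable objects. -/
def HasPath {C : Type u} [Category.{v} C] [Preadditive C] [HasBinaryBiproducts C]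
    (X Y : C) : Prop :=
  Relation.ReflTransGen IndecArrow X Y

/-- Any two indecomposable objects are linked by an unoriented path of non-zero maps between
indecomposable objects. -/
def IndecConnected (C : Type u) [Category.{v} C] [Preadditive C] [HasBinaryBiproducts C] :
    Prop :=
  ∀ X Y : C, Indecomposable X → Indecomposable Y → Relation.EqvGen IndecArrow X Y

/-- An object is endo-simple if its endomorphism algebra is `k`. -/
def EndoSimple (k : Type t) [Field k] {C : Type u} [Category.{v} C] [Preadditive C]
    [Linear k C] (X : C) : Prop :=
  Nonempty (End X ≃ₐ[k] k)

/-! ### The bounded derived category and the Calabi-Yau property -/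

/-- The shift `[1]` is a Serre functor of the triangulated category `C`: there are isomorphisms
`Hom(X, Y) ≃ Hom(Y, X[1])^*`, natural in `X` and in `Y`. -/
def ShiftOneIsSerreFunctor (k : Type t) [Field k] (C : Type u) [Category.{v} C] [Preadditive C]
    [Linear k C] [HasShift C ℤ] : Prop :=
  ∃ η : ∀ X Y : C, (X ⟶ Y) ≃ₗ[k] Module.Dual k (Y ⟶ X⟦(1 : ℤ)⟧),
    ∀ (X X' Y Y' : C) (a : X' ⟶ X) (f : X ⟶ Y) (b : Y ⟶ Y') (h : Y' ⟶ X'⟦(1 : ℤ)⟧),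
      η X' Y' (a ≫ f ≫ b) h = η X Y f (b ≫ h ≫ a⟦(1 : ℤ)⟧')

/-- An abelian category is `1`-Calabi-Yau if it is Ext-finite and the shift `[1]` is a Serre
functor of its bounded derived category. -/
def IsOneCalabiYau (k : Type t) [Field k] (A : Type u) [Category.{v} A] [Abelian A] [Linear k A]
    [HasExt.{w'} A] [HasDerivedCategory.{w} A] : Prop :=
  ExtFinite k A ∧ ShiftOneIsSerreFunctor k (DerivedCategory.Bounded A)

/-- An object of `A`, regarded as an object of the bounded derived category that is
concentrated in degree `0`. -/
def toDb {A : Type u} [Category.{v} A] [Abelian A] [HasDerivedCategory.{w} A] (X : A) :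
    DerivedCategory.Bounded A where
  obj := (DerivedCategory.singleFunctor A 0).obj X
  property := ⟨⟨0, inferInstance⟩, ⟨0, inferInstance⟩⟩

/-! ### Twist functors, on objects

For objects `B`, `X` the object `B ⊗ RHom(B, X)` is the direct sum of the
`B[n] ⊗ Hom(B[n], X)`, that is, a coproduct of copies of the `B[n]`, one for each member of a
basis of `Hom(B[n], X)`; the canonical morphism to `X` has these basis elements as components.
Dually, `B ⊗ RHom(X, B)^*` is the product of copies of the `B[n]`, one for each member of a basis
of `Hom(X, B[n])`. -/

section Twist

variable (k : Type t) [Field k] {C : Type u} [Category.{v} C] [Preadditive C] [Linear k C]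
  [HasZeroObject C] [HasShift C ℤ] [∀ n : ℤ, (shiftFunctor C n).Additive] [Pretriangulated C]

/-- Pairs `(n, f)` with `f` in a basis of `Hom(B[n], X)`. -/
abbrev EvIndex (B X : C) : Type _ :=
  Σ n : ℤ, Module.Basis.ofVectorSpaceIndex k (B⟦n⟧ ⟶ X)

/-- Pairs `(n, f)` with `f` in a basis of `Hom(X, B[n])`. -/
abbrev CoevIndex (B X : C) : Type _ :=
  Σ n : ℤ, Module.Basis.ofVectorSpaceIndex k (X ⟶ B⟦n⟧)

/-- `Y` is a cone of the canonical morphism `B ⊗ RHom(B, X) ⟶ X`. -/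
def IsTwist (B X Y : C) : Prop :=
  ∃ (c : Cofan fun p : EvIndex k B X => B⟦p.1⟧) (hc : IsColimit c)
    (g : X ⟶ Y) (h : Y ⟶ c.pt⟦(1 : ℤ)⟧),
    Triangle.mk (Cofan.IsColimit.desc hc fun p => (p.2 : B⟦p.1⟧ ⟶ X)) g h ∈ distTriang C

/-- There is a distinguished triangle `Y ⟶ X ⟶ B ⊗ RHom(X, B)^* ⟶ Y[1]` whose middle map is
the canonical morphism. -/
def IsCotwist (B X Y : C) : Prop :=
  ∃ (c : Fan fun p : CoevIndex k B X => B⟦p.1⟧) (hc : IsLimit c)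
    (f : Y ⟶ X) (h : c.pt ⟶ Y⟦(1 : ℤ)⟧),
    Triangle.mk f (Fan.IsLimit.lift hc fun p => (p.2 : X ⟶ B⟦p.1⟧)) h ∈ distTriang C

open Classical in
/-- The object `T_B X`, the cone of the canonical morphism `B ⊗ RHom(B, X) ⟶ X`, whenever
`B ⊗ RHom(B, X)` exists, which is the case if `⨁ₙ Hom(B[n], X)` is finite dimensional. -/
def twist (B X : C) : C :=
  if h : ∃ Y, IsTwist k B X Y then h.choose else 0

open Classical in
/-- The object `T_B^* X`, the cocone of the canonical morphism `X ⟶ B ⊗ RHom(X, B)^*`, whenever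
`B ⊗ RHom(X, B)^*` exists, which is the case if `⨁ₙ Hom(X, B[n])` is finite dimensional. -/
def cotwist (B X : C) : C :=
  if h : ∃ Y, IsCotwist k B X Y then h.choose else 0

lemma isTwist_twist (B X : C) [HasCoproduct fun p : EvIndex k B X => B⟦p.1⟧] :
    IsTwist k B X (twist k B X) := by
  have h : ∃ Y, IsTwist k B X Y := by
    obtain ⟨Y, g, h, H⟩ := Pretriangulated.distinguished_cocone_triangle
      (Cofan.IsColimit.desc (coproductIsCoproduct fun p : EvIndex k B X => B⟦p.1⟧)
        fun p => (p.2 : B⟦p.1⟧ ⟶ X))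
    exact ⟨Y, _, coproductIsCoproduct _, g, h, H⟩
  rw [twist, dif_pos h]
  exact h.choose_spec

lemma isCotwist_cotwist (B X : C) [HasProduct fun p : CoevIndex k B X => B⟦p.1⟧] :
    IsCotwist k B X (cotwist k B X) := by
  have h : ∃ Y, IsCotwist k B X Y := by
    obtain ⟨Y, g, h, H⟩ := Pretriangulated.distinguished_cocone_triangle₁
      (Fan.IsLimit.lift (productIsProduct fun p : CoevIndex k B X => B⟦p.1⟧)
        fun p => (p.2 : X ⟶ B⟦p.1⟧))
    exact ⟨Y, _, productIsProduct _, g, h, H⟩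
  rw [cotwist, dif_pos h]
  exact h.choose_spec

/-- The sequence `E_i = T_B^i E`, `i ∈ ℤ`, where the inverse of `T_B` is `T_B^*`. -/
def twistSeq (B E : C) : ℤ → C
  | Int.ofNat n => (twist k B)^[n] E
  | Int.negSucc n => (cotwist k B)^[n + 1] E

end Twist

/-! ### The t-structure of a sequence -/

section TStructure

variable {C : Type u} [Category.{v} C] [Preadditive C] [HasFiniteBiproducts C]
  [HasBinaryBiproducts C]

/-- The finite direct sums of indecomposable objects that satisfy `P`. -/
def addClosure (P : C → Prop) : ObjectProperty C := fun X =>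
  ∃ (n : ℕ) (Y : Fin n → C), (∀ j, Indecomposable (Y j) ∧ P (Y j)) ∧ Nonempty (X ≅ ⨁ Y)

/-- The subcategory `D^{≤ 0}`, whose indecomposable objects are those with a path from some
member of the sequence. -/
def pathLE (𝓔 : ℤ → C) : ObjectProperty C := addClosure fun X => ∃ i, HasPath (𝓔 i) X

/-- The subcategory `D^{≥ 1}`, whose indecomposable objects are all the others. -/
def pathGE (𝓔 : ℤ → C) : ObjectProperty C := addClosure fun X => ¬ ∃ i, HasPath (𝓔 i) X

variable [HasZeroObject C] [HasShift C ℤ] [∀ n : ℤ, (shiftFunctor C n).Additive]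
  [Pretriangulated C]

/-- `⋂ D^{≤ n} = 0 = ⋂ D^{≥ n}`. -/
def IsBounded (τ : TStructure C) : Prop :=
  (∀ X : C, (∀ n, τ.le n X) → IsZero X) ∧ ∀ X : C, (∀ n, τ.ge n X) → IsZero X

/-- All triangles `X ⟶ Y ⟶ Z ⟶ X[1]` with `X` in `D^{≤ 0}` and `Z` in `D^{≥ 1}` split. -/
def IsSplit (τ : TStructure C) : Prop :=
  ∀ T ∈ distTriang C, τ.le 0 T.obj₁ → τ.ge 1 T.obj₃ → T.mor₃ = 0

end TStructure

/-! ### Ample sequences -/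

section Ample

variable {H : Type u} [Category.{v} H]

/-- For each epimorphism `X ⟶ Y`, the map `Hom(E_i, X) ⟶ Hom(E_i, Y)` is surjective
for `i ≪ 0`. -/
def IsProjectiveSeq (𝓔 : ℤ → H) : Prop :=
  ∀ (X Y : H) (p : X ⟶ Y), Epi p →
    ∃ n : ℤ, ∀ i < n, Function.Surjective fun f : 𝓔 i ⟶ X => f ≫ p

variable (k : Type t) [Field k] [Preadditive H] [Linear k H]

/-- The canonical map `⨁ⱼ Hom(W, Z_j) ⊗ Hom(Z_j, X) ⟶ Hom(W, X)`. -/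
def compositionMap {s : ℕ} (W : H) (Z : Fin s → H) (X : H) :
    (⨁ j : Fin s, (W ⟶ Z j) ⊗[k] (Z j ⟶ X)) →ₗ[k] (W ⟶ X) :=
  DirectSum.toModule k (Fin s) (W ⟶ X) fun j => TensorProduct.lift (Linear.comp W (Z j) X)

/-- A projective sequence is coherent if for each `X` and `n` there are
`i₁, …, i_s ≤ n` such that
`⨁ⱼ Hom(E_i, E_{i_j}) ⊗ Hom(E_{i_j}, X) ⟶ Hom(E_i, X)` is surjective for `i ≪ 0`. -/
def IsCoherentSeq (𝓔 : ℤ → H) : Prop :=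
  IsProjectiveSeq 𝓔 ∧
    ∀ (X : H) (n : ℤ), ∃ (s : ℕ) (l : Fin s → ℤ), (∀ j, l j ≤ n) ∧
      ∃ m : ℤ, ∀ i < m, Function.Surjective (compositionMap k (𝓔 i) (fun j => 𝓔 (l j)) X)

/-- A coherent sequence is ample if for each non-zero `X` one has `Hom(E_i, X) ≠ 0`
for `i ≪ 0`. -/
def IsAmpleSeq (𝓔 : ℤ → H) : Prop :=
  IsCoherentSeq k 𝓔 ∧ ∀ X : H, ¬ IsZero X → ∃ m : ℤ, ∀ i < m, ∃ f : 𝓔 i ⟶ X, f ≠ 0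

end Ample

end OneCY

end

set_option linter.unusedSectionVars false

/-! Two consequences of the duality Hom(X, Y) ≅ Hom(Y, X[1])^* drive everything. First, every
t-structure splits: the connecting map of a truncation triangle lies in the dual of a vanishing
Hom-space (`hom_shift_eq_zero`). Hence an indecomposable object lies on one side of each cut
(`isLE_or_isGE`), and for a bounded t-structure it is a shift of an object of the heart. Secondly,
the non-zero cone of an evaluation Y^a → X between bricks with Hom(Y[1], X) = 0 is a brick
(`IsEv.brick_cone`), hence indecomposable. So in a heart such an evaluation is a monomorphism or an
epimorphism.

Applied to E and B, this gives Hom(B, E) = 0, so RHom(E, B) = k^a sits in degree 0. This property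
survives twisting, and the E_i are bricks in triangles E_i → E_{i+1} → W → E_i[1] with W = B^a. For
l < i, RHom(E_l, E_i) has dimension (i - l)N, N = a², and sits in degree 0. Comparing these
dimensions with the mono/epi dichotomy shows that non-zero maps from E_i to D^{≥ 0} are detected by
E_j for j ≤ i - 2 (`IsTwistSeq.exists_comp_ne_zero`).

In a heart containing all E_i with i ≤ i₀, call X torsion if some E_j generates it, and free if it
receives no map from them. The Euler form χ(E_l, X) is affine in l with slope χ(W, X). It replaces
chain conditions: for a torsion subobject A of X, both χ(W, A) and then χ(E_{i₀}, A) are bounded, so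
a largest torsion subobject exists (`exists_torsSub_isFree`).

The standard heart, suitably shifted, contains the E_i of small index. Tilting it at this torsion
pair gives a heart containing all E_i, in which free objects F satisfy RHom(E_i, F) = 0 for i ≤ i₀
(`perp_of_isFree_tilt`). In that situation there are no maps in either direction between the
orthogonal of the sequence and the torsion objects, so connectedness of the category kills the
orthogonal (`Perp.isZero`).

Thus every X in the new heart is torsion: for l ≪ 0, E_l generates X and Ext¹(E_l, X) = 0. Applied
to kernels, this gives ampleness. Splitting, together with the non-zero maps X[-1] → X, describes
D^{≤ 0} by paths. -/

namespace OneCY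

/-! ### Consequences of Serre duality -/

section SerreDuality

variable (k : Type t) [Field k] (C : Type u) [Category.{v} C] [Preadditive C] [Linear k C]
  [HasShift C ℤ]

/-- A `Hom`-finite category for which the shift `[1]` is a Serre functor. -/
class HomFiniteCY : Prop where
  serre : ShiftOneIsSerreFunctor k C
  finite (X Y : C) : Module.Finite k (X ⟶ Y)

attribute [instance] HomFiniteCY.finite

variable {C} [HomFiniteCY k C]

include k

/-- By naturality, the functional attached to `f` sends `h` to the trace `η X X (𝟙 X)` of `f ≫ h`.
If all composites vanished, every functional would kill `h`. The next lemma is the same argument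
with the trace on the other side. -/
lemma exists_pre_ne_zero {X Y : C} (h : Y ⟶ X⟦(1 : ℤ)⟧) (hh : h ≠ 0) :
    ∃ f : X ⟶ Y, f ≫ h ≠ 0 := by
  obtain ⟨η, hη⟩ := HomFiniteCY.serre (k := k) (C := C)
  by_contra! H
  refine hh ((Module.forall_dual_apply_eq_zero_iff k h).1 fun φ => ?_)
  obtain ⟨f, rfl⟩ := (η X Y).surjective φ
  have := hη X X X Y (𝟙 X) (𝟙 X) f h
  rw [Category.id_comp, Category.id_comp, CategoryTheory.Functor.map_id, Category.comp_id] at this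
  rw [this, H f, map_zero]

lemma exists_post_ne_zero {X Y : C} (h : Y ⟶ X⟦(1 : ℤ)⟧) (hh : h ≠ 0) :
    ∃ f : X ⟶ Y, h ≫ f⟦(1 : ℤ)⟧' ≠ 0 := by
  obtain ⟨η, hη⟩ := HomFiniteCY.serre (k := k) (C := C)
  by_contra! H
  refine hh ((Module.forall_dual_apply_eq_zero_iff k h).1 fun φ => ?_)
  obtain ⟨f, rfl⟩ := (η X Y).surjective φ
  have := hη Y X Y Y f (𝟙 Y) (𝟙 Y) h
  simp only [Category.id_comp, Category.comp_id] at this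
  rw [this, H f, map_zero]

lemma finrank_serre (X Y : C) :
    Module.finrank k (X ⟶ Y) = Module.finrank k (Y ⟶ X⟦(1 : ℤ)⟧) := by
  obtain ⟨η, -⟩ := HomFiniteCY.serre (k := k) (C := C)
  rw [(η X Y).finrank_eq, Subspace.dual_finrank_eq]

lemma hom_eq_zero_of_serre {X Y : C} (H : ∀ f : X ⟶ Y, f = 0) (h : Y ⟶ X⟦(1 : ℤ)⟧) : h = 0 := by
  by_contra hh
  obtain ⟨f, hf⟩ := exists_pre_ne_zero k h hh
  exact hf (by rw [H f, zero_comp])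

end SerreDuality

/-! ### Exactness of `Hom` on distinguished triangles -/

section Exactness

variable {C : Type u} [Category.{v} C] [Preadditive C] [HasZeroObject C] [HasShift C ℤ]
  [∀ n : ℤ, (shiftFunctor C n).Additive] [Pretriangulated C]
  {X Y Z : C} {f : X ⟶ Y} {g : Y ⟶ Z} {h : Z ⟶ X⟦(1 : ℤ)⟧}
  (hT : Triangle.mk f g h ∈ distTriang C) {U : C}
include hT

lemma tri_zero₁₂ : f ≫ g = 0 := comp_distTriang_mor_zero₁₂ _ hT

lemma tri_zero₂₃ : g ≫ h = 0 := comp_distTriang_mor_zero₂₃ _ hT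

lemma tri_zero₃₁ : h ≫ f⟦(1 : ℤ)⟧' = 0 := comp_distTriang_mor_zero₃₁ _ hT

lemma tri_lift₂ (u : U ⟶ Y) (hu : u ≫ g = 0) : ∃ v : U ⟶ X, v ≫ f = u :=
  let ⟨v, hv⟩ := Triangle.coyoneda_exact₂ _ hT u hu
  ⟨v, hv.symm⟩

lemma tri_lift₃ (u : U ⟶ Z) (hu : u ≫ h = 0) : ∃ v : U ⟶ Y, v ≫ g = u :=
  let ⟨v, hv⟩ := Triangle.coyoneda_exact₃ _ hT u hu
  ⟨v, hv.symm⟩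

lemma tri_lift₁ (u : U ⟶ X⟦(1 : ℤ)⟧) (hu : u ≫ f⟦(1 : ℤ)⟧' = 0) : ∃ v : U ⟶ Z, v ≫ h = u :=
  let ⟨v, hv⟩ := Triangle.coyoneda_exact₁ _ hT u hu
  ⟨v, hv.symm⟩

lemma tri_desc₂ (u : Y ⟶ U) (hu : f ≫ u = 0) : ∃ v : Z ⟶ U, g ≫ v = u :=
  let ⟨v, hv⟩ := Triangle.yoneda_exact₂ _ hT u hu
  ⟨v, hv.symm⟩

lemma tri_desc₃ (u : Z ⟶ U) (hu : g ≫ u = 0) : ∃ v : X⟦(1 : ℤ)⟧ ⟶ U, h ≫ v = u :=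
  let ⟨v, hv⟩ := Triangle.yoneda_exact₃ _ hT u hu
  ⟨v, hv.symm⟩

lemma tri_rot : Triangle.mk g h (-f⟦(1 : ℤ)⟧') ∈ distTriang C := rot_of_distTriang _ hT

lemma tri_hom_to₂ (h1 : ∀ u : U ⟶ X, u = 0) (h3 : ∀ u : U ⟶ Z, u = 0) (u : U ⟶ Y) : u = 0 := by
  obtain ⟨v, rfl⟩ := tri_lift₂ hT u (h3 _)
  rw [h1 v, zero_comp]

lemma tri_hom_to₃ (h2 : ∀ u : U ⟶ Y, u = 0) (h1 : ∀ u : U ⟶ X⟦(1 : ℤ)⟧, u = 0) (u : U ⟶ Z) :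
    u = 0 := by
  obtain ⟨v, rfl⟩ := tri_lift₃ hT u (h1 _)
  rw [h2 v, zero_comp]

lemma tri_hom_from₂ (h1 : ∀ u : X ⟶ U, u = 0) (h3 : ∀ u : Z ⟶ U, u = 0) (u : Y ⟶ U) :
    u = 0 := by
  obtain ⟨v, rfl⟩ := tri_desc₂ hT u (h1 _)
  rw [h3 v, comp_zero]

end Exactness

/-! ### Powers of an object -/

/-- `V` is a direct sum of `a` copies of `Y`. -/
structure Power {C : Type u} [Category.{v} C] [Preadditive C] (Y V : C) (a : ℕ) where
  /-- The inclusions. -/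
  ι : Fin a → (Y ⟶ V)
  /-- The projections. -/
  π : Fin a → (V ⟶ Y)
  ι_π : ∀ i j, ι i ≫ π j = if i = j then 𝟙 Y else 0
  total : ∑ i, π i ≫ ι i = 𝟙 V

namespace Power

variable {C : Type u} [Category.{v} C] [Preadditive C] {Y V : C} {a : ℕ} (p : Power Y V a)

include p in
lemma hom_ext {X : C} {f g : V ⟶ X} (h : ∀ i, p.ι i ≫ f = p.ι i ≫ g) : f = g := by
  rw [← Category.id_comp f, ← Category.id_comp g, ← p.total]
  simp only [Preadditive.sum_comp, Category.assoc, h]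

include p in
lemma hom_ext' {X : C} {f g : X ⟶ V} (h : ∀ i, f ≫ p.π i = g ≫ p.π i) : f = g := by
  rw [← Category.comp_id f, ← Category.comp_id g, ← p.total]
  simp only [Preadditive.comp_sum, ← Category.assoc, h]

/-- The morphism with given components. -/
def desc {X : C} (b : Fin a → (Y ⟶ X)) : V ⟶ X := ∑ i, p.π i ≫ b i

/-- The morphism with given components. -/
def lift {X : C} (b : Fin a → (X ⟶ Y)) : X ⟶ V := ∑ i, b i ≫ p.ι i

@[simp]
lemma ι_desc {X : C} (b : Fin a → (Y ⟶ X)) (i : Fin a) : p.ι i ≫ p.desc b = b i := by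
  simp only [desc, Preadditive.comp_sum, ← Category.assoc, p.ι_π]
  rw [Finset.sum_eq_single i]
  · simp
  · intro j _ hj
    rw [if_neg hj.symm, zero_comp]
  · simp

@[simp]
lemma lift_π {X : C} (b : Fin a → (X ⟶ Y)) (i : Fin a) : p.lift b ≫ p.π i = b i := by
  simp only [lift, Preadditive.sum_comp, Category.assoc, p.ι_π]
  rw [Finset.sum_eq_single i]
  · simp
  · intro j _ hj
    rw [if_neg hj, comp_zero]
  · simp

/-- The image of a power under an additive functor. -/
@[simps]
def map {D : Type*} [Category* D] [Preadditive D] (F : C ⥤ D) [F.Additive] :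
    Power (F.obj Y) (F.obj V) a where
  ι i := F.map (p.ι i)
  π i := F.map (p.π i)
  ι_π i j := by
    rw [← F.map_comp, p.ι_π]
    split_ifs <;> simp
  total := by
    simp only [← F.map_comp, ← F.map_sum, p.total, F.map_id]

/-- Change of the base object. -/
def ofIso {Y' : C} (e : Y ≅ Y') : Power Y' V a where
  ι i := e.inv ≫ p.ι i
  π i := p.π i ≫ e.hom
  ι_π i j := by
    rw [Category.assoc, ← Category.assoc (p.ι i), p.ι_π]
    split_ifs <;> simp
  total := by simpa using p.total

/-- Two powers of an object with the same exponent are isomorphic. -/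
def iso {V' : C} (q : Power Y V' a) : V ≅ V' where
  hom := p.desc q.ι
  inv := q.desc p.ι
  hom_inv_id := p.hom_ext fun i => by simp [← Category.assoc]
  inv_hom_id := q.hom_ext fun i => by simp [← Category.assoc]

/-- The biproduct of copies of an object. -/
noncomputable def biproduct [HasFiniteBiproducts C] (Y : C) (a : ℕ) :
    Power Y (⨁ fun _ : Fin a => Y) a where
  ι i := biproduct.ι (fun _ : Fin a => Y) i
  π i := biproduct.π (fun _ : Fin a => Y) i
  ι_π i j := by
    rw [biproduct.ι_π]
    split_ifs with h <;> simp
  total := biproduct.total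

variable (k : Type t) [Field k] [Linear k C]

include p

lemma finrank_hom_to (U : C) [Module.Finite k (U ⟶ Y)] :
    Module.finrank k (U ⟶ V) = a * Module.finrank k (U ⟶ Y) := by
  let e : (U ⟶ V) ≃ₗ[k] (Fin a → (U ⟶ Y)) :=
    { toFun := fun f i => f ≫ p.π i
      invFun := p.lift
      map_add' := fun f g => by ext; simp
      map_smul' := fun c f => by ext; simp
      left_inv := fun f => p.hom_ext' (by simp)
      right_inv := fun b => by ext; simp }
  rw [e.finrank_eq, Module.finrank_pi_fintype]
  simp

lemma finrank_hom_from (U : C) [Module.Finite k (Y ⟶ U)] :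
    Module.finrank k (V ⟶ U) = a * Module.finrank k (Y ⟶ U) := by
  let e : (V ⟶ U) ≃ₗ[k] (Fin a → (Y ⟶ U)) :=
    { toFun := fun f i => p.ι i ≫ f
      invFun := p.desc
      map_add' := fun f g => by ext; simp
      map_smul' := fun c f => by ext; simp
      left_inv := fun f => p.hom_ext (by simp)
      right_inv := fun b => by ext; simp }
  rw [e.finrank_eq, Module.finrank_pi_fintype]
  simp

end Power

/-! ### Bricks -/

section Brick

variable (k : Type t) [Field k] {C : Type u} [Category.{v} C] [Preadditive C] [Linear k C]

/-- A non-zero object all of whose endomorphisms are scalars. -/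
def Brick (X : C) : Prop := ¬ IsZero X ∧ ∀ f : X ⟶ X, ∃ c : k, f = c • 𝟙 X

variable {k}

lemma Brick.finrank_end {X : C} (hX : Brick k X) : Module.finrank k (X ⟶ X) = 1 := by
  refine finrank_eq_one (𝟙 X) (fun h => hX.1 ((IsZero.iff_id_eq_zero X).2 h)) fun f => ?_
  obtain ⟨c, rfl⟩ := hX.2 f
  exact ⟨c, rfl⟩

lemma Brick.of_iso {X Y : C} (hX : Brick k X) (e : X ≅ Y) : Brick k Y := by
  refine ⟨fun h => hX.1 (h.of_iso e), fun f => ?_⟩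
  obtain ⟨c, hc⟩ := hX.2 (e.hom ≫ f ≫ e.inv)
  refine ⟨c, ?_⟩
  rw [← cancel_epi e.hom, ← cancel_mono e.inv, Category.assoc, hc]
  simp

lemma Brick.shift [HasShift C ℤ] [∀ n : ℤ, (shiftFunctor C n).Additive]
    [∀ n : ℤ, (shiftFunctor C n).Linear k] {X : C} (hX : Brick k X) (n : ℤ) :
    Brick k (X⟦n⟧) := by
  refine ⟨fun h => hX.1 ?_, fun f => ?_⟩
  · rw [IsZero.iff_id_eq_zero] at h ⊢
    exact (shiftFunctor C n).map_injective (by simpa using h)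
  · obtain ⟨g, rfl⟩ := (shiftFunctor C n).map_surjective f
    obtain ⟨c, rfl⟩ := hX.2 g
    exact ⟨c, by simp [Functor.map_smul]⟩

lemma Brick.indecomposable [HasBinaryBiproducts C] {X : C} (hX : Brick k X) :
    Indecomposable X := by
  refine ⟨hX.1, fun Y Z e => ?_⟩
  obtain ⟨c, hc⟩ := hX.2 (e.hom ≫ biprod.fst ≫ biprod.inl ≫ e.inv)
  have h : (biprod.fst ≫ biprod.inl : Y ⊞ Z ⟶ Y ⊞ Z) = c • 𝟙 _ := by
    rw [← cancel_epi e.hom, ← cancel_mono e.inv, Category.assoc, Category.assoc, hc]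
    simp
  by_cases h0 : c = 0
  · left
    rw [IsZero.iff_id_eq_zero]
    have := biprod.inl ≫= h =≫ biprod.fst
    simpa [h0] using this
  · right
    rw [IsZero.iff_id_eq_zero]
    have := biprod.inr ≫= h =≫ biprod.snd
    simpa [h0] using this.symm

end Brick

/-! ### Evaluation morphisms and their cones -/

section Evaluation

variable (k : Type t) [Field k] {C : Type u} [Category.{v} C] [Preadditive C] [Linear k C]

/-- The morphism `ev : Y^a ⟶ X` has a basis of `Hom(Y, X)` as its components. -/
def IsEv {Y V X : C} {a : ℕ} (p : Power Y V a) (ev : V ⟶ X) : Prop :=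
  ∃ b : Module.Basis (Fin a) k (Y ⟶ X), ∀ i, p.ι i ≫ ev = b i

/-- The morphism `cv : X ⟶ Y^a` has a basis of `Hom(X, Y)` as its components. -/
def IsCoev {Y V X : C} {a : ℕ} (p : Power Y V a) (cv : X ⟶ V) : Prop :=
  ∃ b : Module.Basis (Fin a) k (X ⟶ Y), ∀ i, cv ≫ p.π i = b i

lemma exists_isEv [HasFiniteBiproducts C] (Y X : C) [Module.Finite k (Y ⟶ X)] :
    ∃ (V : C) (p : Power Y V (Module.finrank k (Y ⟶ X))) (ev : V ⟶ X), IsEv k p ev :=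
  ⟨_, Power.biproduct Y _, (Power.biproduct Y _).desc (Module.finBasis k (Y ⟶ X)),
    Module.finBasis k (Y ⟶ X), fun i => by simp⟩

variable {k}

namespace IsEv

variable {Y V X : C} {a : ℕ} {p : Power Y V a} {ev : V ⟶ X} (hev : IsEv k p ev)
include hev

lemma fac (e : Y ⟶ X) : ∃ s : Y ⟶ V, s ≫ ev = e := by
  obtain ⟨b, hb⟩ := hev
  refine ⟨p.lift fun i => b.repr e i • 𝟙 Y, ?_⟩
  conv_rhs => rw [← b.sum_repr e]
  simp [Power.lift, Preadditive.sum_comp, hb]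

lemma fac' (f : V ⟶ X) : ∃ s : V ⟶ V, s ≫ ev = f := by
  choose s hs using fun i => hev.fac (p.ι i ≫ f)
  exact ⟨p.desc s, p.hom_ext fun i => by simp [← Category.assoc, hs]⟩

lemma comp_eq_zero {G : C} {g : X ⟶ G} (hg : ∀ e : Y ⟶ X, e ≫ g = 0) : ev ≫ g = 0 := by
  obtain ⟨b, hb⟩ := hev
  refine p.hom_ext fun i => ?_
  rw [← Category.assoc, hb, hg, comp_zero]

/-- A map from a brick `Y` to `Y^a` is a vector of scalars, and `ev` turns it into the corresponding
combination of basis vectors. -/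
lemma eq_zero_of_comp (hY : Brick k Y) {s : Y ⟶ V} (hs : s ≫ ev = 0) : s = 0 := by
  obtain ⟨b, hb⟩ := hev
  choose c hc using fun i => hY.2 (s ≫ p.π i)
  have h : s = ∑ i, c i • p.ι i := by
    conv_lhs => rw [← Category.comp_id s, ← p.total, Preadditive.comp_sum]
    refine Finset.sum_congr rfl fun i _ => ?_
    rw [← Category.assoc, hc, Linear.smul_comp, Category.id_comp]
  have h2 : ∑ i, c i • b i = 0 := by
    rw [h, Preadditive.sum_comp] at hs
    simpa [hb] using hs
  have h3 := Fintype.linearIndependent_iff.1 b.linearIndependent c h2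
  rw [h]
  simp [h3]

end IsEv

namespace IsCoev

variable {Y V X : C} {a : ℕ} {p : Power Y V a} {cv : X ⟶ V} (hcv : IsCoev k p cv)
include hcv

lemma fac (e : X ⟶ Y) : ∃ s : V ⟶ Y, cv ≫ s = e := by
  obtain ⟨b, hb⟩ := hcv
  refine ⟨p.desc fun i => b.repr e i • 𝟙 Y, ?_⟩
  conv_rhs => rw [← b.sum_repr e]
  simp [Power.desc, Preadditive.comp_sum, hb]

lemma fac' (f : X ⟶ V) : ∃ s : V ⟶ V, cv ≫ s = f := by
  choose s hs using fun i => hcv.fac (f ≫ p.π i)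
  exact ⟨p.lift s, p.hom_ext' fun i => by simp [hs]⟩

lemma eq_zero_of_comp (hY : Brick k Y) {s : V ⟶ Y} (hs : cv ≫ s = 0) : s = 0 := by
  obtain ⟨b, hb⟩ := hcv
  choose c hc using fun i => hY.2 (p.ι i ≫ s)
  have h : s = ∑ i, c i • p.π i := by
    conv_lhs => rw [← Category.id_comp s, ← p.total, Preadditive.sum_comp]
    refine Finset.sum_congr rfl fun i _ => ?_
    rw [Category.assoc, hc, Linear.comp_smul, Category.comp_id]
  have h2 : ∑ i, c i • b i = 0 := by
    rw [h, Preadditive.comp_sum] at hs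
    simpa [hb] using hs
  have h3 := Fintype.linearIndependent_iff.1 b.linearIndependent c h2
  rw [h]
  simp [h3]

end IsCoev

variable [HasZeroObject C] [HasShift C ℤ] [∀ n : ℤ, (shiftFunctor C n).Additive]
  [Pretriangulated C]

/-- The cone of `Y^a ⟶ X` has no maps from `Y[1]` if `X` has none. -/
lemma IsEv.hom_cone_eq_zero {Y V X Z : C} {a : ℕ} {p : Power Y V a} {ev : V ⟶ X}
    (hev : IsEv k p ev) (hY : Brick k Y) {g : X ⟶ Z} {h : Z ⟶ V⟦(1 : ℤ)⟧}
    (hT : Triangle.mk ev g h ∈ distTriang C) (h0 : ∀ f : Y⟦(1 : ℤ)⟧ ⟶ X, f = 0)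
    (f : Y⟦(1 : ℤ)⟧ ⟶ Z) : f = 0 := by
  have h1 : f ≫ h = 0 := by
    obtain ⟨s, hs⟩ := (shiftFunctor C (1 : ℤ)).map_surjective (f ≫ h)
    have : s ≫ ev = 0 := (shiftFunctor C (1 : ℤ)).map_injective (by
      rw [Functor.map_comp, hs, Category.assoc, Functor.map_zero, tri_zero₃₁ hT, comp_zero])
    rw [← hs, hev.eq_zero_of_comp hY this, Functor.map_zero]
  obtain ⟨f', rfl⟩ := tri_lift₃ hT f h1
  rw [h0 f', zero_comp]

/-- The cocone of `X ⟶ Y^a` has no maps to `Y[-1]` if `X` has none. -/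
lemma IsCoev.hom_cocone_eq_zero {Y V X Z : C} {a : ℕ} {p : Power Y V a} {cv : X ⟶ V}
    (hcv : IsCoev k p cv) (hY : Brick k Y) {α : Z ⟶ X} {w : V ⟶ Z⟦(1 : ℤ)⟧}
    (hT : Triangle.mk α cv w ∈ distTriang C) (h0 : ∀ f : X⟦(1 : ℤ)⟧ ⟶ Y, f = 0)
    (f : Z⟦(1 : ℤ)⟧ ⟶ Y) : f = 0 := by
  have hw : cv ≫ w = 0 := tri_zero₂₃ hT
  have h1 : w ≫ f = 0 := hcv.eq_zero_of_comp hY (by rw [reassoc_of% hw, zero_comp])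
  obtain ⟨g, rfl⟩ := tri_desc₂ (tri_rot (tri_rot hT)) f h1
  rw [h0 g, comp_zero]

variable [HomFiniteCY k C]

/-- The cone of the evaluation `Y^a ⟶ X` of bricks is a brick, unless it is zero. -/
theorem IsEv.brick_cone {Y V X Z : C} {a : ℕ} {p : Power Y V a} {ev : V ⟶ X}
    (hev : IsEv k p ev) (hY : Brick k Y) (hX : Brick k X) {g : X ⟶ Z} {h : Z ⟶ V⟦(1 : ℤ)⟧}
    (hT : Triangle.mk ev g h ∈ distTriang C) (h0 : ∀ f : Y⟦(1 : ℤ)⟧ ⟶ X, f = 0)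
    (hZ : ¬ IsZero Z) : Brick k Z := by
  have hVZ : ∀ f : V⟦(1 : ℤ)⟧ ⟶ Z, f = 0 := fun f =>
    (p.map (shiftFunctor C (1 : ℤ))).hom_ext fun i => by
      rw [comp_zero]
      exact hev.hom_cone_eq_zero hY hT h0 _
  refine ⟨hZ, fun φ => ?_⟩
  -- Otherwise duality gives `f : V ⟶ X` whose composite with this map is non-zero. But every such
  -- `f` factors through `ev`, and `ev ≫ g = 0`.
  have h1 : g ≫ φ ≫ h = 0 := by
    by_contra hne
    obtain ⟨f, hf⟩ := exists_pre_ne_zero k _ hne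
    obtain ⟨s, rfl⟩ := hev.fac' f
    refine hf ?_
    rw [Category.assoc, ← Category.assoc ev, tri_zero₁₂ hT, zero_comp, comp_zero]
  obtain ⟨c', hc'⟩ := tri_lift₃ hT (g ≫ φ) (by rw [Category.assoc, h1])
  obtain ⟨c, rfl⟩ := hX.2 c'
  refine ⟨c, sub_eq_zero.1 ?_⟩
  -- `φ` and the scalar `c` agree after `g`, so their difference factors through `V[1]`, from which
  -- `Z` receives no non-zero map.
  obtain ⟨χ, hχ⟩ := tri_desc₃ hT (φ - c • 𝟙 Z) (by
    rw [Preadditive.comp_sub, ← hc']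
    simp)
  rw [← hχ, hVZ χ, comp_zero]

/-- The cocone of the coevaluation `X ⟶ Y^a` of bricks is a brick, unless it is zero. -/
theorem IsCoev.brick_cocone [∀ n : ℤ, (shiftFunctor C n).Linear k]
    {Y V X Z : C} {a : ℕ} {p : Power Y V a} {cv : X ⟶ V}
    (hcv : IsCoev k p cv) (hY : Brick k Y) (hX : Brick k X) {α : Z ⟶ X} {w : V ⟶ Z⟦(1 : ℤ)⟧}
    (hT : Triangle.mk α cv w ∈ distTriang C) (h0 : ∀ f : X⟦(1 : ℤ)⟧ ⟶ Y, f = 0)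
    (hZ : ¬ IsZero Z) : Brick k Z := by
  have hT' := tri_rot (tri_rot hT)
  have hZV : ∀ f : Z⟦(1 : ℤ)⟧ ⟶ V, f = 0 := fun f => p.hom_ext' fun i => by
    rw [zero_comp]
    exact hcv.hom_cocone_eq_zero hY hT h0 _
  refine ⟨hZ, fun φ => ?_⟩
  have h1 : w ≫ φ⟦(1 : ℤ)⟧' ≫ α⟦(1 : ℤ)⟧' = 0 := by
    by_contra hne
    obtain ⟨f, hf⟩ := exists_post_ne_zero k _ hne
    obtain ⟨s, rfl⟩ := hcv.fac' f
    refine hf ?_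
    have : α⟦(1 : ℤ)⟧' ≫ cv⟦(1 : ℤ)⟧' = 0 := by
      rw [← Functor.map_comp, tri_zero₁₂ hT, Functor.map_zero]
    rw [Functor.map_comp, Category.assoc, Category.assoc, reassoc_of% this, zero_comp, comp_zero,
      comp_zero]
  obtain ⟨g, hg⟩ := tri_desc₂ hT' (φ⟦(1 : ℤ)⟧' ≫ α⟦(1 : ℤ)⟧') h1
  obtain ⟨c, rfl⟩ := (hX.shift 1).2 g
  obtain ⟨χ, hχ⟩ := tri_lift₂ hT' (φ⟦(1 : ℤ)⟧' + c • 𝟙 _) (by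
    rw [Preadditive.comp_neg, Preadditive.add_comp, ← hg]
    simp)
  rw [hZV χ, zero_comp] at hχ
  refine ⟨-c, (shiftFunctor C (1 : ℤ)).map_injective ?_⟩
  rw [Functor.map_smul, CategoryTheory.Functor.map_id, neg_smul]
  exact eq_neg_of_add_eq_zero_left hχ.symm

end Evaluation

/-! ### Dimensions of the graded pieces of `RHom` and the Euler form -/

section EulerForm

variable {C : Type u} [Category.{v} C] [Preadditive C] [HasZeroObject C] [HasShift C ℤ]
  [∀ n : ℤ, (shiftFunctor C n).Additive] [Pretriangulated C]

lemma tri_neg {X Y Z : C} {f : X ⟶ Y} {g : Y ⟶ Z} {h : Z ⟶ X⟦(1 : ℤ)⟧}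
    (hT : Triangle.mk f g h ∈ distTriang C) : Triangle.mk (-f) (-g) h ∈ distTriang C :=
  isomorphic_distinguished _ hT _
    (Triangle.isoMk _ _ (Iso.refl X) (-Iso.refl Y) (Iso.refl Z)
      (by change (-f) ≫ (-𝟙 Y) = 𝟙 X ≫ f; simp)
      (by change (-g) ≫ 𝟙 Z = (-𝟙 Y) ≫ g; simp)
      (by change h ≫ (𝟙 X)⟦(1 : ℤ)⟧' = 𝟙 Z ≫ h; simp))

/-- Shifting a triangle by `n` multiplies its maps by `(-1)^n`. Only the first two maps are used
later, and their common sign can be removed by an isomorphism of triangles. -/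
lemma tri_shift {X Y Z : C} {f : X ⟶ Y} {g : Y ⟶ Z} {h : Z ⟶ X⟦(1 : ℤ)⟧}
    (hT : Triangle.mk f g h ∈ distTriang C) (n : ℤ) :
    ∃ δ : Z⟦n⟧ ⟶ X⟦n⟧⟦(1 : ℤ)⟧, Triangle.mk (f⟦n⟧') (g⟦n⟧') δ ∈ distTriang C := by
  have hT' : Triangle.mk (n.negOnePow • f⟦n⟧') (n.negOnePow • g⟦n⟧')
    (n.negOnePow • h⟦n⟧' ≫ (shiftFunctorComm C 1 n).hom.app X) ∈ distTriang C :=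
    Triangle.shift_distinguished _ hT n
  rcases Int.units_eq_one_or n.negOnePow with hn | hn
  · rw [hn, one_smul, one_smul] at hT'
    exact ⟨_, hT'⟩
  · rw [hn, Units.neg_smul, Units.neg_smul, one_smul, one_smul] at hT'
    have := tri_neg hT'
    rw [neg_neg, neg_neg] at this
    exact ⟨_, this⟩

variable (k : Type t) [Field k] [Linear k C]

/-- The dimension of `Hom(X, Y[n])`. -/
noncomputable def hd (X Y : C) (n : ℤ) : ℕ := Module.finrank k (X ⟶ Y⟦n⟧)

/-- The dimension of the kernel of `Hom(U, X) ⟶ Hom(U, Y)`. -/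
noncomputable def kerDim (U : C) {X Y : C} (f : X ⟶ Y) : ℕ :=
  Module.finrank k (LinearMap.ker (Linear.rightComp k U f))

lemma finrank_hom_congr {X X' Y Y' : C} (e : X ≅ X') (e' : Y ≅ Y') :
    Module.finrank k (X ⟶ Y) = Module.finrank k (X' ⟶ Y') :=
  (Linear.homCongr k e e').finrank_eq

lemma kerDim_congr (U : C) {X Y X' Y' : C} {f : X ⟶ Y} {f' : X' ⟶ Y'} (e : X ≅ X') (e' : Y ≅ Y')
    (h : f ≫ e'.hom = e.hom ≫ f') : kerDim k U f = kerDim k U f' := by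
  refine LinearEquiv.finrank_eq (LinearEquiv.ofSubmodules (Linear.homCongr k (Iso.refl U) e) _ _ ?_)
  ext x
  simp only [Submodule.mem_map, LinearMap.mem_ker, Linear.rightComp_apply]
  constructor
  · rintro ⟨y, hy, rfl⟩
    rw [LinearEquiv.coe_coe, Linear.homCongr_apply]
    simp [← h, reassoc_of% hy]
  · intro hx
    refine ⟨x ≫ e.inv, ?_, by rw [LinearEquiv.coe_coe, Linear.homCongr_apply]; simp⟩
    rw [← cancel_mono e'.hom, Category.assoc, Category.assoc, h]
    simp [hx]

variable {k}

lemma hd_eq_zero_iff {X Y : C} {n : ℤ} [Module.Finite k (X ⟶ Y⟦n⟧)] :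
    hd k X Y n = 0 ↔ ∀ f : X ⟶ Y⟦n⟧, f = 0 := by
  rw [hd, Module.finrank_zero_iff]
  exact ⟨fun _ f => Subsingleton.elim _ _, fun h => ⟨fun f g => by rw [h f, h g]⟩⟩

lemma hd_pos_iff {X Y : C} {n : ℤ} [Module.Finite k (X ⟶ Y⟦n⟧)] :
    0 < hd k X Y n ↔ ∃ f : X ⟶ Y⟦n⟧, f ≠ 0 := by
  rw [Nat.pos_iff_ne_zero, ne_eq, hd_eq_zero_iff]
  push Not
  rfl

lemma hd_zero (X Y : C) : hd k X Y 0 = Module.finrank k (X ⟶ Y) :=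
  finrank_hom_congr k (Iso.refl X) ((shiftFunctorZero C ℤ).app Y)

lemma hd_zero_eq_zero_iff {X Y : C} [Module.Finite k (X ⟶ Y)] :
    hd k X Y 0 = 0 ↔ ∀ f : X ⟶ Y, f = 0 := by
  rw [hd_zero, Module.finrank_zero_iff]
  exact ⟨fun _ f => Subsingleton.elim _ _, fun h => ⟨fun f g => by rw [h f, h g]⟩⟩

lemma hd_shift_right (X Y : C) (m n : ℤ) : hd k X (Y⟦m⟧) n = hd k X Y (m + n) :=
  finrank_hom_congr k (Iso.refl X) ((shiftFunctorAdd C m n).symm.app Y)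

lemma hd_eq_finrank (X Y : C) {m n : ℤ} (h : n - m = 0) [(shiftFunctor C m).Linear k] :
    Module.finrank k (X⟦m⟧ ⟶ Y⟦n⟧) = Module.finrank k (X ⟶ Y) := by
  obtain rfl : n = m := by lia
  refine (LinearEquiv.finrank_eq (LinearEquiv.ofBijective
    (Functor.mapLinearMap k (shiftFunctor C n) (X := X) (Y := Y)) ⟨?_, ?_⟩)).symm
  · exact (shiftFunctor C n).map_injective
  · exact (shiftFunctor C n).map_surjective

lemma hd_shift_left [∀ n : ℤ, (shiftFunctor C n).Linear k] (X Y : C) (m n : ℤ) :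
    hd k (X⟦m⟧) Y n = hd k X Y (n - m) := by
  rw [hd, hd, ← hd_eq_finrank X (Y⟦n - m⟧) (m := m) (n := m) (by lia)]
  exact finrank_hom_congr k (Iso.refl _) ((shiftFunctorAdd' C (n - m) m n (by lia)).app Y)

lemma Power.hd_to {Y V : C} {a : ℕ} (p : Power Y V a) (U : C) (n : ℤ)
    [Module.Finite k (U ⟶ Y⟦n⟧)] : hd k U V n = a * hd k U Y n :=
  (p.map (shiftFunctor C n)).finrank_hom_to k U

lemma Power.hd_from {Y V : C} {a : ℕ} (p : Power Y V a) (U : C) (n : ℤ)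
    [Module.Finite k (Y ⟶ U⟦n⟧)] : hd k V U n = a * hd k Y U n :=
  p.finrank_hom_from k _

section

variable [∀ n : ℤ, (shiftFunctor C n).Linear k] [HomFiniteCY k C]

lemma hd_serre (X Y : C) (n : ℤ) : hd k X Y n = hd k Y X (1 - n) := by
  rw [hd, finrank_serre k X (Y⟦n⟧), ← hd_shift_left Y X n 1]
  rfl

variable {X Y Z : C} {f : X ⟶ Y} {g : Y ⟶ Z} {h : Z ⟶ X⟦(1 : ℤ)⟧}
  (hT : Triangle.mk f g h ∈ distTriang C) (U : C)
include hT

/-- Rank–nullity along the long exact sequence. The kernels at both ends of the piece are kept, so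
that they telescope in the alternating sum over all shifts. -/
lemma tri_finrank :
    Module.finrank k (U ⟶ Y) + kerDim k U f + kerDim k U (f⟦(1 : ℤ)⟧') =
      Module.finrank k (U ⟶ X) + Module.finrank k (U ⟶ Z) := by
  have h1 := LinearMap.finrank_range_add_finrank_ker (Linear.rightComp k U f)
  have h2 := LinearMap.finrank_range_add_finrank_ker (Linear.rightComp k U g)
  have h3 := LinearMap.finrank_range_add_finrank_ker (Linear.rightComp k U h)
  have e1 : LinearMap.ker (Linear.rightComp k U g) = LinearMap.range (Linear.rightComp k U f) := by
    ext x
    simp only [LinearMap.mem_ker, LinearMap.mem_range, Linear.rightComp_apply]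
    refine ⟨tri_lift₂ hT x, ?_⟩
    rintro ⟨y, rfl⟩
    rw [Category.assoc, tri_zero₁₂ hT, comp_zero]
  have e2 : LinearMap.ker (Linear.rightComp k U h) = LinearMap.range (Linear.rightComp k U g) := by
    ext x
    simp only [LinearMap.mem_ker, LinearMap.mem_range, Linear.rightComp_apply]
    refine ⟨tri_lift₃ hT x, ?_⟩
    rintro ⟨y, rfl⟩
    rw [Category.assoc, tri_zero₂₃ hT, comp_zero]
  have e3 : LinearMap.ker (Linear.rightComp k U (f⟦(1 : ℤ)⟧')) =
      LinearMap.range (Linear.rightComp k U h) := by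
    ext x
    simp only [LinearMap.mem_ker, LinearMap.mem_range, Linear.rightComp_apply]
    refine ⟨tri_lift₁ hT x, ?_⟩
    rintro ⟨y, rfl⟩
    rw [Category.assoc, tri_zero₃₁ hT, comp_zero]
  rw [e1] at h2
  rw [e2] at h3
  rw [kerDim, kerDim, e3]
  lia

lemma tri_hd (n : ℤ) :
    hd k U Y n + kerDim k U (f⟦n⟧') + kerDim k U (f⟦n + 1⟧') = hd k U X n + hd k U Z n := by
  obtain ⟨δ, hδ⟩ := tri_shift hT n
  have := tri_finrank (k := k) hδ U
  rw [hd, hd, hd, ← this]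
  congr 1
  refine kerDim_congr k U ((shiftFunctorAdd C n 1).app X) ((shiftFunctorAdd C n 1).app Y) ?_
  exact (shiftFunctorAdd C n 1).hom.naturality f

omit hT in
lemma kerDim_le (n : ℤ) : kerDim k U (f⟦n⟧') ≤ hd k U X n := Submodule.finrank_le _

lemma hd_le₂ (n : ℤ) : hd k U Y n ≤ hd k U X n + hd k U Z n := by
  have := tri_hd (k := k) hT U n
  lia

lemma hd_le₁ {n m : ℤ} (hnm : n + 1 = m) : hd k U X m ≤ hd k U Y m + hd k U Z n := by
  subst hnm
  have := tri_hd (k := k) hT U n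
  have h2 := tri_hd (k := k) hT U (n + 1)
  have h3 : kerDim k U (f⟦n + 1⟧') ≤ hd k U Z n := by
    have := kerDim_le (k := k) (f := f) U n
    obtain ⟨δ, hδ⟩ := tri_shift hT n
    have h4 := hd_le₂ (k := k) hδ U 0
    have h5 : kerDim k U (f⟦n⟧') ≤ hd k U X n := kerDim_le U n
    have h6 : hd k U X n ≤ hd k U Y n + kerDim k U (f⟦n⟧') := by
      have := LinearMap.finrank_range_add_finrank_ker (Linear.rightComp k U (f⟦n⟧'))
      have := Submodule.finrank_le (LinearMap.range (Linear.rightComp k U (f⟦n⟧')))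
      unfold hd kerDim
      lia
    lia
  have h6 : hd k U X (n + 1) ≤ hd k U Y (n + 1) + kerDim k U (f⟦n + 1⟧') := by
    have := LinearMap.finrank_range_add_finrank_ker (Linear.rightComp k U (f⟦n + 1⟧'))
    have := Submodule.finrank_le (LinearMap.range (Linear.rightComp k U (f⟦n + 1⟧')))
    unfold hd kerDim
    lia
  lia

lemma hd_from_le₂ (n : ℤ) : hd k Y U n ≤ hd k X U n + hd k Z U n := by
  rw [hd_serre Y, hd_serre X, hd_serre Z]
  exact hd_le₂ hT U _

lemma hd_from_le₁ {n m : ℤ} (hnm : n + 1 = m) : hd k X U n ≤ hd k Y U n + hd k Z U m := by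
  rw [hd_serre Y, hd_serre X, hd_serre Z]
  exact hd_le₁ hT U (by lia)

end

/-! ### The Euler form -/

/-- Any two objects have non-zero extensions in finitely many degrees only. -/
class ExtBounded (C : Type u) [Category.{v} C] [Preadditive C] [HasShift C ℤ] : Prop where
  finite (X Y : C) : {n : ℤ | ∃ f : X ⟶ Y⟦n⟧, f ≠ 0}.Finite

variable (k) in
/-- The Euler form. -/
noncomputable def chi (X Y : C) : ℤ := ∑ᶠ n : ℤ, (n.negOnePow : ℤ) * hd k X Y n

lemma chi_eq_single {X Y : C} (m : ℤ) (h : ∀ n, n ≠ m → hd k X Y n = 0) :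
    chi k X Y = (m.negOnePow : ℤ) * hd k X Y m := by
  rw [chi, finsum_eq_single _ m]
  intro n hn
  rw [h n hn]
  simp

lemma chi_eq_sub {X Y : C} (h : ∀ n, n ≠ 0 → n ≠ 1 → hd k X Y n = 0) :
    chi k X Y = hd k X Y 0 - hd k X Y 1 := by
  rw [chi, finsum_eq_sum_of_support_subset (s := {0, 1})]
  · simp [Int.negOnePow_one, sub_eq_add_neg]
  · intro n hn
    by_contra hn'
    simp only [Finset.coe_insert, Finset.coe_singleton, Set.mem_insert_iff,
      Set.mem_singleton_iff, not_or] at hn'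
    exact hn (by simp [h n hn'.1 hn'.2])

variable [∀ n : ℤ, (shiftFunctor C n).Linear k] [HomFiniteCY k C] [ExtBounded C]

lemma finite_support_hd (X Y : C) : (Function.support (hd k X Y)).Finite := by
  refine (ExtBounded.finite X Y).subset fun n hn => ?_
  exact hd_pos_iff.1 (Nat.pos_of_ne_zero hn)

lemma finite_support_mul {F : ℤ → ℕ} (h : (Function.support F).Finite) :
    (Function.support fun n : ℤ => (n.negOnePow : ℤ) * F n).Finite :=
  h.subset fun n hn => by
    simp only [Function.mem_support, ne_eq, mul_eq_zero, not_or] at hn ⊢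
    exact_mod_cast hn.2

lemma chi_add {X Y Z : C} {f : X ⟶ Y} {g : Y ⟶ Z} {h : Z ⟶ X⟦(1 : ℤ)⟧}
    (hT : Triangle.mk f g h ∈ distTriang C) (U : C) :
    chi k U Y = chi k U X + chi k U Z := by
  let K : ℤ → ℕ := fun n => kerDim k U (f⟦n⟧')
  have hK : (Function.support K).Finite := (finite_support_hd (k := k) U X).subset fun n hn => by
    have h1 : K n ≤ hd k U X n := kerDim_le U n
    simp only [Function.mem_support] at hn ⊢
    lia
  have hK' : (Function.support fun n => K (n + 1)).Finite := by
    refine (hK.preimage ((add_left_injective (1 : ℤ)).injOn)).subset fun n hn => hn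
  -- Reindexing by one flips the sign, so the two kernel sums cancel.
  have e : ∑ᶠ n : ℤ, ((n.negOnePow : ℤ) * K (n + 1)) = -∑ᶠ n : ℤ, (n.negOnePow : ℤ) * K n := by
    rw [← finsum_comp_equiv (Equiv.addRight (1 : ℤ)) (f := fun n : ℤ => (n.negOnePow : ℤ) * K n),
      ← finsum_neg_distrib]
    refine finsum_congr fun n => ?_
    simp [Int.negOnePow_succ]
  have key : chi k U Y + ∑ᶠ n : ℤ, ((n.negOnePow : ℤ) * K n) +
      ∑ᶠ n : ℤ, ((n.negOnePow : ℤ) * K (n + 1)) = chi k U X + chi k U Z := by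
    rw [chi, chi, chi, ← finsum_add_distrib (finite_support_mul (finite_support_hd _ _))
        (finite_support_mul hK), ← finsum_add_distrib _ (finite_support_mul hK'),
        ← finsum_add_distrib (finite_support_mul (finite_support_hd _ _))
        (finite_support_mul (finite_support_hd _ _))]
    · refine finsum_congr fun n => ?_
      rw [← mul_add, ← mul_add, ← mul_add]
      congr 1
      exact_mod_cast tri_hd hT U n
    · exact ((finite_support_mul (finite_support_hd U Y)).union (finite_support_mul hK)).subset
        (Function.support_add _ _)
  rw [e] at key
  lia

lemma chi_serre (X Y : C) : chi k X Y = -chi k Y X := by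
  rw [chi, chi, ← finsum_neg_distrib,
    ← finsum_comp_equiv (Equiv.subLeft (1 : ℤ))]
  refine finsum_congr fun n => ?_
  simp only [Equiv.subLeft_apply]
  rw [hd_serre X Y, sub_sub_cancel, Int.negOnePow_sub]
  simp [Int.negOnePow_one]

lemma chi_add' {X Y Z : C} {f : X ⟶ Y} {g : Y ⟶ Z} {h : Z ⟶ X⟦(1 : ℤ)⟧}
    (hT : Triangle.mk f g h ∈ distTriang C) (U : C) :
    chi k Y U = chi k X U + chi k Z U := by
  rw [chi_serre Y, chi_serre X, chi_serre Z, chi_add hT]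
  ring

lemma chi_self (X : C) : chi k X X = 0 := by
  have := chi_serre (k := k) X X
  lia

end EulerForm

/-! ### Sequences of twists -/

section TwistSeq

variable {C : Type u} [Category.{v} C] [Preadditive C] [HasZeroObject C] [HasShift C ℤ]
  [∀ n : ℤ, (shiftFunctor C n).Additive] [Pretriangulated C]

lemma tri_iso₃ {X Y Z Z' : C} {f : X ⟶ Y} {g : Y ⟶ Z} {h : Z ⟶ X⟦(1 : ℤ)⟧}
    (hT : Triangle.mk f g h ∈ distTriang C) (e : Z ≅ Z') :
    Triangle.mk f (g ≫ e.hom) (e.inv ≫ h) ∈ distTriang C :=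
  isomorphic_distinguished _ hT _
    (Triangle.isoMk _ _ (Iso.refl X) (Iso.refl Y) e.symm
      (by change f ≫ 𝟙 Y = 𝟙 X ≫ f; simp)
      (by change (g ≫ e.hom) ≫ e.inv = 𝟙 Y ≫ g; simp)
      (by change (e.inv ≫ h) ≫ (𝟙 X)⟦(1 : ℤ)⟧' = e.inv ≫ h; simp))

variable (k : Type t) [Field k] [Linear k C]

/-- The numerical properties of the sequence of twists of a brick along a brick `B`, where `W` is a
power of `B`. -/
structure IsTwistSeq (E : ℤ → C) (W : C) (N : ℕ) : Prop where
  pos : 0 < N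
  brick (i : ℤ) : Brick k (E i)
  tri (i : ℤ) : ∃ (f : E i ⟶ E (i + 1)) (g : E (i + 1) ⟶ W) (h : W ⟶ (E i)⟦(1 : ℤ)⟧),
    Triangle.mk f g h ∈ distTriang C
  hd_self (i n : ℤ) : n ≠ 0 → n ≠ 1 → hd k (E i) (E i) n = 0
  hd_W (i n : ℤ) : n ≠ 0 → hd k (E i) W n = 0
  hd_W_zero (i : ℤ) : hd k (E i) W 0 = N

/-- The object `X` is a brick with `RHom(X, B) = k^a`. -/
def GoodFor (B : C) (a : ℕ) (X : C) : Prop :=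
  Brick k X ∧ (∀ n, n ≠ 0 → hd k X B n = 0) ∧ hd k X B 0 = a

variable {k}

variable [∀ n : ℤ, (shiftFunctor C n).Linear k] [HomFiniteCY k C] [ExtBounded C]

lemma Power.chi_from {Y V : C} {a : ℕ} (p : Power Y V a) (U : C) :
    chi k V U = a * chi k Y U := by
  rw [chi, chi, ← smul_eq_mul, smul_finsum]
  refine finsum_congr fun n => ?_
  rw [p.hd_from]
  push_cast
  rw [smul_eq_mul]
  ring

variable {B : C} {a : ℕ}

namespace GoodFor

variable {X : C} (hX : GoodFor k B a X)
include hX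

lemma hd_left (n : ℤ) (hn : n ≠ 1) : hd k B X n = 0 := by
  rw [hd_serre, hX.2.1 _ (by lia)]

/-- By duality, `RHom(B, X)` is concentrated in degree 1, so only `B[-1]` maps non-trivially to `X`.
-/
lemma evIndex_fst (p : EvIndex k B X) : p.1 = -1 := by
  by_contra hn
  have h1 : hd k (B⟦p.1⟧) X 0 = 0 := by rw [hd_shift_left]; exact hX.hd_left _ (by lia)
  have := (Module.Basis.ofVectorSpace k (B⟦p.1⟧ ⟶ X)).ne_zero p.2
  rw [Module.Basis.ofVectorSpace_apply_self] at this
  exact this (hd_zero_eq_zero_iff.1 h1 _)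

lemma coevIndex_fst (p : CoevIndex k B X) : p.1 = 0 := by
  by_contra hn
  have h1 : hd k X B p.1 = 0 := hX.2.1 _ hn
  have := (Module.Basis.ofVectorSpace k (X ⟶ B⟦p.1⟧)).ne_zero p.2
  rw [Module.Basis.ofVectorSpace_apply_self] at this
  exact this (hd_eq_zero_iff.1 h1 _)

lemma finite_evIndex : Finite (EvIndex k B X) := by
  have : Finite (Module.Basis.ofVectorSpaceIndex k (B⟦(-1 : ℤ)⟧ ⟶ X)) :=
    Module.Finite.finite_basis (Module.Basis.ofVectorSpace k _)
  refine Finite.of_surjective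
    (fun i : Module.Basis.ofVectorSpaceIndex k (B⟦(-1 : ℤ)⟧ ⟶ X) =>
      (⟨-1, i⟩ : EvIndex k B X)) ?_
  rintro ⟨n, i⟩
  obtain rfl : n = -1 := hX.evIndex_fst ⟨n, i⟩
  exact ⟨i, rfl⟩

lemma finite_coevIndex : Finite (CoevIndex k B X) := by
  have : Finite (Module.Basis.ofVectorSpaceIndex k (X ⟶ B⟦(0 : ℤ)⟧)) :=
    Module.Finite.finite_basis (Module.Basis.ofVectorSpace k _)
  refine Finite.of_surjective
    (fun i : Module.Basis.ofVectorSpaceIndex k (X ⟶ B⟦(0 : ℤ)⟧) =>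
      (⟨0, i⟩ : CoevIndex k B X)) ?_
  rintro ⟨n, i⟩
  obtain rfl : n = 0 := hX.coevIndex_fst ⟨n, i⟩
  exact ⟨i, rfl⟩

/-- Turns the graded coproduct in the definition of the twist into a finite power of `B[-1]`, so
that the results on cones of evaluations apply. -/
lemma exists_isEv_of_isColimit (c : Cofan fun p : EvIndex k B X => B⟦p.1⟧) (hc : IsColimit c) :
    ∃ p : Power (B⟦(-1 : ℤ)⟧) c.pt a,
      IsEv k p (Cofan.IsColimit.desc hc fun p => (p.2 : B⟦p.1⟧ ⟶ X)) := by
  classical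
  have hfin : Module.finrank k (B⟦(-1 : ℤ)⟧ ⟶ X) = a := by
    rw [← hd_zero, hd_shift_left, hd_serre]
    exact hX.2.2
  have : Finite (Module.Basis.ofVectorSpaceIndex k (B⟦(-1 : ℤ)⟧ ⟶ X)) :=
    Module.Finite.finite_basis (Module.Basis.ofVectorSpace k _)
  have := Fintype.ofFinite (Module.Basis.ofVectorSpaceIndex k (B⟦(-1 : ℤ)⟧ ⟶ X))
  let e0 : Module.Basis.ofVectorSpaceIndex k (B⟦(-1 : ℤ)⟧ ⟶ X) ≃ Fin a :=
    Fintype.equivFinOfCardEq (by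
      rw [← hfin, Module.finrank_eq_card_basis (Module.Basis.ofVectorSpace k _)])
  let q : Fin a → EvIndex k B X := fun i => ⟨-1, e0.symm i⟩
  have hq : ∀ p, ∃ i, q i = p := by
    rintro ⟨n, i⟩
    obtain rfl : n = -1 := hX.evIndex_fst ⟨n, i⟩
    exact ⟨e0 i, by simp [q]⟩
  have hqi : Function.Injective q := fun i j hij => by
    simpa [q] using hij
  let π (i : Fin a) : c.pt ⟶ B⟦(-1 : ℤ)⟧ := Cofan.IsColimit.desc hc fun p =>
    if h : p = q i then eqToHom (by rw [h]) else 0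
  have hπ (i j : Fin a) : c.inj (q i) ≫ π j = if i = j then 𝟙 _ else 0 := by
    simp only [π, Cofan.IsColimit.fac]
    by_cases hij : i = j
    · subst hij
      rw [dif_pos rfl, if_pos rfl]
      rfl
    · rw [dif_neg (fun h => hij (hqi h)), if_neg hij]
  let p : Power (B⟦(-1 : ℤ)⟧) c.pt a :=
    { ι := fun i => c.inj (q i)
      π := π
      ι_π := hπ
      total := by
        refine Cofan.IsColimit.hom_ext hc _ _ fun r => ?_
        obtain ⟨i, rfl⟩ := hq r
        rw [Preadditive.comp_sum, Finset.sum_eq_single i]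
        · rw [← Category.assoc, hπ, if_pos rfl]
          simp [q]
        · intro j _ hj
          rw [← Category.assoc, hπ, if_neg hj.symm, zero_comp]
        · simp }
  refine ⟨p, (Module.Basis.ofVectorSpace k _).reindex e0, fun i => ?_⟩
  simp only [p, Cofan.IsColimit.fac, Module.Basis.reindex_apply,
    Module.Basis.ofVectorSpace_apply_self, q]

lemma exists_isCoev_of_isLimit (c : Fan fun p : CoevIndex k B X => B⟦p.1⟧) (hc : IsLimit c) :
    ∃ p : Power (B⟦(0 : ℤ)⟧) c.pt a,
      IsCoev k p (Fan.IsLimit.lift hc fun p => (p.2 : X ⟶ B⟦p.1⟧)) := by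
  classical
  have hfin : Module.finrank k (X ⟶ B⟦(0 : ℤ)⟧) = a := hX.2.2
  have : Finite (Module.Basis.ofVectorSpaceIndex k (X ⟶ B⟦(0 : ℤ)⟧)) :=
    Module.Finite.finite_basis (Module.Basis.ofVectorSpace k _)
  have := Fintype.ofFinite (Module.Basis.ofVectorSpaceIndex k (X ⟶ B⟦(0 : ℤ)⟧))
  let e0 : Module.Basis.ofVectorSpaceIndex k (X ⟶ B⟦(0 : ℤ)⟧) ≃ Fin a :=
    Fintype.equivFinOfCardEq (by
      rw [← hfin, Module.finrank_eq_card_basis (Module.Basis.ofVectorSpace k _)])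
  let q : Fin a → CoevIndex k B X := fun i => ⟨0, e0.symm i⟩
  have hq : ∀ p, ∃ i, q i = p := by
    rintro ⟨n, i⟩
    obtain rfl : n = 0 := hX.coevIndex_fst ⟨n, i⟩
    exact ⟨e0 i, by simp [q]⟩
  have hqi : Function.Injective q := fun i j hij => by
    simpa [q] using hij
  let ι (i : Fin a) : B⟦(0 : ℤ)⟧ ⟶ c.pt := Fan.IsLimit.lift hc fun p =>
    if h : q i = p then eqToHom (by rw [← h]) else 0
  have hι (i j : Fin a) : ι i ≫ c.proj (q j) = if i = j then 𝟙 _ else 0 := by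
    simp only [ι, Fan.IsLimit.fac]
    by_cases hij : i = j
    · subst hij
      rw [dif_pos rfl, if_pos rfl]
      rfl
    · rw [dif_neg (fun h => hij (hqi h)), if_neg hij]
  let p : Power (B⟦(0 : ℤ)⟧) c.pt a :=
    { ι := ι
      π := fun i => c.proj (q i)
      ι_π := hι
      total := by
        refine Fan.IsLimit.hom_ext hc _ _ fun r => ?_
        obtain ⟨i, rfl⟩ := hq r
        rw [Preadditive.sum_comp, Finset.sum_eq_single i]
        · rw [Category.assoc, hι, if_pos rfl]
          simp [q]
        · intro j _ hj
          rw [Category.assoc, hι, if_neg hj, comp_zero]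
        · simp }
  refine ⟨p, (Module.Basis.ofVectorSpace k _).reindex e0, fun i => ?_⟩
  simp only [p, Fan.IsLimit.fac, Module.Basis.reindex_apply,
    Module.Basis.ofVectorSpace_apply_self, q]

variable (hB : Brick k B) (hBB : ∀ n, n ≠ 0 → n ≠ 1 → hd k B B n = 0) (ha : 0 < a)
  {W : C} (q : Power B W a)
include hB hBB ha q

/-- The twist is the cone of the evaluation at `B[-1]`, hence a brick once it is known to be
non-zero. In `RHom(F, B)` the triangle kills all degrees except 0 and 1. Degree 1 is dual to maps
from `B` to the cone, which vanish because `ev` uses a basis. The dimension in degree 0 is then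
forced by the Euler form, since `χ(B, B) = 0`. -/
theorem of_isTwist {F : C} (hF : IsTwist k B X F) :
    GoodFor k B a F ∧ ∃ (f : X ⟶ F) (g : F ⟶ W) (h : W ⟶ X⟦(1 : ℤ)⟧),
      Triangle.mk f g h ∈ distTriang C := by
  obtain ⟨c, hc, g, h, hT⟩ := hF
  obtain ⟨p, hev⟩ := hX.exists_isEv_of_isColimit c hc
  have hB' : Brick k (B⟦(-1 : ℤ)⟧) := hB.shift _
  let e : c.pt⟦(1 : ℤ)⟧ ≅ W :=
    ((p.map (shiftFunctor C (1 : ℤ))).ofIso ((shiftFunctorCompIsoId C (-1 : ℤ) 1 (by simp)).app B)).iso q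
  have hT' := tri_iso₃ (tri_rot hT) e
  have h0 : ∀ f : B⟦(-1 : ℤ)⟧⟦(1 : ℤ)⟧ ⟶ X, f = 0 := (hd_zero_eq_zero_iff (k := k)).1 (by
    rw [hd_shift_left, hd_shift_left]
    exact hX.hd_left _ (by lia))
  have h1 : hd k F B 1 = 0 := by
    have : hd k (B⟦(-1 : ℤ)⟧⟦(1 : ℤ)⟧) F 0 = 0 :=
      hd_zero_eq_zero_iff.2 (hev.hom_cone_eq_zero hB' hT h0)
    rw [hd_shift_left, hd_shift_left] at this
    rw [hd_serre]
    exact this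
  have h2 : ∀ n, n ≠ 0 → hd k F B n = 0 := fun n hn => by
    by_cases hn1 : n = 1
    · rw [hn1, h1]
    · have := hd_from_le₂ (k := k) hT' B n
      rw [hX.2.1 n hn, q.hd_from, hBB n hn hn1] at this
      lia
  have h3 : hd k F B 0 = a := by
    have := chi_add' (k := k) hT' B
    rw [q.chi_from, chi_self, chi_eq_single 0 h2, chi_eq_single 0 hX.2.1, hX.2.2] at this
    simpa using this
  refine ⟨⟨hev.brick_cone hB' hX.1 hT h0 fun hz => ?_, h2, h3⟩, _, _, _, hT'⟩
  have : hd k F B 0 = 0 := hd_zero_eq_zero_iff.2 fun f => hz.eq_of_src _ _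
  lia

/-- Dual to the previous argument. The exceptional degree is now -1, and it vanishes because the
coevaluation uses a basis. -/
theorem of_isCotwist {F : C} (hF : IsCotwist k B X F) :
    GoodFor k B a F ∧ ∃ (f : F ⟶ X) (g : X ⟶ W) (h : W ⟶ F⟦(1 : ℤ)⟧),
      Triangle.mk f g h ∈ distTriang C := by
  obtain ⟨c, hc, f, h, hT⟩ := hF
  obtain ⟨p, hcv⟩ := hX.exists_isCoev_of_isLimit c hc
  have hB' : Brick k (B⟦(0 : ℤ)⟧) := hB.shift _
  let e : c.pt ≅ W := (p.ofIso ((shiftFunctorZero C ℤ).app B)).iso q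
  have hT' := tri_iso₃ hT e
  have h0 : ∀ f : X⟦(1 : ℤ)⟧ ⟶ B⟦(0 : ℤ)⟧, f = 0 := (hd_eq_zero_iff (k := k)).1 (by
    rw [hd_shift_left]
    exact hX.2.1 _ (by lia))
  have h1 : hd k F B (-1) = 0 := by
    have : hd k (F⟦(1 : ℤ)⟧) B 0 = 0 :=
      hd_eq_zero_iff.2 (hcv.hom_cocone_eq_zero hB' hT h0)
    rw [hd_shift_left] at this
    exact this
  have h2 : ∀ n, n ≠ 0 → hd k F B n = 0 := fun n hn => by
    by_cases hn1 : n = -1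
    · rw [hn1, h1]
    · have := hd_from_le₁ (k := k) hT' B (n := n) rfl
      rw [hX.2.1 n hn, q.hd_from, hBB _ (by lia) (by lia)] at this
      lia
  have h3 : hd k F B 0 = a := by
    have := chi_add' (k := k) hT' B
    rw [q.chi_from, chi_self, chi_eq_single 0 h2, chi_eq_single 0 hX.2.1, hX.2.2] at this
    simpa using this.symm
  refine ⟨⟨hcv.brick_cocone hB' hX.1 hT h0 fun hz => ?_, h2, h3⟩, _, _, _, hT'⟩
  have : hd k F B 0 = 0 := hd_zero_eq_zero_iff.2 fun f => hz.eq_of_src _ _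
  lia

end GoodFor

end TwistSeq

/-! ### Decomposition into indecomposable objects -/

section Decomposition

variable {C : Type u} [Category.{v} C] [Preadditive C] [HasFiniteBiproducts C]
  [HasBinaryBiproducts C]

/-- The biproduct of two biproducts. -/
lemma biprod_biproduct_iso {J K : Type} [Fintype J] [Fintype K] (f : J → C) (g : K → C) :
    Nonempty ((⨁ f) ⊞ (⨁ g) ≅ ⨁ Sum.elim f g) := by
  classical
  let b : Bicone (Sum.elim f g) :=
    { pt := (⨁ f) ⊞ (⨁ g)
      ι := Sum.rec (fun j => biproduct.ι f j ≫ biprod.inl) (fun j => biproduct.ι g j ≫ biprod.inr)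
      π := Sum.rec (fun j => biprod.fst ≫ biproduct.π f j) (fun j => biprod.snd ≫ biproduct.π g j)
      ι_π := by
        rintro (i | i) (j | j)
        · change (biproduct.ι f i ≫ biprod.inl) ≫ biprod.fst ≫ biproduct.π f j = _
          rw [Category.assoc, biprod.inl_fst_assoc, biproduct.ι_π]
          by_cases h : i = j
          · subst h
            simp only [dif_pos]
            rfl
          · rw [dif_neg h, dif_neg (by simpa using h)]
            rfl
        · change (biproduct.ι f i ≫ biprod.inl) ≫ biprod.snd ≫ biproduct.π g j = _
          rw [dif_neg (by simp), Category.assoc, biprod.inl_snd_assoc, zero_comp, comp_zero]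
          rfl
        · change (biproduct.ι g i ≫ biprod.inr) ≫ biprod.fst ≫ biproduct.π f j = _
          rw [dif_neg (by simp), Category.assoc, biprod.inr_fst_assoc, zero_comp, comp_zero]
          rfl
        · change (biproduct.ι g i ≫ biprod.inr) ≫ biprod.snd ≫ biproduct.π g j = _
          rw [Category.assoc, biprod.inr_snd_assoc, biproduct.ι_π]
          by_cases h : i = j
          · subst h
            simp only [dif_pos]
            rfl
          · rw [dif_neg h, dif_neg (by simpa using h)]
            rfl }
  refine ⟨biproduct.uniqueUpToIso _ (isBilimitOfTotal b ?_)⟩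
  rw [Fintype.sum_sum_type]
  change ∑ j, (biprod.fst ≫ biproduct.π f j) ≫ biproduct.ι f j ≫ biprod.inl +
    ∑ j, (biprod.snd ≫ biproduct.π g j) ≫ biproduct.ι g j ≫ biprod.inr = 𝟙 ((⨁ f) ⊞ (⨁ g))
  have h1 : ∑ j, (biprod.fst ≫ biproduct.π f j) ≫ biproduct.ι f j ≫ biprod.inl =
      (biprod.fst ≫ biprod.inl : (⨁ f) ⊞ (⨁ g) ⟶ (⨁ f) ⊞ (⨁ g)) := by
    conv_rhs => rw [← Category.id_comp (biprod.inl : ⨁ f ⟶ (⨁ f) ⊞ (⨁ g)), ← biproduct.total,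
      Preadditive.sum_comp, Preadditive.comp_sum]
    simp only [Category.assoc]
  have h2 : ∑ j, (biprod.snd ≫ biproduct.π g j) ≫ biproduct.ι g j ≫ biprod.inr =
      (biprod.snd ≫ biprod.inr : (⨁ f) ⊞ (⨁ g) ⟶ (⨁ f) ⊞ (⨁ g)) := by
    conv_rhs => rw [← Category.id_comp (biprod.inr : ⨁ g ⟶ (⨁ f) ⊞ (⨁ g)), ← biproduct.total,
      Preadditive.sum_comp, Preadditive.comp_sum]
    simp only [Category.assoc]
  rw [h1, h2, biprod.total]

/-- Induction on the dimension of the endomorphism space: `End Y × End Z` embeds in `End (Y ⊞ Z)`,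
so it drops for both summands of a proper decomposition. -/
theorem exists_iso_biproduct_indecomposable [HasZeroObject C] (k : Type t) [Field k] [Linear k C]
    [∀ X Y : C, Module.Finite k (X ⟶ Y)] (X : C) :
    ∃ (n : ℕ) (Y : Fin n → C), (∀ j, Indecomposable (Y j)) ∧ Nonempty (X ≅ ⨁ Y) := by
  suffices H : ∀ (m : ℕ) (X : C), Module.finrank k (X ⟶ X) = m →
      ∃ (J : Type) (_ : Fintype J) (Y : J → C), (∀ j, Indecomposable (Y j)) ∧
        Nonempty (X ≅ ⨁ Y) by
    obtain ⟨J, _, Y, hY, ⟨e⟩⟩ := H _ X rfl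
    exact ⟨Fintype.card J, fun j => Y ((Fintype.equivFin J).symm j), fun j => hY _,
      ⟨e ≪≫ (biproduct.whiskerEquiv (Fintype.equivFin J).symm fun _ => Iso.refl _).symm⟩⟩
  intro m
  induction m using Nat.strong_induction_on with
  | _ m ih =>
    intro X hX
    by_cases hz : IsZero X
    · refine ⟨Fin 0, inferInstance, Fin.elim0, fun j => j.elim0, ⟨hz.iso ?_⟩⟩
      rw [IsZero.iff_id_eq_zero]
      exact biproduct.hom_ext' _ _ fun j => j.elim0
    by_cases hi : Indecomposable X
    · exact ⟨Unit, inferInstance, fun _ => X, fun _ => hi, ⟨(biproductUniqueIso fun _ : Unit => X).symm⟩⟩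
    simp only [Indecomposable, not_and, not_forall, not_or] at hi
    obtain ⟨Y, Z, e, hY, hZ⟩ := hi hz
    let φ : (Y ⟶ Y) × (Z ⟶ Z) →ₗ[k] (Y ⊞ Z ⟶ Y ⊞ Z) :=
      { toFun := fun f => biprod.map f.1 f.2
        map_add' := fun f g => by
          refine biprod.hom_ext' _ _ ?_ ?_ <;> simp
        map_smul' := fun c f => by
          refine biprod.hom_ext' _ _ ?_ ?_ <;> simp }
    have hφ : Function.Injective φ := fun f g hfg => by
      have h1 := biprod.inl ≫= hfg =≫ biprod.fst
      have h2 := biprod.inr ≫= hfg =≫ biprod.snd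
      simp only [LinearMap.coe_mk, AddHom.coe_mk, biprod.map_fst,
        biprod.inl_fst_assoc, biprod.map_snd, biprod.inr_snd_assoc, φ] at h1 h2
      exact Prod.ext h1 h2
    have h1 := LinearMap.finrank_le_finrank_of_injective hφ
    rw [Module.finrank_prod, ← (Linear.homCongr k e e).finrank_eq, hX] at h1
    have pos : ∀ Y : C, ¬ IsZero Y → 0 < Module.finrank k (Y ⟶ Y) := fun Y hY => by
      have : Nontrivial (Y ⟶ Y) := ⟨𝟙 Y, 0, fun h => hY ((IsZero.iff_id_eq_zero Y).2 h)⟩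
      exact Module.finrank_pos
    have hY' := pos Y hY
    have hZ' := pos Z hZ
    obtain ⟨J, _, F, hF, ⟨eF⟩⟩ := ih (Module.finrank k (Y ⟶ Y)) (by lia) Y rfl
    obtain ⟨K, _, G, hG, ⟨eG⟩⟩ := ih (Module.finrank k (Z ⟶ Z)) (by lia) Z rfl
    obtain ⟨eFG⟩ := biprod_biproduct_iso F G
    refine ⟨J ⊕ K, inferInstance, Sum.elim F G, ?_, ⟨e ≪≫ biprod.mapIso eF eG ≪≫ eFG⟩⟩
    rintro (j | j)
    · exact hF j
    · exact hG j

/-- Non-zero objects have indecomposable summands. -/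
lemma exists_indecomposable_retract [HasZeroObject C] (k : Type t) [Field k] [Linear k C]
    [∀ X Y : C, Module.Finite k (X ⟶ Y)] {X : C} (hX : ¬ IsZero X) :
    ∃ (Y : C) (_ : Retract Y X), Indecomposable Y := by
  obtain ⟨n, Y, hY, ⟨e⟩⟩ := exists_iso_biproduct_indecomposable k X
  by_cases hn : Nonempty (Fin n)
  · obtain ⟨j⟩ := hn
    exact ⟨Y j, ⟨biproduct.ι Y j ≫ e.inv, e.hom ≫ biproduct.π Y j, by simp⟩, hY j⟩
  · refine absurd ?_ hX
    rw [IsZero.iff_id_eq_zero, ← cancel_mono e.hom]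
    refine biproduct.hom_ext _ _ fun j => absurd ⟨j⟩ hn

end Decomposition

lemma indecomposable_of_iso {C : Type u} [Category.{v} C] [Preadditive C]
    [HasBinaryBiproducts C] {X Y : C} (hX : Indecomposable X) (e : X ≅ Y) : Indecomposable Y :=
  ⟨fun h => hX.1 (h.of_iso e), fun P Q e' => hX.2 P Q (e ≪≫ e')⟩

/-- Faithful additive functors reflect indecomposability. -/
lemma indecomposable_of_faithful {C : Type*} {D : Type*} [Category* C]
    [Category* D] [Preadditive C] [Preadditive D] [HasBinaryBiproducts C] [HasBinaryBiproducts D]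
    (F : C ⥤ D) [F.Additive] [F.Faithful] {X : C} (hX : Indecomposable (F.obj X)) :
    Indecomposable X := by
  have hF : ∀ Y : C, IsZero (F.obj Y) → IsZero Y := fun Y hY => by
    rw [IsZero.iff_id_eq_zero] at hY ⊢
    exact F.map_injective (by simpa using hY)
  have := preservesBinaryBiproducts_of_preservesBiproducts F
  refine ⟨fun h => hX.1 (F.map_isZero h), fun Y Z e => ?_⟩
  exact (hX.2 _ _ (F.mapIso e ≪≫ F.mapBiprod Y Z)).imp (hF Y) (hF Z)

/-! ### t-structures on `1`-Calabi-Yau categories -/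

section TStructures

variable {C : Type u} [Category.{v} C] [Preadditive C] [HasZeroObject C] [HasShift C ℤ]
  [∀ n : ℤ, (shiftFunctor C n).Additive] [Pretriangulated C]

lemma indecomposable_shift {X : C} (hX : Indecomposable X) (n : ℤ) : Indecomposable (X⟦n⟧) := by
  refine indecomposable_of_faithful (shiftFunctor C (-n)) (indecomposable_of_iso hX ?_)
  exact ((shiftFunctorCompIsoId C n (-n) (by simp)).app X).symm

variable (T : TStructure C)

lemma isLE_of_retract {X Y : C} (r : Retract X Y) {n : ℤ} (hY : T.IsLE Y n) : T.IsLE X n := by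
  rw [T.isLE_iff_orthogonal n (n + 1) rfl]
  intro Z f hZ
  rw [← Category.id_comp f, ← r.retract, Category.assoc,
    T.zero_of_isLE_of_isGE (r.r ≫ f) n (n + 1) (by lia) hY hZ, comp_zero]

lemma isGE_of_retract {X Y : C} (r : Retract X Y) {n : ℤ} (hY : T.IsGE Y n) : T.IsGE X n := by
  rw [T.isGE_iff_orthogonal (n - 1) n (by lia)]
  intro Z f hZ
  rw [← Category.comp_id f, ← r.retract, ← Category.assoc,
    T.zero_of_isLE_of_isGE (f ≫ r.i) (n - 1) n (by lia) hZ hY, zero_comp]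

lemma isLE_biproduct {J : Type} [Finite J] (Y : J → C) {n : ℤ} (h : ∀ j, T.IsLE (Y j) n) :
    T.IsLE (⨁ Y) n := by
  rw [T.isLE_iff_orthogonal n (n + 1) rfl]
  intro Z f hZ
  refine biproduct.hom_ext' _ _ fun j => ?_
  rw [comp_zero]
  exact T.zero_of_isLE_of_isGE _ n (n + 1) (by lia) (h j) hZ

lemma isGE_biproduct {J : Type} [Finite J] (Y : J → C) {n : ℤ} (h : ∀ j, T.IsGE (Y j) n) :
    T.IsGE (⨁ Y) n := by
  rw [T.isGE_iff_orthogonal (n - 1) n (by lia)]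
  intro Z f hZ
  refine biproduct.hom_ext _ _ fun j => ?_
  rw [zero_comp]
  exact T.zero_of_isLE_of_isGE _ (n - 1) n (by lia) hZ (h j)

lemma isZero_of_isLE_of_isGE {X : C} {a b : ℤ} (hab : a < b) (h1 : T.IsLE X a)
    (h2 : T.IsGE X b) : IsZero X := by
  rw [IsZero.iff_id_eq_zero]
  exact T.zero_of_isLE_of_isGE _ a b hab h1 h2

/-- Each object lies in `D^{≤ n}` and in `D^{≥ m}` for some `n` and `m`. -/
def TBounded : Prop := ∀ X : C, (∃ n, T.IsLE X n) ∧ ∃ n, T.IsGE X n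

section

variable (k : Type t) [Field k] [Linear k C] [HomFiniteCY k C]
include k

/-- The space is dual to `Hom(X, Y)`, which vanishes by the t-structure axiom. This makes all
t-structures split. -/
lemma hom_shift_eq_zero {X Y : C} {a b : ℤ} (hX : T.IsLE X a) (hY : T.IsGE Y b) (hab : a < b)
    (f : Y ⟶ X⟦(1 : ℤ)⟧) : f = 0 :=
  hom_eq_zero_of_serre k (fun g => T.zero_of_isLE_of_isGE g a b hab hX hY) f

/-- The truncation triangle splits, so one of the truncations of an indecomposable object vanishes.
-/
lemma isLE_or_isGE {X : C} (hX : Indecomposable X) (n : ℤ) : T.IsLE X n ∨ T.IsGE X (n + 1) := by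
  obtain ⟨X', X'', h1, h2, f, g, h, hT⟩ := T.exists_triangle X n (n + 1) rfl
  have h0 : h = 0 := hom_shift_eq_zero T k ⟨h1⟩ ⟨h2⟩ (by lia) h
  obtain ⟨e, -, -⟩ := exists_iso_binaryBiproduct_of_distTriang _ hT h0
  rcases hX.2 _ _ e with hz | hz
  · right
    have hz : IsZero X' := hz
    have := T.isGE₂ _ hT (n + 1) (T.isGE_of_isZero hz _) ⟨h2⟩
    exact this
  · left
    have hz : IsZero X'' := hz
    have := T.isLE₂ _ hT n ⟨h1⟩ (T.isLE_of_isZero hz _)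
    exact this

lemma exists_isLE_isGE (hT : TBounded T) {X : C} (hX : Indecomposable X) :
    ∃ d, T.IsLE X d ∧ T.IsGE X d := by
  obtain ⟨a, ha⟩ := (hT X).2
  obtain ⟨d, hd, hd'⟩ := Int.exists_least_of_bdd (P := fun n => T.IsLE X n)
    ⟨a, fun n hn => by
      by_contra h
      exact hX.1 (isZero_of_isLE_of_isGE T (by lia) hn ha)⟩ (hT X).1
  refine ⟨d, hd, ?_⟩
  rcases isLE_or_isGE T k hX (d - 1) with h | h
  · have := hd' _ h
    lia
  · simpa using h

end

variable {k : Type t} [Field k] [Linear k C] [∀ n : ℤ, (shiftFunctor C n).Linear k]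
  [HomFiniteCY k C]

lemma hd_eq_zero_of_isLE_of_isGE {X Y : C} {a b n : ℤ} (hX : T.IsLE X a) (hY : T.IsGE Y b)
    (h : n < b - a) : hd k X Y n = 0 :=
  hd_eq_zero_iff.2 fun f => T.zero_of_isLE_of_isGE f a (b - n) (by lia) hX
    (T.isGE_shift Y b n (b - n))

lemma hd_eq_zero_of_isGE_of_isLE {X Y : C} {a b n : ℤ} (hX : T.IsGE X a) (hY : T.IsLE Y b)
    (h : 1 - n < a - b) : hd k X Y n = 0 := by
  rw [hd_serre]
  exact hd_eq_zero_of_isLE_of_isGE T hY hX h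

lemma hd_self_eq_zero (hT : TBounded T) {X : C} (hX : Indecomposable X) {n : ℤ} (h0 : n ≠ 0)
    (h1 : n ≠ 1) : hd k X X n = 0 := by
  obtain ⟨d, hd1, hd2⟩ := exists_isLE_isGE T k hT hX
  by_cases hn : n < 0
  · exact hd_eq_zero_of_isLE_of_isGE T hd1 hd2 (by lia)
  · exact hd_eq_zero_of_isGE_of_isLE T hd2 hd1 (by lia)

lemma extBounded_of_tBounded (k : Type t) [Field k] [Linear k C]
    [∀ n : ℤ, (shiftFunctor C n).Linear k]
    [HomFiniteCY k C] (hT : TBounded T) : ExtBounded C := by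
  refine ⟨fun X Y => ?_⟩
  obtain ⟨⟨a, ha⟩, ⟨a', ha'⟩⟩ := hT X
  obtain ⟨⟨b, hb⟩, ⟨b', hb'⟩⟩ := hT Y
  refine (Set.finite_Icc (b' - a) (b - a' + 1)).subset ?_
  rintro n ⟨f, hf⟩
  rw [Set.mem_Icc]
  constructor
  · by_contra hn
    exact hf (hd_eq_zero_iff.1 (hd_eq_zero_of_isLE_of_isGE (k := k) T ha hb' (by lia)) f)
  · by_contra hn
    exact hf (hd_eq_zero_iff.1 (hd_eq_zero_of_isGE_of_isLE (k := k) T ha' hb (by lia)) f)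

end TStructures

/-! ### Bricks in a heart -/

section Bricks

variable {k : Type t} [Field k] {C : Type u} [Category.{v} C] [Preadditive C] [Linear k C]

/-- Both composites are scalars, and they are equal because `(f ≫ g) ≫ f = f ≫ g ≫ f`. So `f` is
invertible up to a non-zero scalar. -/
lemma Brick.nonempty_iso {X Y : C} (hX : Brick k X) (hY : Brick k Y) (f : X ⟶ Y) (g : Y ⟶ X)
    (hfg : f ≫ g ≠ 0) : Nonempty (X ≅ Y) := by
  obtain ⟨c, hc⟩ := hX.2 (f ≫ g)
  obtain ⟨d, hd⟩ := hY.2 (g ≫ f)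
  have hc0 : c ≠ 0 := fun h => hfg (by rw [hc, h, zero_smul])
  have hf : f ≠ 0 := fun h => hfg (by rw [h, zero_comp])
  have hcd : c = d := by
    have h1 : c • f = d • f := by
      have : (f ≫ g) ≫ f = f ≫ g ≫ f := Category.assoc _ _ _
      rw [hc, hd] at this
      simpa using this
    exact smul_left_injective k hf h1
  refine ⟨⟨f, c⁻¹ • g, ?_, ?_⟩⟩
  · rw [Linear.comp_smul, hc, smul_smul, inv_mul_cancel₀ hc0, one_smul]
  · rw [Linear.smul_comp, hd, ← hcd, smul_smul, inv_mul_cancel₀ hc0, one_smul]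

end Bricks

section

variable {C : Type u} [Category.{v} C] [Preadditive C] [HasZeroObject C] [HasShift C ℤ]
  [∀ n : ℤ, (shiftFunctor C n).Additive] [Pretriangulated C]
  {k : Type t} [Field k] [Linear k C] [∀ n : ℤ, (shiftFunctor C n).Linear k] [HomFiniteCY k C]
  (T : TStructure C)

/-- Bricks in the heart with non-zero maps in both directions are isomorphic. -/
theorem Brick.nonempty_iso_of_heart {X Y : C} (hX : Brick k X) (hY : Brick k Y)
    (hX₁ : T.IsLE X 0) (hX₂ : T.IsGE X 0) (hY₁ : T.IsLE Y 0) (hY₂ : T.IsGE Y 0)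
    (f : X ⟶ Y) (hf : f ≠ 0) (g : Y ⟶ X) (hg : g ≠ 0) : Nonempty (X ≅ Y) := by
  obtain ⟨V, p, ev, hev⟩ := exists_isEv k Y X
  obtain ⟨Z, q, h, hT⟩ := distinguished_cocone_triangle ev
  have key : T.IsLE Z (-1) ∨ T.IsGE Z 0 := by
    -- The two alternatives say that the evaluation is an epimorphism or a monomorphism in the
    -- heart.
    by_cases hZ : IsZero Z
    · exact Or.inl (T.isLE_of_isZero hZ _)
    · refine isLE_or_isGE T k (hev.brick_cone hY hX hT (fun f => ?_) hZ).indecomposable (-1)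
      exact T.zero_of_isLE_of_isGE f (-1) 0 (by lia) (T.isLE_shift Y 0 1 (-1)) hX₂
  rcases key with hZ | hZ
  · by_contra hne
    -- In the epimorphic case `ev ≫ f` cannot vanish, so some `Y ⟶ X ⟶ Y` is non-zero.
    have h1 : ev ≫ f = 0 := hev.comp_eq_zero fun e => by
      by_contra he
      exact hne ((hY.nonempty_iso hX e f he).map Iso.symm)
    obtain ⟨v, rfl⟩ := tri_desc₂ hT f h1
    exact hf (by rw [T.zero_of_isLE_of_isGE v (-1) 0 (by lia) hZ hY₂, comp_zero])
  · obtain ⟨s, rfl⟩ := hev.fac g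
    obtain ⟨i, hi⟩ : ∃ i, s ≫ p.π i ≠ 0 := by
      by_contra! H
      refine hg ?_
      rw [p.hom_ext' (f := s) (g := 0) (fun i => by rw [H, zero_comp]), zero_comp]
    -- In the monomorphic case `f` followed by an inclusion `Y ⟶ V` stays non-zero after `ev`. A
    -- summand exists because `g` is non-zero.
    refine hX.nonempty_iso hY f (p.ι i ≫ ev) fun h0 => ?_
    rw [← Category.assoc] at h0
    obtain ⟨v, hv⟩ := tri_lift₂ (inv_rot_of_distTriang _ hT) (f ≫ p.ι i) h0
    have : T.IsGE (Z⟦(-1 : ℤ)⟧) 1 := T.isGE_shift Z 0 (-1) 1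
    have hv0 : v = 0 := T.zero_of_isLE_of_isGE v 0 1 (by lia) hX₁ this
    rw [hv0, zero_comp] at hv
    have hv' : f ≫ p.ι i = 0 := hv.symm
    have h2 := p.ι_π i i
    rw [if_pos rfl] at h2
    refine hf ?_
    rw [← Category.comp_id f, ← h2, ← Category.assoc, hv', zero_comp]

end

/-! ### Construction of twist sequences -/

section

variable {C : Type u} [Category.{v} C] [Preadditive C] [HasZeroObject C] [HasShift C ℤ]
  [∀ n : ℤ, (shiftFunctor C n).Additive] [Pretriangulated C]
  {k : Type t} [Field k] [Linear k C] [∀ n : ℤ, (shiftFunctor C n).Linear k] [HomFiniteCY k C]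
  [ExtBounded C]

section

variable {B : C} {a : ℕ} (hB : Brick k B) (hBB : ∀ n, n ≠ 0 → n ≠ 1 → hd k B B n = 0) (ha : 0 < a)
include hB hBB ha

lemma GoodFor.twist {X W : C} (hX : GoodFor k B a X) (q : Power B W a) :
    GoodFor k B a (twist k B X) ∧
      ∃ (f : X ⟶ OneCY.twist k B X) (g : OneCY.twist k B X ⟶ W) (h : W ⟶ X⟦(1 : ℤ)⟧),
      Triangle.mk f g h ∈ distTriang C := by
  have := hX.finite_evIndex
  have : HasColimitsOfShape (Discrete (EvIndex k B X)) C := hasColimitsOfShape_discrete C _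
  exact hX.of_isTwist hB hBB ha q (isTwist_twist k B X)

lemma GoodFor.cotwist {X W : C} (hX : GoodFor k B a X) (q : Power B W a) :
    GoodFor k B a (cotwist k B X) ∧
      ∃ (f : OneCY.cotwist k B X ⟶ X) (g : X ⟶ W) (h : W ⟶ (OneCY.cotwist k B X)⟦(1 : ℤ)⟧),
      Triangle.mk f g h ∈ distTriang C := by
  have := hX.finite_coevIndex
  have : HasLimitsOfShape (Discrete (CoevIndex k B X)) C := hasLimitsOfShape_discrete C _
  exact hX.of_isCotwist hB hBB ha q (isCotwist_cotwist k B X)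

lemma GoodFor.isTwistSeq (T : TStructure C) (hT : TBounded T) {X : C} (hX : GoodFor k B a X) :
    IsTwistSeq k (twistSeq k B X) (⨁ fun _ : Fin a => B) (a * a) := by
  let q := Power.biproduct B a
  have good : ∀ i, GoodFor k B a (twistSeq k B X i) := by
    rintro (n | n)
    · induction n with
      | zero => exact hX
      | succ n ih =>
        change GoodFor k B a ((OneCY.twist k B)^[n + 1] X)
        rw [Function.iterate_succ_apply']
        exact (GoodFor.twist hB hBB ha ih q).1
    · induction n with
      | zero => exact (GoodFor.cotwist hB hBB ha hX q).1
      | succ n ih =>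
        change GoodFor k B a ((OneCY.cotwist k B)^[n + 1 + 1] X)
        rw [Function.iterate_succ_apply']
        exact (GoodFor.cotwist hB hBB ha ih q).1
  -- The constant is `a * a`, since `W` consists of `a` copies of `B` and each `Hom(E i, B)` has
  -- dimension `a`.
  refine ⟨by positivity, fun i => (good i).1, ?_, fun i n => ?_, fun i n hn => ?_, fun i => ?_⟩
  · rintro (n | n)
    · have e : twistSeq k B X (Int.ofNat n + 1) = OneCY.twist k B (twistSeq k B X (Int.ofNat n)) :=
        Function.iterate_succ_apply' _ _ _
      rw [e]
      exact (GoodFor.twist hB hBB ha (good (Int.ofNat n)) q).2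
    · cases n with
      | zero => exact (GoodFor.cotwist hB hBB ha hX q).2
      | succ n =>
        have e : twistSeq k B X (Int.negSucc (n + 1)) =
          OneCY.cotwist k B (twistSeq k B X (Int.negSucc n)) := Function.iterate_succ_apply' _ _ _
        have e' : Int.negSucc (n + 1) + 1 = Int.negSucc n := rfl
        rw [e', e]
        exact (GoodFor.cotwist hB hBB ha (good (Int.negSucc n)) q).2
  · exact hd_self_eq_zero T hT (good i).1.indecomposable
  · rw [q.hd_to, (good i).2.1 n hn, mul_zero]
  · rw [q.hd_to, (good i).2.2]

end

/-! ### Hom-spaces inside a twist sequence -/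

namespace IsTwistSeq

variable {E : ℤ → C} {W : C} {N : ℕ} (hE : IsTwistSeq k E W N)
include hE

lemma hd_W_left (i n : ℤ) (hn : n ≠ 1) : hd k W (E i) n = 0 := by
  rw [hd_serre, hE.hd_W _ _ (by lia)]

/-- If the connecting map were zero, the identity of `W` would factor through `E (i + 1)`. But
`Hom(W, E (i + 1)) = 0` and `W` is non-zero. -/
lemma conn_ne_zero {i : ℤ} {f : E i ⟶ E (i + 1)} {g : E (i + 1) ⟶ W} {h : W ⟶ (E i)⟦(1 : ℤ)⟧}
    (hT : Triangle.mk f g h ∈ distTriang C) : h ≠ 0 := by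
  intro h0
  obtain ⟨v, hv⟩ := tri_lift₃ hT (𝟙 W) (by rw [h0, comp_zero])
  have h1 : v = 0 := (hd_zero_eq_zero_iff (k := k)).1 (hE.hd_W_left (i + 1) 0 (by lia)) v
  rw [h1, zero_comp] at hv
  have h2 : hd k (E i) W 0 = 0 := hd_zero_eq_zero_iff.2 fun f => by
    rw [← Category.comp_id f, ← hv, comp_zero]
  rw [hE.hd_W_zero] at h2
  exact hE.pos.ne' h2

/-- `Hom(E i, (E i)[1])` is one-dimensional, being dual to the endomorphisms of a brick. By
non-degeneracy it is spanned by a map through the connecting map `h`. A map to `(E (i + 1))[1]`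
comes from this line, and the line is killed because `h ≫ f[1] = 0`. -/
lemma hd_succ_one (i : ℤ) : hd k (E i) (E (i + 1)) 1 = 0 := by
  obtain ⟨f, g, h, hT⟩ := hE.tri i
  obtain ⟨p, hp⟩ := exists_pre_ne_zero k h (hE.conn_ne_zero hT)
  have h1 : Module.finrank k (E i ⟶ (E i)⟦(1 : ℤ)⟧) = 1 := by
    rw [← finrank_serre, (hE.brick i).finrank_end]
  refine hd_eq_zero_iff.2 fun u => ?_
  obtain ⟨v, hv⟩ := tri_lift₂ (tri_rot (tri_rot (tri_rot hT))) u
    (hd_eq_zero_iff.1 (hE.hd_W i 1 (by lia)) _)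
  obtain ⟨c, hc⟩ := (finrank_eq_one_iff_of_nonzero' (p ≫ h) hp).1 h1 v
  rw [← hv, ← hc, Linear.smul_comp, Preadditive.comp_neg, Category.assoc, tri_zero₃₁ hT]
  simp

lemma hd_eq_zero {l i : ℤ} (h : l < i) {n : ℤ} (hn : n ≠ 0) : hd k (E l) (E i) n = 0 := by
  induction i, (show l + 1 ≤ i by lia) using Int.leInduction with
  | base =>
    by_cases hn1 : n = 1
    · rw [hn1, hE.hd_succ_one]
    · obtain ⟨f, g, h, hT⟩ := hE.tri l
      have := hd_le₂ (k := k) hT (E l) n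
      rw [hE.hd_self l n hn hn1, hE.hd_W l n hn] at this
      lia
  | succ i hi ih =>
    obtain ⟨f, g, h, hT⟩ := hE.tri i
    have := hd_le₂ (k := k) hT (E l) n
    rw [ih (by lia), hE.hd_W l n hn] at this
    lia

lemma hd_eq_zero' {l i : ℤ} (h : l < i) {n : ℤ} (hn : n ≠ 1) : hd k (E i) (E l) n = 0 := by
  rw [hd_serre, hE.hd_eq_zero h (by lia)]

lemma chi_left (U : C) (i j : ℤ) : chi k (E j) U = chi k (E i) U + (j - i) * chi k W U := by
  have step : ∀ i, chi k (E (i + 1)) U = chi k (E i) U + chi k W U := fun i => by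
    obtain ⟨f, g, h, hT⟩ := hE.tri i
    exact chi_add' hT U
  induction j using Int.inductionOn' (b := i) with
  | zero => ring
  | succ j hj ih => rw [step, ih]; ring
  | pred j hj ih =>
    have := step (j - 1)
    rw [sub_add_cancel, ih] at this
    linarith

lemma chi_eq (l i : ℤ) : chi k (E l) (E i) = (i - l) * N := by
  rw [hE.chi_left (E i) i l, chi_self, chi_serre W, chi_eq_single 0 (fun n hn => hE.hd_W i n hn),
    hE.hd_W_zero]
  simp
  ring

lemma hd_zero_eq {l i : ℤ} (h : l < i) : (hd k (E l) (E i) 0 : ℤ) = (i - l) * N := by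
  rw [← hE.chi_eq, chi_eq_single 0 (fun n hn => hE.hd_eq_zero h hn)]
  simp

lemma exists_ne_zero {l i : ℤ} (h : l < i) : ∃ f : E l ⟶ E i, f ≠ 0 := by
  by_contra! H
  have h1 := hE.hd_zero_eq h
  rw [hd_zero_eq_zero_iff.2 H] at h1
  have h2 : 0 < (i - l) * (N : ℤ) := mul_pos (by lia) (by exact_mod_cast hE.pos)
  lia

/-- Non-zero maps from a member of the sequence to an object of `D^{≥ 0}` are detected by the
members of smaller index. -/
theorem exists_comp_ne_zero (T : TStructure C) {i j : ℤ} (hij : j + 2 ≤ i)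
    (hj : T.IsLE (E (j - 3)) 0) {G : C} (hG : T.IsGE G 0) (g : E i ⟶ G) (hg : g ≠ 0) :
    ∃ e : E j ⟶ E i, e ≫ g ≠ 0 := by
  by_contra! H
  obtain ⟨V, p, ev, hev⟩ := exists_isEv k (E j) (E i)
  obtain ⟨Z, q, h, hT⟩ := distinguished_cocone_triangle ev
  obtain ⟨v, hv⟩ := tri_desc₂ hT g (hev.comp_eq_zero H)
  -- `g` factors through the cone `Z`, which is therefore a brick. As the factorization is non-zero
  -- and ends in `D^{≥ 0}`, `Z` cannot lie in `D^{≤ -1}`.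
  have hZ : ¬ IsZero Z := fun hZ => hg (by rw [← hv, hZ.eq_of_src v 0, comp_zero])
  have hZb := hev.brick_cone (hE.brick j) (hE.brick i) hT
    ((hd_zero_eq_zero_iff (k := k)).1 (by
      rw [hd_shift_left]; exact hE.hd_eq_zero (by lia) (by lia))) hZ
  have hZ0 : T.IsGE Z 0 := by
    rcases isLE_or_isGE T k hZb.indecomposable (-1) with h1 | h1
    · refine absurd ?_ hg
      rw [← hv, T.zero_of_isLE_of_isGE v (-1) 0 (by lia) h1 hG, comp_zero]
    · exact h1
  -- Since `Hom(E (j - 3), Z[-1]) = 0`, counting dimensions gives `3 (i - j) N² ≤ (i - j + 3) N`.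
  -- This is impossible for `i - j ≥ 2` and `N ≥ 1`. An offset of 2 instead of 3 would allow
  -- equality when `N = 1` and `i - j = 2`.
  have h1 := hd_le₁ (k := k) hT (E (j - 3)) (n := -1) (m := 0) (by lia)
  rw [hd_eq_zero_of_isLE_of_isGE T hj hZ0 (by lia), p.hd_to, add_zero, ← hd_zero] at h1
  have h2 := hE.hd_zero_eq (show j < i by lia)
  have h3 := hE.hd_zero_eq (show j - 3 < j by lia)
  have h4 := hE.hd_zero_eq (show j - 3 < i by lia)
  zify at h1
  rw [h2, h3, h4] at h1
  have h5 : (0 : ℤ) < N := by exact_mod_cast hE.pos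
  obtain ⟨m, rfl⟩ : ∃ m : ℕ, i = j + 2 + m := ⟨(i - (j + 2)).toNat, by lia⟩
  nlinarith [mul_nonneg (Int.natCast_nonneg m) h5.le, mul_pos h5 h5,
    mul_nonneg (Int.natCast_nonneg m) (mul_nonneg h5.le (show (0 : ℤ) ≤ N - 1 by lia)),
    mul_nonneg h5.le (show (0 : ℤ) ≤ N - 1 by lia)]

end IsTwistSeq

end

/-! ### Torsion pairs generated by a sequence -/

section

variable {C : Type u} [Category.{v} C] [Preadditive C] [HasZeroObject C] [HasShift C ℤ]
  [∀ n : ℤ, (shiftFunctor C n).Additive] [Pretriangulated C]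

lemma tri_iso {X Y Z X' Y' Z' : C} {f : X ⟶ Y} {g : Y ⟶ Z} {h : Z ⟶ X⟦(1 : ℤ)⟧}
    (hT : Triangle.mk f g h ∈ distTriang C) (a : X ≅ X') (b : Y ≅ Y') (c : Z ≅ Z') :
    Triangle.mk (a.inv ≫ f ≫ b.hom) (b.inv ≫ g ≫ c.hom) (c.inv ≫ h ≫ a.hom⟦(1 : ℤ)⟧') ∈
      distTriang C :=
  isomorphic_distinguished _ hT _
    (Triangle.isoMk _ _ a.symm b.symm c.symm
      (by change (a.inv ≫ f ≫ b.hom) ≫ b.inv = a.inv ≫ f; simp)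
      (by change (b.inv ≫ g ≫ c.hom) ≫ c.inv = b.inv ≫ g; simp)
      (by
        change (c.inv ≫ h ≫ a.hom⟦(1 : ℤ)⟧') ≫ a.inv⟦(1 : ℤ)⟧' = c.inv ≫ h
        rw [Category.assoc, Category.assoc, ← Functor.map_comp, a.hom_inv_id,
          CategoryTheory.Functor.map_id, Category.comp_id]))

lemma tri_unshift {X Y Z : C} {f : X⟦(1 : ℤ)⟧ ⟶ Y⟦(1 : ℤ)⟧} {g : Y⟦(1 : ℤ)⟧ ⟶ Z⟦(1 : ℤ)⟧}
    {h : Z⟦(1 : ℤ)⟧ ⟶ X⟦(1 : ℤ)⟧⟦(1 : ℤ)⟧} (hT : Triangle.mk f g h ∈ distTriang C) :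
    ∃ (f' : X ⟶ Y) (g' : Y ⟶ Z) (h' : Z ⟶ X⟦(1 : ℤ)⟧), Triangle.mk f' g' h' ∈ distTriang C := by
  obtain ⟨δ, hδ⟩ := tri_shift hT (-1)
  let e := shiftFunctorCompIsoId C (1 : ℤ) (-1) (by simp)
  exact ⟨_, _, _, tri_iso hδ (e.app X) (e.app Y) (e.app Z)⟩

lemma tri_eq_zero_of_comp {X Y Z U : C} {f : X ⟶ Y} {g : Y ⟶ Z} {h : Z ⟶ X⟦(1 : ℤ)⟧}
    (hT : Triangle.mk f g h ∈ distTriang C) (h0 : ∀ v : U ⟶ Z⟦(-1 : ℤ)⟧, v = 0) (u : U ⟶ X)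
    (hu : u ≫ f = 0) : u = 0 := by
  obtain ⟨v, hv⟩ := tri_lift₂ (inv_rot_of_distTriang _ hT) u hu
  have hv0 : v = 0 := h0 v
  rw [← hv, hv0]
  exact zero_comp

variable (T : TStructure C)

lemma tri_isLE₃ {X Y Z : C} {f : X ⟶ Y} {g : Y ⟶ Z} {h : Z ⟶ X⟦(1 : ℤ)⟧}
    (hT : Triangle.mk f g h ∈ distTriang C) {n : ℤ} (hY : T.IsLE Y n) (hX : T.IsLE X (n + 1)) :
    T.IsLE Z n :=
  T.isLE₂ _ (tri_rot hT) n hY (T.isLE_shift X (n + 1) 1 n)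

lemma tri_isGE₃ {X Y Z : C} {f : X ⟶ Y} {g : Y ⟶ Z} {h : Z ⟶ X⟦(1 : ℤ)⟧}
    (hT : Triangle.mk f g h ∈ distTriang C) {n : ℤ} (hY : T.IsGE Y n) (hX : T.IsGE X (n + 1)) :
    T.IsGE Z n :=
  T.isGE₂ _ (tri_rot hT) n hY (T.isGE_shift X (n + 1) 1 n)

lemma tri_isGE₁ {X Y Z : C} {f : X ⟶ Y} {g : Y ⟶ Z} {h : Z ⟶ X⟦(1 : ℤ)⟧}
    (hT : Triangle.mk f g h ∈ distTriang C) {n : ℤ} (hY : T.IsGE Y n) (hZ : T.IsGE Z (n - 1)) :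
    T.IsGE X n := by
  have : T.IsGE (X⟦(1 : ℤ)⟧) (n - 1) := T.isGE₂ _ (tri_rot (tri_rot hT)) (n - 1) hZ
    (T.isGE_shift Y n 1 (n - 1))
  exact (T.isGE_shift_iff X n 1 (n - 1)).1 this

variable {T}

lemma heart_isLE {X : C} (hX : T.heart X) : T.IsLE X 0 := ⟨hX.1⟩

lemma heart_isGE {X : C} (hX : T.heart X) : T.IsGE X 0 := ⟨hX.2⟩

variable (T)

/-- Morphisms from `X` to objects of `D^{≥ 0}` are detected by morphisms `P ⟶ X`. -/
def Generates (P X : C) : Prop :=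
  ∀ (G : C), T.IsGE G 0 → ∀ g : X ⟶ G, (∀ e : P ⟶ X, e ≫ g = 0) → g = 0

/-- An object of the heart that is generated by some `E j`. -/
def IsTors (E : ℤ → C) (i₀ : ℤ) (X : C) : Prop :=
  T.heart X ∧ ∃ j ≤ i₀, Generates T (E j) X

/-- An object of the heart without maps from the `E i`, `i ≤ i₀`. -/
def IsFree (E : ℤ → C) (i₀ : ℤ) (X : C) : Prop :=
  T.heart X ∧ ∀ i ≤ i₀, ∀ f : E i ⟶ X, f = 0

variable {T}

lemma Generates.of_iso {P X Y : C} (hX : Generates T P X) (e : X ≅ Y) : Generates T P Y := by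
  intro G hG g hg
  rw [← cancel_epi e.hom, comp_zero]
  refine hX G hG _ fun a => ?_
  rw [← Category.assoc]
  exact hg _

lemma IsTors.of_iso {E : ℤ → C} {i₀ : ℤ} {X Y : C} (hX : IsTors T E i₀ X) (e : X ≅ Y) :
    IsTors T E i₀ Y := by
  refine ⟨(T.mem_heart_iff Y).2 ?_, ?_⟩
  · obtain ⟨h1, h2⟩ := (T.mem_heart_iff X).1 hX.1
    exact ⟨T.isLE_of_iso e 0, T.isGE_of_iso e 0⟩
  · obtain ⟨j, hj, h⟩ := hX.2
    exact ⟨j, hj, h.of_iso e⟩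

lemma IsTors.of_isZero {E : ℤ → C} {i₀ : ℤ} {X : C} (hX : IsZero X) : IsTors T E i₀ X :=
  ⟨(T.mem_heart_iff X).2 ⟨T.isLE_of_isZero hX _, T.isGE_of_isZero hX _⟩, i₀, le_rfl,
    fun _ _ _ _ => hX.eq_of_src _ _⟩

lemma IsTors.hom_eq_zero {E : ℤ → C} {i₀ : ℤ} {X F : C} (hX : IsTors T E i₀ X)
    (hF : IsFree T E i₀ F) (f : X ⟶ F) : f = 0 := by
  obtain ⟨j, hj, h⟩ := hX.2
  exact h F (heart_isGE hF.1) f fun e => hF.2 j hj _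

variable {k : Type t} [Field k] [Linear k C] [∀ n : ℤ, (shiftFunctor C n).Linear k]
  [HomFiniteCY k C] [ExtBounded C]

lemma chi_heart {X Y : C} (hX : T.heart X) (hY : T.heart Y) :
    chi k X Y = hd k X Y 0 - hd k X Y 1 := by
  refine chi_eq_sub fun n h0 h1 => ?_
  by_cases hn : n < 0
  · exact hd_eq_zero_of_isLE_of_isGE T (heart_isLE hX) (heart_isGE hY) (by lia)
  · exact hd_eq_zero_of_isGE_of_isLE T (heart_isGE hX) (heart_isLE hY) (by lia)

variable {E : ℤ → C} {W : C} {N : ℕ} (hE : IsTwistSeq k E W N) {i₀ : ℤ}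
  (hH : ∀ l ≤ i₀, T.heart (E l))
include hE hH

lemma Generates.of_le {X : C} {j j' : ℤ} (hX : Generates T (E j) X) (h : j' + 2 ≤ j)
    (h0 : j' ≤ i₀) : Generates T (E j') X := by
  intro G hG g hg
  refine hX G hG g fun e => ?_
  by_contra he
  obtain ⟨e', he'⟩ := hE.exists_comp_ne_zero T h (heart_isLE (hH (j' - 3) (by lia))) hG _ he
  refine he' ?_
  rw [← Category.assoc]
  exact hg _

/-- The space is dual to `Hom(X, E l)`. A non-zero map there would be detected by a map `E j ⟶ E l`,
and there is none for `l < j`. -/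
lemma Generates.hom_shift_eq_zero {X : C} {j l : ℤ} (hX : Generates T (E j) X) (h : l < j)
    (h0 : l ≤ i₀) (f : E l ⟶ X⟦(1 : ℤ)⟧) : f = 0 := by
  refine hom_eq_zero_of_serre k (fun u => ?_) f
  refine hX _ (heart_isGE (hH l h0)) u fun e => ?_
  exact hd_zero_eq_zero_iff.1 (hE.hd_eq_zero' h (by lia)) _

lemma IsTors.exists_index {X : C} (hX : IsTors T E i₀ X) : ∃ j ≤ i₀, ∀ l ≤ j,
    Generates T (E l) X ∧ ∀ f : E l ⟶ X⟦(1 : ℤ)⟧, f = 0 := by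
  obtain ⟨-, j, hj, h⟩ := hX
  exact ⟨j - 2, by lia, fun l hl => ⟨h.of_le hE hH (by lia) (by lia),
    h.hom_shift_eq_zero hE hH (by lia) (by lia)⟩⟩

lemma IsTors.chi_eq {X : C} (hX : IsTors T E i₀ X) : ∃ j ≤ i₀, ∀ l ≤ j,
    Generates T (E l) X ∧ chi k (E l) X = hd k (E l) X 0 := by
  obtain ⟨j, hj, h⟩ := hX.exists_index hE hH
  refine ⟨j, hj, fun l hl => ⟨(h l hl).1, ?_⟩⟩
  rw [chi_heart (hH l (by lia)) hX.1, hd_eq_zero_iff.2 (h l hl).2]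
  simp

/-- For `l ≪ 0`, `chi (E l) X` is the dimension of a Hom-space, hence non-negative. It is affine in
`l` with slope `chi W X`. -/
lemma IsTors.chi_nonpos {X : C} (hX : IsTors T E i₀ X) : chi k W X ≤ 0 := by
  obtain ⟨j, hj, h⟩ := hX.chi_eq hE hH
  by_contra hc
  -- Far enough down for a slope of at least 1 to make the value negative.
  have h1 := (h (j - (hd k (E j) X 0 + 1)) (by lia)).2
  rw [hE.chi_left X j, (h j le_rfl).2] at h1
  nlinarith

lemma IsTors.ext {X Y Z : C} {f : X ⟶ Y} {g : Y ⟶ Z} {h : Z ⟶ X⟦(1 : ℤ)⟧}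
    (hT : Triangle.mk f g h ∈ distTriang C) (hX : IsTors T E i₀ X) (hZ : IsTors T E i₀ Z) :
    IsTors T E i₀ Y := by
  obtain ⟨a, ha, hXa⟩ := hX.exists_index hE hH
  obtain ⟨b, hb, hZb⟩ := hZ.exists_index hE hH
  refine ⟨(T.mem_heart_iff Y).2 ⟨T.isLE₂ _ hT 0 (heart_isLE hX.1) (heart_isLE hZ.1),
    T.isGE₂ _ hT 0 (heart_isGE hX.1) (heart_isGE hZ.1)⟩, min a b, by lia, ?_⟩
  obtain ⟨h1, h2⟩ := hXa (min a b) (by lia)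
  obtain ⟨h3, -⟩ := hZb (min a b) (by lia)
  intro G hG u hu
  obtain ⟨v, rfl⟩ := tri_desc₂ hT u (h1 G hG _ fun e => by
    rw [← Category.assoc]
    exact hu _)
  rw [h3 G hG v fun e => ?_, comp_zero]
  -- Maps from the generator to `Z` lift to `Y` because the index is small enough for `Hom(E l,
  -- X[1])` to vanish.
  obtain ⟨e', rfl⟩ := tri_lift₃ hT e (h2 _)
  rw [Category.assoc]
  exact hu e'

variable [IsTriangulated C]

-- In a heart: the kernel `A'` of `X ⟶ G ⟶ Q` is an extension of the kernel `J` of the second map by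
-- the kernel `A` of the first.
omit hE hH [ExtBounded C] [HomFiniteCY k C] [∀ n : ℤ, (shiftFunctor C n).Linear k] [Linear k C] in
lemma tri_extension {X G Q A J : C} {p : X ⟶ G} {a : A ⟶ X} {a' : G ⟶ A⟦(1 : ℤ)⟧}
    (h₁ : Triangle.mk a p a' ∈ distTriang C) {q : G ⟶ Q} {b : J ⟶ G} {b' : Q ⟶ J⟦(1 : ℤ)⟧}
    (h₂ : Triangle.mk b q b' ∈ distTriang C) :
    ∃ (A' : C) (i : A' ⟶ X) (d : Q ⟶ A'⟦(1 : ℤ)⟧) (f : A ⟶ A') (g : A' ⟶ J)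
      (h : J ⟶ A⟦(1 : ℤ)⟧), Triangle.mk i (p ≫ q) d ∈ distTriang C ∧
        Triangle.mk f g h ∈ distTriang C := by
  obtain ⟨A', i, d, h₃⟩ := distinguished_cocone_triangle₁ (p ≫ q)
  obtain ⟨f, g, h, h₄⟩ := tri_unshift (someOctahedron rfl (tri_rot h₁) (tri_rot h₂) (tri_rot h₃)).mem
  exact ⟨A', i, d, f, g, h, h₃, h₄⟩

/-- The image of a non-zero map from `E i` to an object of the heart. -/
lemma exists_isTors_sub {G : C} (hG : T.heart G) {i : ℤ} (hi : i ≤ i₀) (f : E i ⟶ G)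
    (hf : f ≠ 0) : ∃ (J Q : C) (a : J ⟶ G) (b : G ⟶ Q) (c : Q ⟶ J⟦(1 : ℤ)⟧),
      Triangle.mk a b c ∈ distTriang C ∧ IsTors T E i₀ J ∧ T.heart Q ∧ ¬ IsZero J := by
  obtain ⟨Z, g, h, hT⟩ := distinguished_cocone_triangle f
  have hZ0 : T.IsLE Z 0 := tri_isLE₃ T hT (heart_isLE hG)
    (have := heart_isLE (hH i hi); T.isLE_of_le _ 0 _)
  have hZ1 : T.IsGE Z (-1) := tri_isGE₃ T hT (have := heart_isGE hG; T.isGE_of_ge _ _ 0)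
    (heart_isGE (hH i hi))
  -- The cone of `f` lives in degrees -1 and 0. There `Z'` is the shifted kernel of `f` and `Q` is
  -- its cokernel. The cocone `J` of `G ⟶ Q` is the image, and the octahedral axiom relates it to `E
  -- i` and `Z'`.
  obtain ⟨Z', Q, h1, h2, a, b, c, hT'⟩ := T.exists_triangle Z (-1) 0 (by lia)
  have h1 : T.IsLE Z' (-1) := ⟨h1⟩
  have h2 : T.IsGE Q 0 := ⟨h2⟩
  have hQ : T.IsLE Q 0 := tri_isLE₃ T hT' hZ0 (T.isLE_of_le _ (-1) _)
  obtain ⟨J, α, δ, hJ⟩ := distinguished_cocone_triangle₁ (g ≫ b)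
  obtain ⟨f', g', h', hEJ⟩ :=
    tri_unshift (someOctahedron rfl (tri_rot hT) (tri_rot hT') (tri_rot hJ)).mem
  have hJ0 : T.IsLE J 0 := T.isLE₂ _ hEJ 0 (heart_isLE (hH i hi)) (T.isLE_of_le Z' (-1) 0)
  have hJ1 : T.IsGE J 0 := tri_isGE₁ T hJ (heart_isGE hG) (T.isGE_of_ge _ _ 0)
  refine ⟨J, Q, α, g ≫ b, δ, hJ, ⟨(T.mem_heart_iff J).2 ⟨hJ0, hJ1⟩, i - 2, by lia, ?_⟩,
    (T.mem_heart_iff Q).2 ⟨hQ, h2⟩, fun hz => hf ?_⟩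
  · intro G' hG' u hu
    -- Maps from the image to `D^{≥ 0}` are determined on `E i`, where `E (i - 2)` detects them.
    have h0 : f' ≫ u = 0 := by
      by_contra hne
      obtain ⟨e, he⟩ := hE.exists_comp_ne_zero T (j := i - 2) (by lia)
        (heart_isLE (hH _ (by lia))) hG' _ hne
      refine he ?_
      rw [← Category.assoc]
      exact hu _
    obtain ⟨v, rfl⟩ := tri_desc₂ hEJ u h0
    rw [T.zero_of_isLE_of_isGE v (-1) 0 (by lia) h1 hG', comp_zero]
  · obtain ⟨v, hv⟩ := tri_lift₂ hJ f (by rw [← Category.assoc, tri_zero₁₂ hT, zero_comp])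
    rw [← hv, hz.eq_of_tgt v 0, zero_comp]

/-- `A` is a torsion subobject of `X` with quotient `Q`. -/
def TorsSub (T : TStructure C) (E : ℤ → C) (i₀ : ℤ) (X A Q : C) : Prop :=
  IsTors T E i₀ A ∧ T.heart Q ∧ ∃ (f : A ⟶ X) (g : X ⟶ Q) (h : Q ⟶ A⟦(1 : ℤ)⟧),
    Triangle.mk f g h ∈ distTriang C

lemma TorsSub.trans {X A G J Q : C} (h₁ : TorsSub T E i₀ X A G) (h₂ : TorsSub T E i₀ G J Q) :
    ∃ A', TorsSub T E i₀ X A' Q ∧ ∀ U, chi k U A' = chi k U A + chi k U J := by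
  obtain ⟨hA, hG, a, p, a', hT₁⟩ := h₁
  obtain ⟨hJ, hQ, b, q, b', hT₂⟩ := h₂
  obtain ⟨A', i, d, f, g, h, h₃, h₄⟩ := tri_extension hT₁ hT₂
  exact ⟨A', ⟨IsTors.ext hE hH h₄ hA hJ, hQ, i, p ≫ q, d, h₃⟩, fun U => chi_add h₄ U⟩

omit [IsTriangulated C] in
lemma TorsSub.hd_le {X A Q : C} (h : TorsSub T E i₀ X A Q) {l : ℤ} (hl : l ≤ i₀) :
    hd k (E l) A 0 ≤ hd k (E l) X 0 := by
  obtain ⟨hA, hQ, a, p, a', hT⟩ := h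
  have h1 := hd_le₁ (k := k) hT (E l) (n := -1) (m := 0) (by lia)
  have h2 : hd k (E l) Q (-1) = 0 :=
    hd_eq_zero_of_isLE_of_isGE T (heart_isLE (hH l hl)) (heart_isGE hQ) (by lia)
  lia

-- By duality and the triangles of the sequence, lowering the index by one adds at most `hd k X W 0`
-- to the dimension, so growth is at most linear.
omit hH [IsTriangulated C] in
lemma hd_zero_le (X : C) (n : ℕ) : hd k (E (i₀ - n)) X 0 ≤ hd k (E i₀) X 0 + n * hd k X W 0 := by
  induction n with
  | zero => simp
  | succ n ih =>
    obtain ⟨f, g, h, hT⟩ := hE.tri (i₀ - (n + 1))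
    have h1 := hd_le₁ (k := k) hT X (n := 0) (m := 1) (by lia)
    rw [hd_serre X (E _), hd_serre X (E _), sub_self, show i₀ - (n + 1) + 1 = i₀ - n by lia] at h1
    push_cast
    lia

-- For `l ≪ 0`, `chi (E l) A` is the dimension of `Hom(E l, A)`, which embeds in `Hom(E l, X)`.
-- Comparing growth rates as `l → -∞` bounds the slope for `A`, independently of `A`.
omit [IsTriangulated C] in
lemma TorsSub.le_chi {X A Q : C} (h : TorsSub T E i₀ X A Q) : -(hd k X W 0 : ℤ) ≤ chi k W A := by
  obtain ⟨j, hj, hA⟩ := h.1.chi_eq hE hH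
  have key : ∀ l ≤ j, chi k (E i₀) A + (l - i₀) * chi k W A ≤
      hd k (E i₀) X 0 + (i₀ - l) * hd k X W 0 := fun l hl => by
    have h1 := (hA l hl).2
    have h2 := TorsSub.hd_le hE hH h (l := l) (by lia)
    have h3 := hd_zero_le hE (i₀ := i₀) X (i₀ - l).toNat
    rw [show i₀ - ((i₀ - l).toNat : ℤ) = l by lia] at h3
    rw [← hE.chi_left A i₀ l, h1]
    zify at h2 h3
    rw [show ((i₀ - l).toNat : ℤ) = i₀ - l by lia] at h3
    linarith
  by_contra! hc
  obtain ⟨m, hm⟩ : ∃ m : ℕ, (hd k (E i₀) X 0 : ℤ) - chi k (E i₀) A < m :=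
    ⟨((hd k (E i₀) X 0 : ℤ) - chi k (E i₀) A + 1).toNat, by lia⟩
  have := key (j - m) (by lia)
  nlinarith

/-- Each object of the heart is an extension of a torsion free object by a torsion object. -/
theorem exists_torsSub_isFree {X : C} (hX : T.heart X) :
    ∃ A F, TorsSub T E i₀ X A F ∧ IsFree T E i₀ F := by
  have triv : ∀ X, T.heart X → TorsSub T E i₀ X 0 X := fun X hX =>
    ⟨IsTors.of_isZero (isZero_zero C), hX, 0, 𝟙 X, 0, contractible_distinguished₁ X⟩
  obtain ⟨c, ⟨A, G, hA, rfl⟩, hc⟩ := Int.exists_least_of_bdd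
    (P := fun c => ∃ A G, TorsSub T E i₀ X A G ∧ chi k W A = c)
    ⟨_, by rintro z ⟨A, G, hA, rfl⟩; exact hA.le_chi hE hH⟩ ⟨_, _, _, triv X hX, rfl⟩
  -- A torsion subobject `J` of the quotient `G` enlarges `A` and changes `chi W A` by `chi W J ≤
  -- 0`. Minimality forces slope zero.
  have zero : ∀ J Q, TorsSub T E i₀ G J Q → chi k W J = 0 := fun J Q hJ => by
    obtain ⟨A', h1, h2⟩ := TorsSub.trans hE hH hA hJ
    have h3 := hc _ ⟨A', Q, h1, rfl⟩
    rw [h2] at h3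
    have h4 := hJ.1.chi_nonpos hE hH
    lia
  -- With slope zero, `chi (E l) J` does not depend on `l`. It is bounded by the dimension of `Hom(E
  -- i₀, G)`, so a maximal `J` exists.
  obtain ⟨d, ⟨J, Q, hJ, rfl⟩, hmax⟩ := Int.exists_greatest_of_bdd
    (P := fun c => ∃ J Q, TorsSub T E i₀ G J Q ∧ chi k (E i₀) J = c)
    ⟨hd k (E i₀) G 0, by
      rintro z ⟨J, Q, hJ, rfl⟩
      rw [chi_heart (hH i₀ le_rfl) hJ.1.1]
      have := TorsSub.hd_le hE hH hJ le_rfl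
      lia⟩ ⟨_, _, _, triv G hA.2.1, rfl⟩
  obtain ⟨A', hA', -⟩ := TorsSub.trans hE hH hA hJ
  refine ⟨A', Q, hA', hA'.2.1, fun i hi f => ?_⟩
  by_contra hf
  obtain ⟨J', Q', a, b, c, hT, hJ', hQ', hz⟩ := exists_isTors_sub hE hH hA'.2.1 hi f hf
  obtain ⟨J'', h1, h2⟩ := TorsSub.trans hE hH hJ ⟨hJ', hQ', a, b, c, hT⟩
  have h3 := hmax _ ⟨J'', Q', h1, rfl⟩
  have h4 := zero _ _ h1
  rw [h2, zero _ _ hJ] at h4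
  rw [h2] at h3
  -- Adding the image `J'` must not increase the maximum, so `chi (E i₀) J' ≤ 0`. As the slope of
  -- `J'` is zero, `Hom(E j, J') = 0` for a generator `E j` of `J'`, and so `J' = 0`.
  obtain ⟨j, hj, h⟩ := hJ'.chi_eq hE hH
  obtain ⟨h5, h6⟩ := h j le_rfl
  rw [hE.chi_left J' i₀ j] at h6
  have h7 : hd k (E j) J' 0 = 0 := by
    have : chi k W J' = 0 := by lia
    rw [this, mul_zero] at h6
    lia
  refine hz ((IsZero.iff_id_eq_zero J').2 (h5 J' (heart_isGE hJ'.1) _ fun e => ?_))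
  rw [hd_zero_eq_zero_iff.1 h7 e, zero_comp]

end

/-! ### Tilting -/

section

variable {C : Type u} [Category.{v} C] [Preadditive C] [HasZeroObject C] [HasShift C ℤ]
  [∀ n : ℤ, (shiftFunctor C n).Additive] [Pretriangulated C]

/-- The shift of a t-structure. -/
def shiftT (T : TStructure C) (d : ℤ) : TStructure C where
  le n := T.le (n + d)
  ge n := T.ge (n + d)
  le_isClosedUnderIsomorphisms n := T.le_isClosedUnderIsomorphisms _
  ge_isClosedUnderIsomorphisms n := T.ge_isClosedUnderIsomorphisms _
  le_shift n a n' h := T.le_shift _ _ _ (by lia)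
  ge_shift n a n' h := T.ge_shift _ _ _ (by lia)
  zero' X Y f hX hY := T.zero_of_isLE_of_isGE f (0 + d) (1 + d) (by lia) ⟨hX⟩ ⟨hY⟩
  le_zero_le := T.le_monotone (by lia)
  ge_one_le := T.ge_antitone (by lia)
  exists_triangle_zero_one X := T.exists_triangle X (0 + d) (1 + d) (by lia)

lemma shiftT_isLE_iff {T : TStructure C} {d : ℤ} {X : C} {n : ℤ} :
    (shiftT T d).IsLE X n ↔ T.IsLE X (n + d) := ⟨fun h => ⟨h.le⟩, fun h => ⟨h.le⟩⟩

lemma shiftT_isGE_iff {T : TStructure C} {d : ℤ} {X : C} {n : ℤ} :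
    (shiftT T d).IsGE X n ↔ T.IsGE X (n + d) := ⟨fun h => ⟨h.ge⟩, fun h => ⟨h.ge⟩⟩

lemma TBounded.shiftT {T : TStructure C} (hT : TBounded T) (d : ℤ) : TBounded (shiftT T d) := by
  intro X
  obtain ⟨⟨a, ha⟩, ⟨b, hb⟩⟩ := hT X
  exact ⟨⟨a - d, shiftT_isLE_iff.2 (by simpa using ha)⟩,
    ⟨b - d, shiftT_isGE_iff.2 (by simpa using hb)⟩⟩

variable (T : TStructure C) (E : ℤ → C) (i₀ : ℤ)

/-- The objects of `D^{≤ 0}` without maps to torsion free objects. -/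
def TiltLE (X : C) : Prop := T.IsLE X 0 ∧ ∀ F, IsFree T E i₀ F → ∀ f : X ⟶ F, f = 0

/-- The objects of `D^{≥ 0}` without maps from the `E i`, `i ≤ i₀`. -/
def TiltGE (X : C) : Prop := T.IsGE X 0 ∧ ∀ i ≤ i₀, ∀ f : E i ⟶ X, f = 0

variable {T E i₀}

lemma TiltLE.of_iso {X Y : C} (hX : TiltLE T E i₀ X) (e : X ≅ Y) : TiltLE T E i₀ Y := by
  obtain ⟨h1, h2⟩ := hX
  refine ⟨T.isLE_of_iso e 0, fun F hF f => ?_⟩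
  rw [← cancel_epi e.hom, h2 F hF (e.hom ≫ f), comp_zero]

lemma TiltGE.of_iso {X Y : C} (hX : TiltGE T E i₀ X) (e : X ≅ Y) : TiltGE T E i₀ Y := by
  obtain ⟨h1, h2⟩ := hX
  refine ⟨T.isGE_of_iso e 0, fun i hi f => ?_⟩
  rw [← cancel_mono e.inv, h2 i hi (f ≫ e.inv), zero_comp]

lemma TiltLE.of_isLE {X : C} (hX : T.IsLE X (-1)) : TiltLE T E i₀ X :=
  ⟨T.isLE_of_le X (-1) 0, fun F hF f =>
    T.zero_of_isLE_of_isGE f (-1) 0 (by lia) hX (heart_isGE hF.1)⟩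

variable (hH : ∀ l ≤ i₀, T.heart (E l))
include hH

lemma TiltGE.of_isGE {X : C} (hX : T.IsGE X 1) : TiltGE T E i₀ X :=
  ⟨T.isGE_of_ge X 0 1, fun i hi f =>
    T.zero_of_isLE_of_isGE f 0 1 (by lia) (heart_isLE (hH i hi)) hX⟩

lemma TiltLE.hom_eq_zero {X Y : C} (hX : TiltLE T E i₀ X) (hY : TiltGE T E i₀ Y) (g : X ⟶ Y) :
    g = 0 := by
  obtain ⟨Y', Y'', h1, h2, a, b, c, hT⟩ := T.exists_triangle Y 0 1 (by lia)
  have h1 : T.IsLE Y' 0 := ⟨h1⟩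
  have h2 : T.IsGE Y'' 1 := ⟨h2⟩
  have h3 : T.IsGE Y' 0 := tri_isGE₁ T hT hY.1 (T.isGE_of_ge _ _ 1)
  obtain ⟨v, rfl⟩ := tri_lift₂ hT g (T.zero_of_isLE_of_isGE _ 0 1 (by lia) hX.1 h2)
  rw [hX.2 Y' ⟨(T.mem_heart_iff _).2 ⟨h1, h3⟩, fun i hi f => ?_⟩ v, zero_comp]
  refine tri_eq_zero_of_comp hT (fun w => ?_) f (hY.2 i hi (f ≫ a))
  have h4 : T.IsGE (Y''⟦(-1 : ℤ)⟧) 1 :=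
    have := T.isGE_shift Y'' 1 (-1) 2
    T.isGE_of_ge _ 1 2
  exact T.zero_of_isLE_of_isGE w 0 1 (by lia) (heart_isLE (hH i hi)) h4

variable {k : Type t} [Field k] [Linear k C] [∀ n : ℤ, (shiftFunctor C n).Linear k]
  [HomFiniteCY k C] [ExtBounded C] [IsTriangulated C] {W : C} {N : ℕ} (hE : IsTwistSeq k E W N)
include hE

/-- Cut `X` not between degrees 0 and 1 but inside degree 0, along the torsion sequence of `H`, the
degree-0 cohomology. `A` consists of the negative part and the torsion part `S`; `B` consists of the
free part `F` and the positive part. -/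
lemma exists_tilt_triangle (X : C) : ∃ (A B : C) (_ : TiltLE T E i₀ A) (_ : TiltGE T E i₀ B)
    (f : A ⟶ X) (g : X ⟶ B) (h : B ⟶ A⟦(1 : ℤ)⟧), Triangle.mk f g h ∈ distTriang C := by
  obtain ⟨P, R, h1, h2, a, b, c, hT₁⟩ := T.exists_triangle X 0 1 (by lia)
  have h1 : T.IsLE P 0 := ⟨h1⟩
  have h2 : T.IsGE R 1 := ⟨h2⟩
  obtain ⟨P₁, H, h3, h4, a₁, b₁, c₁, hT₂⟩ := T.exists_triangle P (-1) 0 (by lia)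
  have h3 : T.IsLE P₁ (-1) := ⟨h3⟩
  have h4 : T.IsGE H 0 := ⟨h4⟩
  have hH0 : T.IsLE H 0 := tri_isLE₃ T hT₂ h1 (T.isLE_of_le _ (-1) _)
  obtain ⟨S, F, ⟨hS, -, a₂, b₂, c₂, hT₃⟩, hF⟩ :=
    exists_torsSub_isFree hE hH ((T.mem_heart_iff H).2 ⟨hH0, h4⟩)
  obtain ⟨A, i, d, f, g, h, hT₄, hT₅⟩ := tri_extension hT₂ hT₃
  obtain ⟨B, q, e, hT₆⟩ := distinguished_cocone_triangle (i ≫ a)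
  have hT₇ := (someOctahedron rfl hT₄ hT₁ hT₆).mem
  refine ⟨A, B, ⟨T.isLE₂ _ hT₅ 0 (T.isLE_of_le P₁ (-1) 0) (heart_isLE hS.1), fun F' hF' u => ?_⟩,
    ⟨T.isGE₂ _ hT₇ 0 (heart_isGE hF.1) (T.isGE_of_ge R 0 1), fun j hj u => ?_⟩, _, _, _, hT₆⟩
  · exact tri_hom_from₂ hT₅ (fun u => (TiltLE.of_isLE h3).2 F' hF' u)
      (fun u => hS.hom_eq_zero hF' u) u
  · exact tri_hom_to₂ hT₇ (fun u => hF.2 j hj u) (fun u => (TiltGE.of_isGE hH h2).2 j hj u) u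

/-- The tilt of a t-structure at the torsion pair generated by the sequence. -/
def tilt : TStructure C where
  le n X := TiltLE T E i₀ (X⟦n⟧)
  -- `TiltGE` is the right orthogonal of `TiltLE`, so it plays the role of `D^{≥ 1}`; hence the
  -- index `n - 1`. The new heart has torsion objects in degree 0 and free ones in degree -1.
  ge n X := TiltGE T E i₀ (X⟦n - 1⟧)
  le_isClosedUnderIsomorphisms n :=
    ⟨fun e hX => TiltLE.of_iso hX ((shiftFunctor C n).mapIso e)⟩
  ge_isClosedUnderIsomorphisms n :=
    ⟨fun e hX => TiltGE.of_iso hX ((shiftFunctor C (n - 1)).mapIso e)⟩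
  le_shift n a n' h X hX := TiltLE.of_iso hX ((shiftFunctorAdd' C a n' n h).app X)
  ge_shift n a n' h X hX :=
    TiltGE.of_iso hX ((shiftFunctorAdd' C a (n' - 1) (n - 1) (by lia)).app X)
  zero' X Y f hX hY := TiltLE.hom_eq_zero hH
    (TiltLE.of_iso hX ((shiftFunctorZero C ℤ).app X))
    (TiltGE.of_iso hY ((shiftFunctorZero' C (1 - 1 : ℤ) (by lia)).app Y)) f
  le_zero_le X hX := by
    have hX' : T.IsLE X 0 := (TiltLE.of_iso hX ((shiftFunctorZero C ℤ).app X)).1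
    exact TiltLE.of_isLE (T.isLE_shift X 0 1 (-1))
  ge_one_le X hX := by
    have hX' : T.IsGE X 0 := (TiltGE.of_iso hX ((shiftFunctorZero' C (1 - 1 : ℤ) (by lia)).app X)).1
    exact TiltGE.of_isGE hH (T.isGE_shift X 0 (0 - 1) 1)
  exists_triangle_zero_one X := by
    obtain ⟨A, B, hA, hB, f, g, h, hT⟩ := exists_tilt_triangle hH hE X
    exact ⟨A, B, hA.of_iso ((shiftFunctorZero C ℤ).symm.app A),
      hB.of_iso ((shiftFunctorZero' C (1 - 1 : ℤ) (by lia)).symm.app B), f, g, h, hT⟩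

lemma tilt_isLE_iff {X : C} {n : ℤ} : (tilt hH hE).IsLE X n ↔ TiltLE T E i₀ (X⟦n⟧) :=
  ⟨fun h => h.le, fun h => ⟨h⟩⟩

lemma tilt_isGE_iff {X : C} {n : ℤ} : (tilt hH hE).IsGE X n ↔ TiltGE T E i₀ (X⟦n - 1⟧) :=
  ⟨fun h => h.ge, fun h => ⟨h⟩⟩

lemma tilt_bounded (hT : TBounded T) : TBounded (tilt hH hE) := by
  intro X
  obtain ⟨⟨a, ha⟩, ⟨b, hb⟩⟩ := hT X
  exact ⟨⟨a + 1, (tilt_isLE_iff hH hE).2 (TiltLE.of_isLE (T.isLE_shift X a (a + 1) (-1)))⟩,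
    ⟨b, (tilt_isGE_iff hH hE).2 (TiltGE.of_isGE hH (T.isGE_shift X b (b - 1) 1))⟩⟩

lemma tilt_heart_iff {X : C} :
    (tilt hH hE).heart X ↔ TiltLE T E i₀ X ∧ TiltGE T E i₀ (X⟦(-1 : ℤ)⟧) := by
  rw [TStructure.mem_heart_iff, tilt_isLE_iff, tilt_isGE_iff, zero_sub]
  exact and_congr_left' ⟨fun h => h.of_iso ((shiftFunctorZero C ℤ).app X),
    fun h => h.of_iso ((shiftFunctorZero C ℤ).symm.app X)⟩

/-- All members of the sequence lie in the heart of the tilt. -/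
lemma tilt_heart (hH' : ∀ i, i₀ < i → T.IsLE (E i) 0 ∧ T.IsGE (E i) (-1)) (i : ℤ) :
    (tilt hH hE).heart (E i) := by
  rw [tilt_heart_iff]
  by_cases hi : i ≤ i₀
  · refine ⟨⟨heart_isLE (hH i hi), fun F hF => hF.2 i hi⟩, TiltGE.of_isGE hH ?_⟩
    have := heart_isGE (hH i hi)
    exact T.isGE_shift (E i) 0 (-1) 1
  · obtain ⟨h1, h2⟩ := hH' i (by lia)
    refine ⟨⟨h1, fun F hF f => ?_⟩, T.isGE_shift (E i) (-1) (-1) 0, fun j hj f => ?_⟩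
    · by_contra hf
      -- `i₀ - 1` is the largest index that is at least 2 below every `i > i₀`. A map to a free
      -- object would be detected there.
      obtain ⟨e, he⟩ := hE.exists_comp_ne_zero T (j := i₀ - 1) (by lia)
        (heart_isLE (hH _ (by lia))) (heart_isGE hF.1) f hf
      exact he (hF.2 _ (by lia) _)
    · exact hd_eq_zero_iff.1 (hE.hd_eq_zero (show j < i by lia) (by lia)) f

omit hH

/-- The members of the sequence of small index lie in a common shift of the heart, and the others
in degrees that differ from it by at most one. -/
lemma exists_degree (hT : TBounded T) : ∃ d i₀ : ℤ, (∀ i ≤ i₀, T.IsLE (E i) d ∧ T.IsGE (E i) d) ∧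
    ∀ i, i₀ < i → T.IsLE (E i) d ∧ T.IsGE (E i) (d - 1) := by
  choose d hdeg using fun i => exists_isLE_isGE T k hT (hE.brick i).indecomposable
  -- A non-zero map `E l ⟶ E i` cannot raise the degree, and by duality it lowers it by at most one.
  -- So `d` is non-increasing and bounded, and its maximum is attained on a half-line towards `-∞`.
  have h1 : ∀ l i, l < i → d i ≤ d l ∧ d l ≤ d i + 1 := fun l i h => by
    have hne : hd k (E l) (E i) 0 ≠ 0 := fun h0 => by
      obtain ⟨f, hf⟩ := hE.exists_ne_zero h
      exact hf (hd_zero_eq_zero_iff.1 h0 f)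
    constructor
    · by_contra hc
      exact hne (hd_eq_zero_of_isLE_of_isGE T (hdeg l).1 (hdeg i).2 (by lia))
    · by_contra hc
      exact hne (hd_eq_zero_of_isGE_of_isLE T (hdeg l).2 (hdeg i).1 (by lia))
  obtain ⟨D, ⟨i₀, rfl⟩, hD⟩ := Int.exists_greatest_of_bdd (P := fun c => ∃ i, d i = c)
    ⟨d 0 + 1, by
      rintro z ⟨i, rfl⟩
      rcases lt_trichotomy i 0 with h | h | h
      · exact (h1 i 0 h).2
      · subst h; lia
      · have := (h1 0 i h).1
        lia⟩ ⟨_, 0, rfl⟩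
  refine ⟨d i₀, i₀, fun i hi => ?_, fun i hi => ?_⟩
  · obtain rfl | hi := eq_or_lt_of_le hi
    · exact hdeg i
    · have h2 : d i = d i₀ := le_antisymm (hD _ ⟨i, rfl⟩) (h1 _ _ hi).1
      rw [← h2]
      exact hdeg i
  · obtain ⟨h2, h3⟩ := h1 _ _ hi
    obtain ⟨h4, h5⟩ := hdeg i
    exact ⟨T.isLE_of_le _ (d i) _, T.isGE_of_ge _ _ (d i)⟩

end

/-! ### The orthogonal of the sequence -/

section

variable {C : Type u} [Category.{v} C] [Preadditive C] [HasZeroObject C] [HasShift C ℤ]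
  [∀ n : ℤ, (shiftFunctor C n).Additive] [Pretriangulated C]
  {k : Type t} [Field k] [Linear k C]

variable (k) in
/-- The object `X` satisfies `RHom(E i, X) = 0` for `i ≤ i₀`. -/
def Perp (E : ℤ → C) (i₀ : ℤ) (X : C) : Prop := ∀ i ≤ i₀, ∀ n, hd k (E i) X n = 0

lemma Perp.shift {E : ℤ → C} {i₀ : ℤ} {X : C} (hX : Perp k E i₀ X) (m : ℤ) :
    Perp k E i₀ (X⟦m⟧) := fun i hi n => by rw [hd_shift_right, hX i hi]

lemma Perp.of_shift {E : ℤ → C} {i₀ : ℤ} {X : C} {m : ℤ} (hX : Perp k E i₀ (X⟦m⟧)) :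
    Perp k E i₀ X := fun i hi n => by
  have := hX i hi (n - m)
  rwa [hd_shift_right, add_sub_cancel] at this

variable [∀ n : ℤ, (shiftFunctor C n).Linear k] [HomFiniteCY k C]

lemma Perp.of_retract {E : ℤ → C} {i₀ : ℤ} {X Y : C} (r : Retract X Y) (hY : Perp k E i₀ Y) :
    Perp k E i₀ X := fun i hi n => hd_eq_zero_iff.2 fun f => by
  rw [← Category.comp_id f, ← CategoryTheory.Functor.map_id, ← r.retract, Functor.map_comp,
    ← Category.assoc, hd_eq_zero_iff.1 (hY i hi n) (f ≫ r.i⟦n⟧'), zero_comp]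

variable [ExtBounded C] [IsTriangulated C]
  {E : ℤ → C} {W : C} {N : ℕ} (hE : IsTwistSeq k E W N) {i₀ : ℤ}
  {T : TStructure C} (hH : ∀ l ≤ i₀, T.heart (E l))

lemma Perp.isFree {F : C} (hF : Perp k E i₀ F) (hF' : T.heart F) : IsFree T E i₀ F :=
  ⟨hF', fun i hi f => hd_zero_eq_zero_iff.1 (hF i hi 0) f⟩

/-- Having no maps from the `E i`, `F` has a degree-0 cohomology that is free for `T`, and the
tilted heart allows no map from `F` to it. So `F` is concentrated in degree -1. Then degrees -1 and
0 of `RHom(E i, F)` vanish by the two freeness conditions, and all others vanish for degree reasons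
and by duality. -/
lemma perp_of_isFree_tilt {F : C} (hF : IsFree (tilt hH hE) E i₀ F) : Perp k E i₀ F := by
  obtain ⟨hF, hF0⟩ := hF
  obtain ⟨⟨h1, h2⟩, ⟨h3, h4⟩⟩ := (tilt_heart_iff hH hE).1 hF
  have h5 : T.IsGE F (-1) := (T.isGE_shift_iff F (-1) (-1) 0).1 h3
  obtain ⟨F₁, T₀, h6, h7, a, b, c, hT⟩ := T.exists_triangle F (-1) 0 (by lia)
  have h6 : T.IsLE F₁ (-1) := ⟨h6⟩
  have h7 : T.IsGE T₀ 0 := ⟨h7⟩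
  have h8 : T.IsLE T₀ 0 := tri_isLE₃ T hT h1 (T.isLE_of_le _ (-1) _)
  have h9 : b = 0 := h2 T₀ ⟨(T.mem_heart_iff _).2 ⟨h8, h7⟩, fun i hi => by
    refine tri_hom_to₃ hT (hF0 i hi) ((hd_eq_zero_iff (k := k)).1 ?_)
    exact hd_eq_zero_of_isGE_of_isLE (k := k) T (heart_isGE (hH i hi)) h6 (by lia)⟩ b
  obtain ⟨s, hs⟩ := tri_lift₂ hT (𝟙 F) (by rw [h9, comp_zero])
  have h10 : T.IsLE F (-1) := isLE_of_retract T ⟨s, a, hs⟩ h6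
  intro i hi n
  rcases lt_trichotomy n (-1) with hn | rfl | hn
  · exact hd_eq_zero_of_isLE_of_isGE T (heart_isLE (hH i hi)) h5 (by lia)
  · exact hd_eq_zero_iff.2 (h4 i hi)
  · obtain rfl | hn := eq_or_ne n 0
    · exact hd_zero_eq_zero_iff.2 (hF0 i hi)
    · exact hd_eq_zero_of_isGE_of_isLE T (heart_isGE (hH i hi)) h10 (by lia)

/-- The kernel of the evaluation at a generator, as a shifted cone. -/
lemma Generates.exists_triangle {X : C} (hX : T.heart X) {j : ℤ} (hj : T.heart (E j))
    (h : Generates T (E j) X) : ∃ (V K : C) (p : Power (E j) V (Module.finrank k (E j ⟶ X)))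
      (ev : V ⟶ X) (g : X ⟶ K⟦(1 : ℤ)⟧) (δ : K⟦(1 : ℤ)⟧ ⟶ V⟦(1 : ℤ)⟧),
      IsEv k p ev ∧ Triangle.mk ev g δ ∈ distTriang C ∧ T.heart K := by
  obtain ⟨V, p, ev, hev⟩ := exists_isEv k (E j) X
  obtain ⟨Z, q, δ, hT⟩ := distinguished_cocone_triangle ev
  have hV : T.heart V := by
    refine (T.mem_heart_iff V).2 ⟨?_, ?_⟩
    · rw [T.isLE_iff_orthogonal 0 1 (by lia)]
      intro G g hG
      refine p.hom_ext fun i => ?_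
      rw [comp_zero]
      exact T.zero_of_isLE_of_isGE _ 0 1 (by lia) (heart_isLE hj) hG
    · rw [T.isGE_iff_orthogonal (-1) 0 (by lia)]
      intro G g hG
      refine p.hom_ext' fun i => ?_
      rw [zero_comp]
      exact T.zero_of_isLE_of_isGE _ (-1) 0 (by lia) hG (heart_isGE hj)
  -- Generation says exactly that the evaluation is an epimorphism, so its cone is a shifted kernel.
  have hZ1 : T.IsLE Z (-1) := by
    rw [T.isLE_iff_orthogonal (-1) 0 (by lia)]
    intro G v hG
    have h1 : q ≫ v = 0 := h G hG _ fun e => by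
      obtain ⟨s, rfl⟩ := hev.fac e
      rw [Category.assoc, ← Category.assoc ev, tri_zero₁₂ hT, zero_comp, comp_zero]
    obtain ⟨u, rfl⟩ := tri_desc₃ hT v h1
    have := heart_isLE hV
    rw [T.zero_of_isLE_of_isGE u (-1) 0 (by lia) (T.isLE_shift V 0 1 (-1)) hG, comp_zero]
  have hZ2 : T.IsGE Z (-1) := tri_isGE₃ T hT (have := heart_isGE hX; T.isGE_of_ge _ _ 0)
    (heart_isGE hV)
  have e : Z ≅ Z⟦(-1 : ℤ)⟧⟦(1 : ℤ)⟧ := ((shiftFunctorCompIsoId C (-1 : ℤ) 1 (by simp)).app Z).symm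
  exact ⟨V, Z⟦(-1 : ℤ)⟧, p, ev, _, _, hev, tri_iso₃ hT e,
    (T.mem_heart_iff _).2 ⟨T.isLE_shift Z (-1) (-1) 0, T.isGE_shift Z (-1) (-1) 0⟩⟩

variable (hfree : ∀ F, IsFree T E i₀ F → Perp k E i₀ F)
include hE hH hfree

/-- Present `X` as the quotient of a power `V` of `E j` by `K`. The orthogonal admits no maps to
`V`, by duality. Hence the free part of `K`, being both orthogonal and a subobject of `V`, vanishes,
and `K` is torsion. Finally `Hom(F, K[1])` is dual to `Hom(K, F) = 0`, so nothing maps from `F` to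
`X`. -/
lemma Perp.hom_isTors_eq_zero {F X : C} (hF : Perp k E i₀ F) (hF' : T.heart F)
    (hX : IsTors T E i₀ X) (f : F ⟶ X) : f = 0 := by
  obtain ⟨hX, j, hj, h⟩ := hX
  obtain ⟨V, K, p, ev, g, δ, hev, hT, hK⟩ := h.exists_triangle (k := k) hX (hH j hj)
  have hFV : ∀ F, Perp k E i₀ F → ∀ f : F ⟶ V, f = 0 := fun F hF f => p.hom_ext' fun i => by
    rw [zero_comp]
    refine (hd_zero_eq_zero_iff (k := k)).1 ?_ _
    rw [hd_serre, hF j hj]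
  obtain ⟨A, Q, ⟨hA, -, a, b, c, hT'⟩, hQ⟩ := exists_torsSub_isFree hE hH hK
  have hc : c = 0 := hom_eq_zero_of_serre k (fun u => hA.hom_eq_zero hQ u) c
  obtain ⟨s, hs⟩ := tri_lift₃ hT' (𝟙 Q) (by rw [hc, comp_zero])
  have hs0 : s⟦(1 : ℤ)⟧' = 0 := by
    have h1 : s⟦(1 : ℤ)⟧' ≫ δ = 0 := by
      obtain ⟨r, hr⟩ := (shiftFunctor C (1 : ℤ)).map_surjective (s⟦(1 : ℤ)⟧' ≫ δ)
      rw [← hr, hFV Q (hfree Q hQ) r, Functor.map_zero]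
    obtain ⟨v, hv⟩ := tri_lift₃ hT _ h1
    have h2 := heart_isLE hQ.1
    rw [← hv, T.zero_of_isLE_of_isGE v (-1) 0 (by lia) (T.isLE_shift Q 0 1 (-1)) (heart_isGE hX),
      zero_comp]
  have hQ0 : IsZero Q := by
    rw [IsZero.iff_id_eq_zero, ← hs, (shiftFunctor C (1 : ℤ)).map_injective
      (hs0.trans (Functor.map_zero _ _ _).symm), zero_comp]
  refine tri_hom_to₂ hT (hFV F hF) (hom_eq_zero_of_serre k fun u => ?_) f
  exact tri_hom_from₂ hT' (fun u => hA.hom_eq_zero (hF.isFree hF') u)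
    (fun u => hQ0.eq_of_src _ _) u

/-- A shift of `X` lies in the heart, where its torsion sequence splits because `Ext¹(Q, A)` is dual
to `Hom(A, Q) = 0`. -/
lemma perp_or_isTors (hTb : TBounded T) {X : C} (hX : Indecomposable X) :
    Perp k E i₀ X ∨ ∃ m : ℤ, IsTors T E i₀ (X⟦m⟧) := by
  obtain ⟨d, h1, h2⟩ := exists_isLE_isGE T k hTb hX
  have hXd : T.heart (X⟦d⟧) :=
    (T.mem_heart_iff _).2 ⟨T.isLE_shift X d d 0, T.isGE_shift X d d 0⟩
  obtain ⟨A, Q, ⟨hA, -, a, b, c, hT⟩, hQ⟩ := exists_torsSub_isFree hE hH hXd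
  have hc : c = 0 := hom_eq_zero_of_serre k (fun u => hA.hom_eq_zero hQ u) c
  obtain ⟨e, -, -⟩ := exists_iso_binaryBiproduct_of_distTriang _ hT hc
  rcases (indecomposable_shift hX d).2 _ _ e with hz | hz
  · left
    have hz : IsZero A := hz
    refine Perp.of_shift (m := d) fun i hi n => ?_
    have h3 := hd_le₂ (k := k) hT (E i) n
    rw [hfree Q hQ i hi n, hd_eq_zero_iff.2 fun f => ((shiftFunctor C n).map_isZero hz).eq_of_tgt f 0]
      at h3
    lia
  · right
    have hz : IsZero Q := hz
    exact ⟨d, IsTors.ext hE hH hT hA (IsTors.of_isZero hz)⟩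

lemma Perp.hd_eq_zero (hTb : TBounded T) {F X : C} (hF : Perp k E i₀ F) (hF' : Indecomposable F)
    {m : ℤ} (hX : IsTors T E i₀ (X⟦m⟧)) (n : ℤ) : hd k F X n = 0 := by
  obtain ⟨d, h1, h2⟩ := exists_isLE_isGE T k hTb hF'
  have hFd : T.heart (F⟦d⟧) :=
    (T.mem_heart_iff _).2 ⟨T.isLE_shift F d d 0, T.isGE_shift F d d 0⟩
  have key : ∀ n, hd k (F⟦d⟧) (X⟦m⟧) n = 0 := fun n => by
    obtain rfl | h0 := eq_or_ne n 0
    · exact hd_zero_eq_zero_iff.2 fun f => (hF.shift d).hom_isTors_eq_zero hE hH hfree hFd hX f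
    obtain rfl | h1 := eq_or_ne n 1
    · rw [hd_serre]
      exact hd_zero_eq_zero_iff.2 fun f => hX.hom_eq_zero ((hF.shift d).isFree hFd) f
    by_cases hn : n < 0
    · exact hd_eq_zero_of_isLE_of_isGE T (heart_isLE hFd) (heart_isGE hX.1) (by lia)
    · exact hd_eq_zero_of_isGE_of_isLE T (heart_isGE hFd) (heart_isLE hX.1) (by lia)
  have := key (n + d - m)
  rwa [hd_shift_left, hd_shift_right, show m + (n + d - m - d) = n by lia] at this

/-- The orthogonal and the shifts of torsion objects are mutually Hom-orthogonal in all degrees, the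
reverse direction by duality. So no non-zero map joins the two classes. -/
lemma perp_iff_of_indecArrow (hTb : TBounded T) {X Y : C} (h : IndecArrow X Y) :
    Perp k E i₀ X ↔ Perp k E i₀ Y := by
  obtain ⟨hX, hY, f, hf⟩ := h
  constructor
  · intro h
    refine (perp_or_isTors hE hH hfree hTb hY).resolve_right ?_
    rintro ⟨m, hm⟩
    exact hf (hd_zero_eq_zero_iff.1 (h.hd_eq_zero hE hH hfree hTb hX hm 0) f)
  · intro h
    refine (perp_or_isTors hE hH hfree hTb hX).resolve_right ?_
    rintro ⟨m, hm⟩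
    refine hf ((hd_zero_eq_zero_iff (k := k)).1 ?_ f)
    rw [hd_serre]
    exact h.hd_eq_zero hE hH hfree hTb hY hm _

/-- The orthogonal of the sequence vanishes if the heart of some t-structure is connected. -/
theorem Perp.isZero (hTb : TBounded T) (T₀ : TStructure C) (hT₀ : TBounded T₀)
    (hconn : ∀ X Y : C, Indecomposable X → Indecomposable Y → T₀.heart X → T₀.heart Y →
      Relation.EqvGen IndecArrow X Y) (hE₀ : T₀.heart (E 0)) {F : C} (hF : Perp k E i₀ F) :
    IsZero F := by
  by_contra hF0
  obtain ⟨F', r, hF'⟩ := exists_indecomposable_retract k hF0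
  obtain ⟨d, h1, h2⟩ := exists_isLE_isGE T₀ k hT₀ hF'
  have hFd : T₀.heart (F'⟦d⟧) :=
    (T₀.mem_heart_iff _).2 ⟨T₀.isLE_shift F' d d 0, T₀.isGE_shift F' d d 0⟩
  have key : ∀ X Y : C, Relation.EqvGen IndecArrow X Y → (Perp k E i₀ X ↔ Perp k E i₀ Y) := by
    intro X Y h
    induction h with
    | rel X Y h => exact perp_iff_of_indecArrow hE hH hfree hTb h
    | refl X => exact Iff.rfl
    | symm X Y h ih => exact ih.symm
    | trans X Y Z h h' ih ih' => exact ih.trans ih'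
  have h3 := (key _ _ (hconn _ _ (indecomposable_shift hF' d) (hE.brick 0).indecomposable hFd
    hE₀)).1 ((hF.of_retract r).shift d)
  -- Connectedness has put `E 0` in the orthogonal, but it receives a non-zero map from a member of
  -- index `≤ i₀` and `< 0`.
  obtain ⟨f, hf⟩ := hE.exists_ne_zero (show min i₀ (-1) < 0 by lia)
  exact hf (hd_zero_eq_zero_iff.1 (h3 _ (by lia) 0) f)

/-- If the orthogonal of the sequence vanishes, then all objects of the heart are torsion. -/
lemma isTors_of_perp (h0 : ∀ F, Perp k E i₀ F → IsZero F) {X : C} (hX : T.heart X) :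
    IsTors T E i₀ X := by
  obtain ⟨A, Q, ⟨hA, -, a, b, c, hT⟩, hQ⟩ := exists_torsSub_isFree hE hH hX
  exact IsTors.ext hE hH hT hA (IsTors.of_isZero (h0 Q (hfree Q hQ)))

end

/-! ### The t-structure of an ample sequence -/

section

variable {C : Type u} [Category.{v} C] [Preadditive C] [HasZeroObject C] [HasShift C ℤ]
  [∀ n : ℤ, (shiftFunctor C n).Additive] [Pretriangulated C]
  {k : Type t} [Field k] [Linear k C] [∀ n : ℤ, (shiftFunctor C n).Linear k] [HomFiniteCY k C]

lemma isBounded_of_tBounded {T : TStructure C} (hT : TBounded T) : IsBounded T := by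
  refine ⟨fun X hX => ?_, fun X hX => ?_⟩
  · obtain ⟨-, n, hn⟩ := hT X
    exact isZero_of_isLE_of_isGE T (show n - 1 < n by lia) ⟨hX _⟩ hn
  · obtain ⟨⟨n, hn⟩, -⟩ := hT X
    exact isZero_of_isLE_of_isGE T (show n < n + 1 by lia) hn ⟨hX _⟩

variable (k) in
include k in
omit [∀ n : ℤ, (shiftFunctor C n).Linear k] in
lemma isSplit (T : TStructure C) : IsSplit T := fun _ _ h1 h3 =>
  hom_shift_eq_zero T k ⟨h1⟩ ⟨h3⟩ (by lia) _

variable [ExtBounded C] [IsTriangulated C]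

/-- A twist sequence that starts in a connected heart lies in the heart of a bounded t-structure
all of whose objects are generated by members of the sequence. -/
theorem exists_tStructure {E : ℤ → C} {W : C} {N : ℕ} (hE : IsTwistSeq k E W N)
    (T₀ : TStructure C) (hT₀ : TBounded T₀)
    (hconn : ∀ X Y : C, Indecomposable X → Indecomposable Y → T₀.heart X → T₀.heart Y →
      Relation.EqvGen IndecArrow X Y) (hE₀ : T₀.heart (E 0)) :
    ∃ (T : TStructure C) (i₀ : ℤ), TBounded T ∧ (∀ i, T.heart (E i)) ∧
      ∀ X, T.heart X → IsTors T E i₀ X := by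
  obtain ⟨d, i₀, h1, h2⟩ := exists_degree hE hT₀
  have hH : ∀ i ≤ i₀, (shiftT T₀ d).heart (E i) := fun i hi =>
    (TStructure.mem_heart_iff _ _).2 ⟨shiftT_isLE_iff.2 (by simpa using (h1 i hi).1),
      shiftT_isGE_iff.2 (by simpa using (h1 i hi).2)⟩
  have hH' := tilt_heart hH hE fun i hi => ⟨shiftT_isLE_iff.2 (by simpa using (h2 i hi).1),
    shiftT_isGE_iff.2 (by simpa [neg_add_eq_sub] using (h2 i hi).2)⟩
  have hb := tilt_bounded hH hE (hT₀.shiftT d)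
  have hfree : ∀ F, IsFree (tilt hH hE) E i₀ F → Perp k E i₀ F :=
    fun F hF => perp_of_isFree_tilt hE hH hF
  refine ⟨tilt hH hE, i₀, hb, hH', fun X hX => ?_⟩
  -- The torsion theory is now applied a second time, in the tilted heart.
  exact isTors_of_perp hE (fun l _ => hH' l) hfree
    (fun F hF => hF.isZero hE (fun l _ => hH' l) hfree hb T₀ hT₀ hconn hE₀) hX

variable {E : ℤ → C} {W : C} {N : ℕ} (hE : IsTwistSeq k E W N) {T : TStructure C} {i₀ : ℤ}
  (hT : TBounded T) (hH : ∀ i, T.heart (E i)) (htors : ∀ X, T.heart X → IsTors T E i₀ X)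

-- Each half of a t-structure is closed under summands and finite sums, and an indecomposable object
-- lies in one of the halves. So both are determined by the indecomposables of `D^{≤ 0}`.
include k in
omit [ExtBounded C] [IsTriangulated C] [∀ n : ℤ, (shiftFunctor C n).Linear k] in
lemma le_iff_addClosure (P : C → Prop) (hP : ∀ X, Indecomposable X → (T.le 0 X ↔ P X)) :
    T.le 0 = addClosure P ∧ T.ge 1 = addClosure fun X => ¬ P X := by
  constructor
  · ext X
    constructor
    · intro hX
      obtain ⟨n, Y, hY, ⟨e⟩⟩ := exists_iso_biproduct_indecomposable k X
      refine ⟨n, Y, fun j => ⟨hY j, (hP _ (hY j)).1 ?_⟩, ⟨e⟩⟩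
      exact (isLE_of_retract T ⟨biproduct.ι Y j ≫ e.inv, e.hom ≫ biproduct.π Y j, by simp⟩
        (⟨hX⟩ : T.IsLE X 0)).le
    · rintro ⟨n, Y, hY, ⟨e⟩⟩
      have := isLE_biproduct T Y (n := 0) fun j => ⟨(hP _ (hY j).1).2 (hY j).2⟩
      exact (T.isLE_of_iso e.symm 0).le
  · ext X
    constructor
    · intro hX
      obtain ⟨n, Y, hY, ⟨e⟩⟩ := exists_iso_biproduct_indecomposable k X
      refine ⟨n, Y, fun j => ⟨hY j, fun h => (hY j).1 ?_⟩, ⟨e⟩⟩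
      have h1 : T.IsGE (Y j) 1 := isGE_of_retract T
        ⟨biproduct.ι Y j ≫ e.inv, e.hom ≫ biproduct.π Y j, by simp⟩ (⟨hX⟩ : T.IsGE X 1)
      exact isZero_of_isLE_of_isGE T (show (0 : ℤ) < 1 by lia) ⟨(hP _ (hY j)).2 h⟩ h1
    · rintro ⟨n, Y, hY, ⟨e⟩⟩
      have := isGE_biproduct T Y (n := 1) fun j => by
        rcases isLE_or_isGE T k (hY j).1 0 with h | h
        · exact absurd ((hP _ (hY j).1).1 h.le) (hY j).2
        · exact h
      exact (T.isGE_of_iso e.symm 1).ge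

include hE hT hH htors

/-- The t-structure consists of the successors of the sequence and their complement. -/
theorem le_eq_pathLE : T.le 0 = pathLE E ∧ T.ge 1 = pathGE E := by
  refine le_iff_addClosure (k := k) _ fun X hX => ⟨fun h => ?_, ?_⟩
  · obtain ⟨d, hd1, hd2⟩ := exists_isLE_isGE T k hT hX
    have hd : d ≤ 0 := by
      by_contra hc
      exact hX.1 (isZero_of_isLE_of_isGE T (show 0 < d by lia) ⟨h⟩ hd2)
    obtain ⟨n, rfl⟩ : ∃ n : ℕ, d = -n := ⟨(-d).toNat, by lia⟩
    clear hd h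
    induction n generalizing X with
    | zero =>
      have hX' : T.heart X := (T.mem_heart_iff X).2 ⟨by simpa using hd1, by simpa using hd2⟩
      -- In the heart a path of length one suffices: a generator has a non-zero map to `X`.
      obtain ⟨-, j, -, hj⟩ := htors X hX'
      refine ⟨j, Relation.ReflTransGen.single ⟨(hE.brick j).indecomposable, hX, ?_⟩⟩
      by_contra! H
      refine hX.1 ((IsZero.iff_id_eq_zero X).2 (hj X (heart_isGE hX') _ fun e => ?_))
      rw [H e, zero_comp]
    | succ n ih =>
      have hY := indecomposable_shift hX (-1)
      obtain ⟨i, hi⟩ := ih _ hY (T.isLE_shift X (-(n + 1 : ℕ)) (-1) (-n) (by push_cast; ring))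
        (T.isGE_shift X (-(n + 1 : ℕ)) (-1) (-n) (by push_cast; ring))
      refine ⟨i, hi.tail ⟨hY, hX, ?_⟩⟩
      by_contra! H
      -- `Hom(X[-1], X) ≅ Hom(X, X[1])` is dual to `End X`, hence non-zero. So a path can be
      -- extended from `X[-1]` to `X`.
      have h1 : hd k (X⟦(-1 : ℤ)⟧) X 0 = 0 := hd_zero_eq_zero_iff.2 H
      rw [hd_shift_left, hd_serre, show (1 - (0 - -1) : ℤ) = 0 by lia] at h1
      exact hX.1 ((IsZero.iff_id_eq_zero X).2 (hd_zero_eq_zero_iff.1 h1 _))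
  · rintro ⟨i, hi⟩
    induction hi with
    | refl => exact (hH i).1
    | tail _ h ih =>
      obtain ⟨hY, hZ, f, hf⟩ := h
      -- An indecomposable outside `D^{≤ 0}` lies in `D^{≥ 1}`, so paths cannot leave `D^{≤ 0}`.
      rcases isLE_or_isGE T k hZ 0 with h1 | h1
      · exact h1.le
      · exact absurd (T.zero_of_isLE_of_isGE f 0 1 (by lia) ⟨ih hY⟩ h1) hf

omit hT in
lemma exists_forall_hom_shift_eq_zero {X : C} (hX : T.heart X) :
    ∃ n : ℤ, ∀ i < n, Generates T (E i) X ∧ ∀ f : E i ⟶ X⟦(1 : ℤ)⟧, f = 0 := by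
  obtain ⟨j, -, h⟩ := (htors X hX).exists_index hE (fun l _ => hH l)
  exact ⟨j, fun i hi => h i hi.le⟩

-- The kernel of an epimorphism is an object of the heart, hence torsion, so it has no `Ext¹` from
-- `E i` for `i ≪ 0`. This is the obstruction to lifting.
omit hT in
lemma isProjectiveSeq :
    IsProjectiveSeq (H := T.heart.FullSubcategory) (fun i => ⟨E i, hH i⟩) := by
  intro X Y p hp
  obtain ⟨Z, g, δ, hT⟩ := distinguished_cocone_triangle p.hom
  have hX1 := heart_isLE X.property
  have hZ0 : T.IsLE Z 0 := tri_isLE₃ T hT (heart_isLE Y.property)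
    (have := heart_isLE X.property; T.isLE_of_le _ 0 _)
  have hZ1 : T.IsLE Z (-1) := by
    rw [T.isLE_iff_orthogonal (-1) 0 (by lia)]
    intro G v hG
    -- Being an epimorphism only tests against objects of the heart, so `G` is first replaced by its
    -- degree-0 part `P`.
    obtain ⟨P, R, h1, h2, a, b, c, hT'⟩ := T.exists_triangle G 0 1 (by lia)
    have h1 : T.IsLE P 0 := ⟨h1⟩
    have h2 : T.IsGE R 1 := ⟨h2⟩
    have h3 : T.IsGE P 0 := tri_isGE₁ T hT' hG (T.isGE_of_ge _ _ 1)
    obtain ⟨v', rfl⟩ := tri_lift₂ hT' v (T.zero_of_isLE_of_isGE _ 0 1 (by lia) hZ0 h2)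
    let P' : T.heart.FullSubcategory := ⟨P, (T.mem_heart_iff P).2 ⟨h1, h3⟩⟩
    have h4 : (ObjectProperty.homMk (g ≫ v') : Y ⟶ P') = 0 := by
      rw [← cancel_epi p, comp_zero]
      refine ObjectProperty.hom_ext _ ?_
      change p.hom ≫ g ≫ v' = 0
      rw [← Category.assoc, tri_zero₁₂ hT, zero_comp]
    obtain ⟨w, hw⟩ := tri_desc₃ hT v' (congrArg (fun f => f.hom) h4)
    rw [← hw, T.zero_of_isLE_of_isGE w (-1) 0 (by lia) (T.isLE_shift X.obj 0 1 (-1)) h3,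
      comp_zero, zero_comp]
  have hZ2 : T.IsGE Z (-1) := tri_isGE₃ T hT
    (have := heart_isGE Y.property; T.isGE_of_ge _ _ 0) (heart_isGE X.property)
  have hK : T.heart (Z⟦(-1 : ℤ)⟧) :=
    (T.mem_heart_iff _).2 ⟨T.isLE_shift Z (-1) (-1) 0, T.isGE_shift Z (-1) (-1) 0⟩
  obtain ⟨n, hn⟩ := exists_forall_hom_shift_eq_zero hE hH htors hK
  refine ⟨n, fun i hi f => ?_⟩
  let e : Z⟦(-1 : ℤ)⟧⟦(1 : ℤ)⟧ ≅ Z := (shiftFunctorCompIsoId C (-1 : ℤ) 1 (by simp)).app Z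
  have h0 : f.hom ≫ g = 0 := by
    rw [← cancel_mono e.inv, (hn i hi).2 ((f.hom ≫ g) ≫ e.inv), zero_comp]
  obtain ⟨s, hs⟩ := tri_lift₂ hT f.hom h0
  exact ⟨ObjectProperty.homMk s, ObjectProperty.hom_ext _ hs⟩

omit hT in
theorem isAmpleSeq : IsAmpleSeq k (H := T.heart.FullSubcategory) (fun i => ⟨E i, hH i⟩) := by
  refine ⟨⟨isProjectiveSeq hE hH htors, fun X n => ?_⟩, fun X hX => ?_⟩
  · obtain ⟨m, hm⟩ := exists_forall_hom_shift_eq_zero hE hH htors X.property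
    -- A single generator index suffices. It must be at most `n` and strictly below `m`.
    let l := min n (m - 1)
    obtain ⟨V, K, p, ev, g, δ, hev, hT, hK⟩ :=
      (hm l (by lia)).1.exists_triangle (k := k) X.property (hH l)
    obtain ⟨r, hr⟩ := exists_forall_hom_shift_eq_zero hE hH htors hK
    refine ⟨1, fun _ => l, fun _ => by lia, r, fun i hi f => ?_⟩
    -- The obstruction to lifting through the evaluation `V ⟶ X` lies in `Hom(E i, K[1]) = 0`. The
    -- components of the lift give the tensor that maps to `f`.
    obtain ⟨s, hs⟩ := tri_lift₂ hT f.hom ((hr i hi).2 _)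
    obtain ⟨b, hb⟩ := hev
    refine ⟨DirectSum.lof k (Fin 1) _ 0 (∑ a, (ObjectProperty.homMk (s ≫ p.π a)) ⊗ₜ[k]
      (ObjectProperty.homMk (b a))), ?_⟩
    rw [compositionMap, DirectSum.toModule_lof, map_sum]
    simp only [TensorProduct.lift.tmul]
    refine T.heart.ι.map_injective ?_
    rw [Functor.map_sum]
    change ∑ a, (s ≫ p.π a) ≫ b a = f.hom
    conv_rhs => rw [← hs, ← Category.comp_id s, ← p.total, Preadditive.comp_sum,
      Preadditive.sum_comp]
    refine Finset.sum_congr rfl fun a _ => ?_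
    rw [← hb]
    simp
  · obtain ⟨m, hm⟩ := exists_forall_hom_shift_eq_zero hE hH htors X.property
    refine ⟨m, fun i hi => ?_⟩
    by_contra! H
    refine hX ((IsZero.iff_id_eq_zero X).2 (ObjectProperty.hom_ext _ ?_))
    refine (hm i hi).1 X.obj (heart_isGE X.property) _ fun e => ?_
    have := congrArg (fun f => f.hom) (H (ObjectProperty.homMk e))
    have h1 : e = 0 := this
    rw [h1, zero_comp]

end

/-! ### Serre duality and finiteness -/

/-- For an infinite-dimensional space the dual has strictly larger dimension, and the bidual larger
still. -/
lemma finite_of_equiv_dual_dual {k : Type t} [Field k] {V : Type v} [AddCommGroup V] [Module k V]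
    (e : V ≃ₗ[k] Module.Dual k (Module.Dual k V)) : Module.Finite k V := by
  rw [← Module.rank_lt_aleph0_iff]
  by_contra! h
  have h1 := lift_rank_lt_rank_dual h
  have h2 : Cardinal.aleph0 ≤ Module.rank k (Module.Dual k V) := by
    refine le_trans ?_ h1.le
    rwa [Cardinal.aleph0_le_lift]
  have h3 := lift_rank_lt_rank_dual h2
  have h4 := e.lift_rank_eq
  rw [Cardinal.lift_umax.{v, t}, Cardinal.lift_id'.{v, max t v}] at h4
  rw [Cardinal.lift_id'] at h3
  have h5 := h1.trans h3
  rw [← h4] at h5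
  exact lt_irrefl _ h5

/-- Applying duality twice gives `Hom(X, Y) ≅ Hom(X[1], Y[1])^**`, and the shift identifies this
with the bidual of `Hom(X, Y)`. -/
lemma homFiniteCY_of_serre (k : Type t) [Field k] {C : Type u} [Category.{v} C] [Preadditive C]
    [Linear k C] [HasShift C ℤ] [∀ n : ℤ, (shiftFunctor C n).Additive]
    [∀ n : ℤ, (shiftFunctor C n).Linear k] (h : ShiftOneIsSerreFunctor k C) : HomFiniteCY k C := by
  refine ⟨h, fun X Y => ?_⟩
  obtain ⟨η, -⟩ := h
  let e : (X ⟶ Y) ≃ₗ[k] (X⟦(1 : ℤ)⟧ ⟶ Y⟦(1 : ℤ)⟧) := LinearEquiv.ofBijective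
    (Functor.mapLinearMap k (shiftFunctor C (1 : ℤ)) (X := X) (Y := Y))
    ⟨(shiftFunctor C (1 : ℤ)).map_injective, (shiftFunctor C (1 : ℤ)).map_surjective⟩
  exact finite_of_equiv_dual_dual
    (η X Y ≪≫ₗ ((η Y (X⟦(1 : ℤ)⟧)).trans e.dualMap).symm.dualMap)

/-! ### The bounded derived category -/

section

variable {k : Type t} [Field k] {A : Type u} [Category.{v} A] [Abelian A] [Linear k A]
  [HasDerivedCategory.{w} A]

instance (n : ℤ) : (shiftFunctor (DerivedCategory.Bounded A) n).Linear k where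
  map_smul {X Y} f r := by
    let ι : DerivedCategory.Bounded A ⥤ DerivedCategory A :=
      (DerivedCategory.TStructure.t (C := A)).bounded.ι
    refine ι.map_injective ?_
    have h1 := (ι.commShiftIso n).hom.naturality (r • f)
    have h2 := (ι.commShiftIso n).hom.naturality f
    have h3 : ι.map (r • f⟦n⟧') = r • ι.map (f⟦n⟧') := rfl
    have h4 : ι.map (r • f) = r • ι.map f := rfl
    rw [← cancel_mono ((ι.commShiftIso n).hom.app Y), h3, Linear.smul_comp]
    simp only [Functor.comp_map] at h1 h2
    rw [h1, h2, h4, Functor.map_smul, Linear.comp_smul]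

variable (A) in
/-- The canonical functor to the bounded derived category. -/
noncomputable def toDbFunctor : A ⥤ DerivedCategory.Bounded A :=
  ObjectProperty.lift _ (DerivedCategory.singleFunctor A 0) fun X => (toDb X).property

instance : (toDbFunctor A).Full where
  map_surjective f := by
    obtain ⟨g, hg⟩ := (DerivedCategory.singleFunctor A 0).map_surjective f.hom
    exact ⟨g, ObjectProperty.hom_ext _ hg⟩

instance : (toDbFunctor A).Faithful where
  map_injective {_ _} _ _ h :=
    (DerivedCategory.singleFunctor A 0).map_injective (congrArg (fun f => f.hom) h)

instance : (toDbFunctor A).Additive where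
  map_add := ObjectProperty.hom_ext _ ((DerivedCategory.singleFunctor A 0).map_add)

instance : (toDbFunctor A).Linear k where
  map_smul {_ _} f r := ObjectProperty.hom_ext _
    (Functor.Linear.map_smul (F := DerivedCategory.singleFunctor A 0) f r)

lemma tBounded_onBounded : TBounded (DerivedCategory.TStructure.t (C := A)).onBounded := by
  intro X
  obtain ⟨⟨a, ha⟩, ⟨b, hb⟩⟩ := X.property
  exact ⟨⟨b, (ObjectProperty.tStructure_isLE_iff _ _ X b).2 hb⟩,
    ⟨a, (ObjectProperty.tStructure_isGE_iff _ _ X a).2 ha⟩⟩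

lemma heart_toDb (X : A) : (DerivedCategory.TStructure.t (C := A)).onBounded.heart (toDb X) := by
  rw [TStructure.mem_heart_iff]
  refine ⟨(ObjectProperty.tStructure_isLE_iff _ _ _ _).2 ?_,
    (ObjectProperty.tStructure_isGE_iff _ _ _ _).2 ?_⟩
  · exact inferInstanceAs (((DerivedCategory.singleFunctor A 0).obj X).IsLE 0)
  · exact inferInstanceAs (((DerivedCategory.singleFunctor A 0).obj X).IsGE 0)

lemma exists_iso_toDb {X : DerivedCategory.Bounded A}
    (hX : (DerivedCategory.TStructure.t (C := A)).onBounded.heart X) :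
    ∃ S : A, Nonempty (X ≅ toDb S) := by
  obtain ⟨h1, h2⟩ := (TStructure.mem_heart_iff _ _).1 hX
  have h1 : X.obj.IsLE 0 := (ObjectProperty.tStructure_isLE_iff _ _ X 0).1 h1
  have h2 : X.obj.IsGE 0 := (ObjectProperty.tStructure_isGE_iff _ _ X 0).1 h2
  obtain ⟨S, ⟨e⟩⟩ := DerivedCategory.exists_iso_singleFunctor_obj_of_isGE_of_isLE X.obj 0
  exact ⟨S, ⟨ObjectProperty.isoMk _ e⟩⟩

/-- Summands of an object of the heart lie in the heart, so a decomposition in the derived category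
comes from one in `A`. -/
lemma indecomposable_toDb {S : A} (hS : Indecomposable S) : Indecomposable (toDb S) := by
  refine ⟨fun h => hS.1 ?_, fun P Q e => ?_⟩
  · rw [IsZero.iff_id_eq_zero]
    exact (toDbFunctor A).map_injective (h.eq_of_src _ _)
  · have hret : ∀ {Y : DerivedCategory.Bounded A}, Retract Y (toDb S) →
        (DerivedCategory.TStructure.t (C := A)).onBounded.heart Y := fun {Y} r => by
      rw [TStructure.mem_heart_iff]
      exact ⟨isLE_of_retract _ r (heart_isLE (heart_toDb S)),
        isGE_of_retract _ r (heart_isGE (heart_toDb S))⟩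
    obtain ⟨p, ⟨eP⟩⟩ := exists_iso_toDb (hret (Y := P)
      ⟨biprod.inl ≫ e.inv, e.hom ≫ biprod.fst, by simp⟩)
    obtain ⟨q, ⟨eQ⟩⟩ := exists_iso_toDb (hret (Y := Q)
      ⟨biprod.inr ≫ e.inv, e.hom ≫ biprod.snd, by simp⟩)
    have := preservesBinaryBiproducts_of_preservesBiproducts (toDbFunctor A)
    let e' : (toDbFunctor A).obj S ≅ (toDbFunctor A).obj (p ⊞ q) :=
      e ≪≫ biprod.mapIso eP eQ ≪≫ ((toDbFunctor A).mapBiprod p q).symm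
    rcases hS.2 p q ((toDbFunctor A).preimageIso e') with h | h
    · exact Or.inl (((toDbFunctor A).map_isZero h).of_iso eP)
    · exact Or.inr (((toDbFunctor A).map_isZero h).of_iso eQ)

lemma indecArrow_toDb {S S' : A} (h : IndecArrow S S') : IndecArrow (toDb S) (toDb S') := by
  obtain ⟨h1, h2, f, hf⟩ := h
  refine ⟨indecomposable_toDb h1, indecomposable_toDb h2, (toDbFunctor A).map f, fun h0 => hf ?_⟩
  exact (toDbFunctor A).map_injective (h0.trans ((toDbFunctor A).map_zero S S').symm)

lemma eqvGen_of_heart (hA : IndecConnected A) {X Y : DerivedCategory.Bounded A}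
    (hX : Indecomposable X) (hY : Indecomposable Y)
    (hX' : (DerivedCategory.TStructure.t (C := A)).onBounded.heart X)
    (hY' : (DerivedCategory.TStructure.t (C := A)).onBounded.heart Y) :
    Relation.EqvGen IndecArrow X Y := by
  have key : ∀ X : DerivedCategory.Bounded A, Indecomposable X →
      (DerivedCategory.TStructure.t (C := A)).onBounded.heart X →
      ∃ S : A, Indecomposable S ∧ IndecArrow X (toDb S) := fun X hX hX' => by
    obtain ⟨S, ⟨e⟩⟩ := exists_iso_toDb hX'
    have h1 : Indecomposable (toDb S) := indecomposable_of_iso hX e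
    refine ⟨S, indecomposable_of_faithful (toDbFunctor A) h1, hX, h1, e.hom, fun h => hX.1 ?_⟩
    rw [IsZero.iff_id_eq_zero, ← e.hom_inv_id, h, zero_comp]
  obtain ⟨S, hS, hXS⟩ := key X hX hX'
  obtain ⟨S', hS', hYS⟩ := key Y hY hY'
  have h : ∀ S S' : A, Relation.EqvGen IndecArrow S S' →
      Relation.EqvGen IndecArrow (toDb S) (toDb S') := fun S S' h => by
    induction h with
    | rel S S' h => exact .rel _ _ (indecArrow_toDb h)
    | refl S => exact .refl _
    | symm S S' h ih => exact .symm _ _ ih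
    | trans S S' S'' h h' ih ih' => exact .trans _ _ _ ih ih'
  exact .trans _ _ _ (.rel _ _ hXS) (.trans _ _ _ (h S S' (hA S S' hS hS'))
    (.symm _ _ (.rel _ _ hYS)))

lemma EndoSimple.brick {C : Type u} [Category.{v} C] [Preadditive C] [Linear k C] {X : C}
    (hX : EndoSimple k X) : Brick k X := by
  obtain ⟨φ⟩ := hX
  refine ⟨fun h => ?_, fun f => ⟨φ f, ?_⟩⟩
  · have h0 : (1 : End X) = 0 := h.eq_of_src _ _
    have := congrArg φ h0
    rw [map_one, map_zero] at this
    exact one_ne_zero this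
  · have h1 : (f : End X) = φ f • (1 : End X) := φ.injective (by rw [map_smul, map_one]; simp)
    exact h1

lemma Brick.toDb {X : A} (hX : Brick k X) : Brick k (toDb X) := by
  refine ⟨fun h => hX.1 ?_, fun f => ?_⟩
  · rw [IsZero.iff_id_eq_zero]
    exact (toDbFunctor A).map_injective (h.eq_of_src _ _)
  · obtain ⟨g, rfl⟩ := (toDbFunctor A).map_surjective f
    obtain ⟨c, rfl⟩ := hX.2 g
    refine ⟨c, ?_⟩
    rw [Functor.map_smul, CategoryTheory.Functor.map_id]
    rfl

end

end OneCY

theorem mainTheorem4 {k : Type t} [Field k] [IsAlgClosed k]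
    {A : Type u} [Category.{v} A] [Abelian A] [Linear k A]
    [HasExt.{w'} A] [HasDerivedCategory.{w} A]
    (hA : OneCY.IndecConnected A) (hCY : OneCY.IsOneCalabiYau k A)
    (E B : A) (hE : OneCY.EndoSimple k E) (hB : OneCY.EndoSimple k B)
    (hne : IsEmpty (E ≅ B)) (hEB : ∃ f : E ⟶ B, f ≠ 0)
    (𝓔 : ℤ → DerivedCategory.Bounded A)
    (h𝓔 : 𝓔 = OneCY.twistSeq k (OneCY.toDb B) (OneCY.toDb E)) :
    ∃ τ : TStructure (DerivedCategory.Bounded A),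
      τ.le 0 = OneCY.pathLE 𝓔 ∧ τ.ge 1 = OneCY.pathGE 𝓔 ∧
      OneCY.IsBounded τ ∧ OneCY.IsSplit τ ∧
      ∃ hH : ∀ i, τ.heart (𝓔 i),
        OneCY.IsAmpleSeq k (H := τ.heart.FullSubcategory) (fun i => ⟨𝓔 i, hH i⟩) := by
  have := OneCY.homFiniteCY_of_serre k hCY.2
  let T₀ := (DerivedCategory.TStructure.t (C := A)).onBounded
  have hT₀ : OneCY.TBounded T₀ := OneCY.tBounded_onBounded
  have := OneCY.extBounded_of_tBounded T₀ k hT₀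
  have hE' : OneCY.Brick k (OneCY.toDb E) := hE.brick.toDb
  have hB' : OneCY.Brick k (OneCY.toDb B) := hB.brick.toDb
  have hEh : T₀.heart (OneCY.toDb E) := OneCY.heart_toDb E
  have hBh : T₀.heart (OneCY.toDb B) := OneCY.heart_toDb B
  obtain ⟨f, hf⟩ := hEB
  have hf' : (OneCY.toDbFunctor A).map f ≠ 0 := fun h0 =>
    hf ((OneCY.toDbFunctor A).map_injective (h0.trans ((OneCY.toDbFunctor A).map_zero E B).symm))
  -- Non-zero maps in both directions would make `E` and `B` isomorphic. Dually, this vanishing says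
  -- `Ext¹(E, B) = 0`, so `RHom(E, B)` sits in degree 0.
  have hBE : ∀ g : OneCY.toDb B ⟶ OneCY.toDb E, g = 0 := fun g => by
    by_contra hg
    obtain ⟨e⟩ := hE'.nonempty_iso_of_heart T₀ hB' (OneCY.heart_isLE hEh) (OneCY.heart_isGE hEh)
      (OneCY.heart_isLE hBh) (OneCY.heart_isGE hBh) ((OneCY.toDbFunctor A).map f) hf' g hg
    exact hne.false ((OneCY.toDbFunctor A).preimageIso e)
  have hgood : OneCY.GoodFor k (OneCY.toDb B)
      (OneCY.hd k (OneCY.toDb E) (OneCY.toDb B) 0) (OneCY.toDb E) := by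
    refine ⟨hE', fun n hn => ?_, rfl⟩
    obtain rfl | h1 := eq_or_ne n 1
    · rw [OneCY.hd_serre]
      exact OneCY.hd_zero_eq_zero_iff.2 hBE
    by_cases h0 : n < 0
    · exact OneCY.hd_eq_zero_of_isLE_of_isGE T₀ (OneCY.heart_isLE hEh) (OneCY.heart_isGE hBh)
        (by lia)
    · exact OneCY.hd_eq_zero_of_isGE_of_isLE T₀ (OneCY.heart_isGE hEh) (OneCY.heart_isLE hBh)
        (by lia)
  have hpos : 0 < OneCY.hd k (OneCY.toDb E) (OneCY.toDb B) 0 := Nat.pos_of_ne_zero fun h0 =>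
    hf' (OneCY.hd_zero_eq_zero_iff.1 h0 _)
  have hseq := OneCY.GoodFor.isTwistSeq hB'
    (fun n h0 h1 => OneCY.hd_self_eq_zero T₀ hT₀ hB'.indecomposable h0 h1) hpos T₀ hT₀ hgood
  rw [← h𝓔] at hseq
  have h𝓔₀ : T₀.heart (𝓔 0) := by
    rw [h𝓔]
    exact hEh
  obtain ⟨T, i₀, hT, hH, htors⟩ := OneCY.exists_tStructure hseq T₀ hT₀
    (fun X Y hX hY hX' hY' => OneCY.eqvGen_of_heart hA hX hY hX' hY') h𝓔₀
  obtain ⟨h1, h2⟩ := OneCY.le_eq_pathLE hseq hT hH htors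
  exact ⟨T, h1, h2, OneCY.isBounded_of_tBounded hT, OneCY.isSplit k T, hH,
    OneCY.isAmpleSeq hseq hH htors⟩
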